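/- For an integer $N\ge 2$ let $\varphi$ be Euler's totient function, let $r_1,\dots,r_{\varphi(N)}$ be the integers in $\{1,\dots,N\}$ coprime to $N$, and put $$C_N:=N^{\varphi(N)}\prod_{p\mid N}p^{\varphi(N)/(p-1)},\qquad \mathbf B_N(m):=C_N^m\prod_{j=1}^{\varphi(N)}\frac{(r_j/N)_m}{m!},\qquad \mathbf H_N(m):=\sum_{j=1}^{\varphi(N)}H(r_j/N,m)-\varphi(N)H(1,m),$$ where $p$ runs over primes, $(\alpha)_m=\alpha(\alpha+1)\cdots(\alpha+m-1)$ and $H(x,m)=\sum_{n=0}^{m-1}\frac1{x+n}$. Let $k\ge1$, let $N_1,\dots,N_k\ge2$ be integers, and write $\mathbf N=(N_1,\dots,N_k)$, $C_{\mathbf N}=\prod_j C_{N_j}$, $M_{\mathbf N}=\max(N_1,\dots,N_k)$, $\mathbf B_{\mathbf N}(m)=\prod_j\mathbf B_{N_j}(m)$, $\mathbf H_{\mathbf N}(m)=\sum_j\mathbf H_{N_j}(m)$, $$\mathbf F_{\mathbf N}(z)=\sum_{m\ge0}\mathbf B_{\mathbf N}(m)z^m,\qquad \mathbf G_{\mathbf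 N}(z)=\sum_{m\ge1}\mathbf H_{\mathbf N}(m)\mathbf B_{\mathbf N}(m)z^m .$$ Both series converge for $|z|<1/C_{\mathbf N}$ and $\mathbf F_{\mathbf N}$ has no zero there, so that $$\mathbf q_{\mathbf N}(z):=z\exp\big(\mathbf G_{\mathbf N}(z)/\mathbf F_{\mathbf N}(z)\big)$$ is well defined on this disk. Moreover: (i) $\mathbf q_{\mathbf N}$ can be continued to an analytic function on $\mathbb C\setminus[1/C_{\mathbf N},+\infty)$, again denoted by $\mathbf q_{\mathbf N}$. (ii) The point $1/C_{\mathbf N}$ is a branch point of $\mathbf q_{\mathbf N}$: for every $p\in\mathbb C\setminus[1/C_{\mathbf N},+\infty)$ sufficiently close to $1/C_{\mathbf N}$, the germ of $\mathbf q_{\mathbf N}$ at $p$ can be continued analytically along the circle with centre $1/C_{\mathbf N}$ through $p$, traversed once from $p$ to $p$ in either direction, and the germ obtained at the end is different from the initial one. (iii) We have $$\lim_{z\to\infty}\mathbf q_{\mathbf N}(z)=-\exp\big(-\pi\cot(\pi/M_{\mathbf N})\big),$$ where $z$ tends to $\infty$ within $\mathbb C\setminus[1/C_{\mathbf N},+\infty)$.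 -/

import Mathlib

open Filter Topology

noncomputable section

namespace CanonicalCoordinate

/-- The integers `r ∈ {1, …, N}` coprime to `N`. -/
def residues (N : ℕ) : Finset ℕ := (Finset.Icc 1 N).filter (fun r => Nat.Coprime r N)

/-- `C_N = N ^ φ(N) * ∏_{p ∣ N} p ^ (φ(N) / (p - 1))`; the division is exact. -/
def cNum (N : ℕ) : ℕ :=
  N ^ Nat.totient N * ∏ p ∈ N.primeFactors, p ^ (Nat.totient N / (p - 1))

/-- `B_N(m) = C_N ^ m * ∏_r (r / N)_m / m!`. -/
def bCoeff (N m : ℕ) : ℂ :=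
  (cNum N : ℂ) ^ m *
    ∏ r ∈ residues N, (ascPochhammer ℂ m).eval ((r : ℂ) / (N : ℂ)) / (m.factorial : ℂ)

/-- `H(x, m) = ∑_{n < m} 1 / (x + n)`. -/
def harm (x : ℂ) (m : ℕ) : ℂ := ∑ n ∈ Finset.range m, 1 / (x + (n : ℂ))

/-- `H_N(m) = ∑_r H(r / N, m) - φ(N) H(1, m)`. -/
def hCoeff (N m : ℕ) : ℂ :=
  ∑ r ∈ residues N, harm ((r : ℂ) / (N : ℂ)) m - (Nat.totient N : ℂ) * harm 1 m

variable {k : ℕ}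

/-- `C_𝐍 = C_{N_1} ⋯ C_{N_k}`. -/
def cVec (N : Fin k → ℕ) : ℕ := ∏ j, cNum (N j)

/-- `B_𝐍(m) = B_{N_1}(m) ⋯ B_{N_k}(m)`. -/
def bVec (N : Fin k → ℕ) (m : ℕ) : ℂ := ∏ j, bCoeff (N j) m

/-- `H_𝐍(m) = H_{N_1}(m) + ⋯ + H_{N_k}(m)`. -/
def hVec (N : Fin k → ℕ) (m : ℕ) : ℂ := ∑ j, hCoeff (N j) m

/-- `F_𝐍(z) = ∑_{m ≥ 0} B_𝐍(m) z ^ m`. -/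
def fSer (N : Fin k → ℕ) (z : ℂ) : ℂ := ∑' m : ℕ, bVec N m * z ^ m

/-- `G_𝐍(z) = ∑_{m ≥ 1} H_𝐍(m) B_𝐍(m) z ^ m`; the term with `m = 0` is `0`. -/
def gSer (N : Fin k → ℕ) (z : ℂ) : ℂ := ∑' m : ℕ, hVec N m * bVec N m * z ^ m

/-- The canonical coordinate `q_𝐍(z) = z exp(G_𝐍(z) / F_𝐍(z))`, meaningful on the disk of
convergence `|z| < 1 / C_𝐍`. -/
def qFun (N : Fin k → ℕ) (z : ℂ) : ℂ := z * Complex.exp (gSer N z / fSer N z)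

/-- `M_𝐍 = max(N_1, …, N_k)`. -/
def maxN (N : Fin k → ℕ) : ℕ := Finset.univ.sup N

/-- The slit plane `ℂ \ [a, +∞)`. -/
def slit (a : ℝ) : Set ℂ := ((fun x : ℝ => (x : ℂ)) '' Set.Ici a)ᶜ

/-- The germ of `g` at `γ 1` is the analytic continuation of the germ of `f` at `γ 0` along the
curve `γ : [0, 1] → ℂ`: there are function elements `φ t`, analytic at `γ t`, of which neighbouring
ones agree, leading from `f` to `g`. -/
def IsContinuationAlong (γ : ℝ → ℂ) (f g : ℂ → ℂ) : Prop :=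
  ∃ φ : ℝ → ℂ → ℂ,
    (∀ t ∈ Set.Icc (0 : ℝ) 1, AnalyticAt ℂ (φ t) (γ t)) ∧
    (∀ t ∈ Set.Icc (0 : ℝ) 1, ∀ᶠ s in 𝓝[Set.Icc (0 : ℝ) 1] t, φ s =ᶠ[𝓝 (γ s)] φ t) ∧
    φ 0 =ᶠ[𝓝 (γ 0)] f ∧ φ 1 =ᶠ[𝓝 (γ 1)] g

/-- The circle around `z₀` through `p`, run through once from `p` to `p`, counterclockwise for
`σ = 1` and clockwise for `σ = -1`. -/
def turn (z₀ p : ℂ) (σ : ℝ) (t : ℝ) : ℂ :=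
  z₀ + (p - z₀) * Complex.exp (2 * (Real.pi : ℂ) * Complex.I * (σ : ℂ) * (t : ℂ))

/-- `z₀` is a branch point of `f : U → ℂ`: `z₀` is an accumulation point of `U`, and from every
point `p` of `U` near `z₀` (other than `z₀`), in both orientations, `f` can be continued
analytically once around `z₀` along the circle through `p`, and comes back as a different germ
(non-trivial monodromy). -/
def IsBranchPoint (f : ℂ → ℂ) (U : Set ℂ) (z₀ : ℂ) : Prop :=
  AccPt z₀ (𝓟 U) ∧
  ∃ r : ℝ, 0 < r ∧ ∀ p ∈ U, p ≠ z₀ → ‖p - z₀‖ < r → ∀ σ : ℝ, σ = 1 ∨ σ = -1 →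
    ∃ g : ℂ → ℂ, IsContinuationAlong (turn z₀ p σ) f g ∧ ¬ (g =ᶠ[𝓝 p] f)

end CanonicalCoordinate

end

open Filter Topology MeasureTheory Set

noncomputable section

namespace CanonicalCoordinate

/-! Put `w = C z`. For `0 < α < 1` the number `(α)_m / m!` is the `m`-th moment of the Beta law with
parameters `α`, `1 - α`. In the variable `x = -log t` moments become values of a Laplace transform,
and products become convolutions. So the product of `(α_i)_m / m!` over all parameters `α_i = r /
N_j` equals `ℒ(m)`, the Laplace transform of one positive density `ρ(x) = x ^ (b - 1) g(x)` on `(0,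
∞)` (`exists_kernel`, `laplace_natCast`), and summing geometric series gives `F = Φ(w) = ∫ ρ(x) / (1
- w e^{-x}) dx`.

The logarithmic derivative of the recurrence for `ℒ` gives `ℒ'(m) / ℒ(m) = ℒ'(0) + H(m)`. The left
side tends to `0` and `H(m)` tends to `log C` (`tendsto_harmonicDiff_residues`), so `ℒ'(0) = -log
C`. Hence `G = Ψ(w) + log C · Φ(w)`, where `Ψ` is the same transform of `-x ρ(x)`, and `q = w
exp(Ψ(w) / Φ(w))` (`hasSum_hVec`).

Continuation: `Φ` and `Ψ` are holomorphic off `[1, ∞)`. `Φ` has no zero there, being positive on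
real `w < 1` and having an imaginary part of the sign of `Im w` elsewhere (`stieltjes_ne_zero`).

Branch point: `b = ∑ (1 - α_i)` is half an integer. With `w = e^ω` this gives `Φ = A(ω) + S` and `Ψ
= B(ω) - ω S` with `A`, `B` holomorphic and `S = ω ^ j g(ω) E(log(-ω))`, where `E(τ)` is `-τ` or `π
e^{-τ/2}` (`IsKernel.exists_isLocalPair`). A turn around `w = 1` adds to `S` a nonzero `κ` that is
real or purely imaginary when `ω < 0`. Since `Φ > 0`, `Ψ ≤ 0` and `ω < 0` for real `w < 1` near `1`,
this changes `exp(Ψ / Φ)` (`exp_div_add_ne`).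

Limit: with `w = -e^Λ` one has `q = -exp((Λ Φ + Ψ) / Φ)`, and `Λ Φ + Ψ` is the integral of `ρ(x) (Λ
- x) / (1 + e^{Λ - x})`. The density behaves like a power of `x` times `e^{-a x}` with `a = min α_i
= 1 / M`, also in the complex strip. Moving the contour to `Λ + ξ` with `ξ` real shows that the
exponent tends to the logarithmic derivative at `a` of `∫ e^{-aξ} / (1 + e^{-ξ}) dξ = π / sin(πa)`,
that is, to `-π cot(πa)` (`IsKernel.tendsto_infinity`). -/

/-! ### Holomorphic dependence of integrals on a parameter. -/

/-- A parametric integral of holomorphic functions that is locally dominated is holomorphic. -/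
lemma differentiableOn_integral_of_locally_dominated {X : Type*} [MeasurableSpace X]
    {μ : Measure X} {U : Set ℂ} (hU : IsOpen U) {Φ : ℂ → X → ℂ}
    (hm : ∀ z ∈ U, AEStronglyMeasurable (Φ z) μ)
    (hd : ∀ᵐ x ∂μ, DifferentiableOn ℂ (fun z => Φ z x) U)
    (hb : ∀ z₀ ∈ U, ∃ ε > 0, ∃ bound : X → ℝ, Integrable bound μ ∧
      ∀ᵐ x ∂μ, ∀ z ∈ Metric.ball z₀ ε, z ∈ U → ‖Φ z x‖ ≤ bound x) :
    DifferentiableOn ℂ (fun z => ∫ x, Φ z x ∂μ) U := by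
  intro z₀ hz₀
  obtain ⟨ε₁, hε₁, bound, hbi, hbd⟩ := hb z₀ hz₀
  obtain ⟨ε₂, hε₂, hball⟩ := Metric.isOpen_iff.1 hU z₀ hz₀
  -- A closed disc of radius `δ / 2` centred in the `δ`-ball stays inside both given balls, so
  -- Cauchy's estimate bounds the derivative there by `bound x / (δ / 2)`.
  set δ := min ε₁ ε₂ / 2 with hδ
  have hδ0 : 0 < δ := by positivity
  have hsub : ∀ z ∈ Metric.ball z₀ δ, ∀ y ∈ Metric.closedBall z (δ / 2),
      y ∈ Metric.ball z₀ ε₁ ∧ y ∈ U := by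
    intro z hz y hy
    have h1 : dist y z₀ < 2 * δ := by
      have := dist_triangle y z z₀
      simp only [Metric.mem_ball, Metric.mem_closedBall] at hz hy
      linarith
    have h2 : 2 * δ = min ε₁ ε₂ := by rw [hδ]; ring
    rw [h2] at h1
    exact ⟨lt_of_lt_of_le h1 (min_le_left _ _), hball (lt_of_lt_of_le h1 (min_le_right _ _))⟩
  have hdiff : ∀ᵐ x ∂μ, ∀ z ∈ Metric.ball z₀ δ,
      HasDerivAt (fun z => Φ z x) (deriv (fun z => Φ z x) z) z := by
    filter_upwards [hd] with x hx z hz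
    have hzU := (hsub z hz z (Metric.mem_closedBall_self (by positivity))).2
    exact ((hx z hzU).differentiableAt (hU.mem_nhds hzU)).hasDerivAt
  have hle : ∀ᵐ x ∂μ, ∀ z ∈ Metric.ball z₀ δ,
      ‖deriv (fun z => Φ z x) z‖ ≤ bound x / (δ / 2) := by
    filter_upwards [hd, hbd] with x hx hxb z hz
    refine Complex.norm_deriv_le_of_forall_mem_sphere_norm_le (by positivity) ?_ ?_
    · refine DifferentiableOn.diffContOnCl_ball (U := U) hx ?_
      exact fun y hy => (hsub z hz y hy).2
    · intro y hy
      have := hsub z hz y (Metric.sphere_subset_closedBall hy)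
      exact hxb y this.1 this.2
  -- The derivative is a pointwise limit of difference quotients with increments `1 / (n + n₀ + 1)`;
  -- the offset `n₀` keeps all sampled points in `U`.
  have hmeas : AEStronglyMeasurable (fun x => deriv (fun z => Φ z x) z₀) μ := by
    have hlim : Tendsto (fun n : ℕ => z₀ + ((1 / ((n : ℝ) + 1) : ℝ) : ℂ)) atTop (𝓝 z₀) := by
      have := (Complex.continuous_ofReal.tendsto 0).comp
        (tendsto_one_div_add_atTop_nhds_zero_nat (𝕜 := ℝ))
      simpa using (tendsto_const_nhds (x := z₀)).add this
    have hev : ∀ᶠ n : ℕ in atTop, z₀ + ((1 / ((n : ℝ) + 1) : ℝ) : ℂ) ∈ U :=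
      hlim.eventually (hU.mem_nhds hz₀)
    obtain ⟨n₀, hn₀⟩ := eventually_atTop.1 hev
    refine aestronglyMeasurable_of_tendsto_ae (u := atTop)
      (f := fun n : ℕ => fun x => ((((1 / (((n + n₀ : ℕ) : ℝ) + 1) : ℝ) : ℂ))⁻¹ *
        (Φ (z₀ + ((1 / (((n + n₀ : ℕ) : ℝ) + 1) : ℝ) : ℂ)) x - Φ z₀ x))) ?_ ?_
    · intro n
      exact ((hm _ (hn₀ _ (by omega))).sub (hm _ hz₀)).const_mul _
    · filter_upwards [hdiff] with x hx
      have h1 := hasDerivAt_iff_tendsto_slope_zero.1 (hx z₀ (Metric.mem_ball_self hδ0))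
      have h2 : Tendsto (fun n : ℕ => ((1 / (((n + n₀ : ℕ) : ℝ) + 1) : ℝ) : ℂ)) atTop (𝓝[≠] 0) := by
        rw [tendsto_nhdsWithin_iff]
        refine ⟨?_, Eventually.of_forall fun n => ?_⟩
        · have h3 := (Complex.continuous_ofReal.tendsto 0).comp
            (tendsto_one_div_add_atTop_nhds_zero_nat (𝕜 := ℝ))
          exact (by simpa using h3 : Tendsto _ _ _).comp (tendsto_add_atTop_nat n₀) |>.congr
            (fun n => by simp)
        · simp only [mem_compl_iff, mem_singleton_iff, Complex.ofReal_eq_zero]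
          positivity
      exact (h1.comp h2).congr fun n => by simp [smul_eq_mul]
  have key := hasDerivAt_integral_of_dominated_loc_of_deriv_le (μ := μ)
    (F := Φ) (F' := fun z x => deriv (fun z => Φ z x) z) (x₀ := z₀)
    (bound := fun x => bound x / (δ / 2))
    (Metric.ball_mem_nhds z₀ hδ0) (by
      filter_upwards [hU.mem_nhds hz₀] with z hz using hm z hz)
    (hbi.mono' (hm z₀ hz₀) (by
      filter_upwards [hbd] with x hx using hx z₀ (Metric.mem_ball_self hε₁) hz₀))
    hmeas hle (hbi.div_const _) hdiff
  exact key.2.differentiableAt.differentiableWithinAt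

/-! ### Kernels, their growth in the strip, and integrability of densities. -/

/-- The domain of holomorphy of the kernels: the unit disk together with the right half plane. -/
def kernelDomain : Set ℂ := Metric.ball 0 1 ∪ {x | 0 < x.re}

/-- The filter of points tending to `+∞` inside the strip `|Im x| ≤ π`. -/
def stripEnd : Filter ℂ := comap Complex.re atTop ⊓ 𝓟 {x | |x.im| ≤ Real.pi}

/-- The properties of the function `g` in a density `x ^ (b - 1) * g x` on `(0, ∞)`: it is
holomorphic, positive on the real axis, and asymptotic to `c * x ^ e * exp (-a * x)`. -/
structure IsKernel (b a e : ℝ) (g : ℂ → ℂ) : Prop where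
  b_pos : 0 < b
  a_pos : 0 < a
  one_le : 1 ≤ e + b
  diff : DifferentiableOn ℂ g kernelDomain
  real_pos : ∀ x : ℝ, -1 < x → (g x).im = 0 ∧ 0 < (g x).re
  asymp : ∃ c : ℝ, 0 < c ∧
    Tendsto (fun x : ℂ => g x * Complex.exp (a * x) * (((1 + x.re) ^ (-e) : ℝ) : ℂ))
      stripEnd (𝓝 c)

/-- The density `x ^ (b - 1) * g x`. -/
def density (b : ℝ) (g : ℂ → ℂ) (x : ℝ) : ℝ := x ^ (b - 1) * (g x).re

/-- The Laplace transform of the density. -/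
def laplace (b : ℝ) (g : ℂ → ℂ) (s : ℝ) : ℝ :=
  ∫ x in Ioi (0 : ℝ), density b g x * Real.exp (-(s * x))

/-- Dominated convergence along a filter needs the filter to be countably generated. -/
instance : stripEnd.IsCountablyGenerated := by unfold stripEnd; infer_instance

lemma eventually_stripEnd {p : ℂ → Prop} :
    (∀ᶠ x in stripEnd, p x) ↔ ∃ X : ℝ, ∀ x : ℂ, X ≤ x.re → |x.im| ≤ Real.pi → p x := by
  unfold stripEnd
  rw [eventually_inf_principal, eventually_comap, eventually_atTop]
  constructor
  · rintro ⟨X, h⟩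
    exact ⟨X, fun x hx hi => h x.re hx x rfl hi⟩
  · rintro ⟨X, h⟩
    exact ⟨X, fun r hr x hx hi => h x (hx ▸ hr) hi⟩

lemma tendsto_re_stripEnd : Tendsto Complex.re stripEnd atTop :=
  tendsto_comap.mono_left inf_le_left

lemma isOpen_kernelDomain : IsOpen kernelDomain :=
  Metric.isOpen_ball.union (isOpen_lt continuous_const Complex.continuous_re)

/-- The domain is star-shaped about `0`; this is what the convolution kernel needs, since it
evaluates its factors at `x (1 - v)` and `x v`. -/
lemma smul_mem_kernelDomain {x : ℂ} (hx : x ∈ kernelDomain) {v : ℝ} (h0 : 0 ≤ v) (h1 : v ≤ 1) :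
    x * v ∈ kernelDomain := by
  rcases hx with hx | hx
  · left
    simp only [mem_ball_zero_iff, norm_mul, Complex.norm_real, Real.norm_of_nonneg h0] at hx ⊢
    nlinarith [norm_nonneg x]
  · rcases h0.eq_or_lt with rfl | h0
    · left; simp
    · right; simp only [mem_ofPred_eq, Complex.mul_re, Complex.ofReal_re, Complex.ofReal_im,
        mul_zero, sub_zero] at hx ⊢; positivity

lemma ofReal_mem_kernelDomain {x : ℝ} (hx : -1 < x) : (x : ℂ) ∈ kernelDomain := by
  rcases lt_or_ge 0 x with h | h
  · right; simpa using h
  · left; simp [abs_lt]; constructor <;> linarith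

lemma IsKernel.eq_re {b a e : ℝ} {g : ℂ → ℂ} (h : IsKernel b a e g) {x : ℝ} (hx : -1 < x) :
    g x = ((g x).re : ℂ) := by
  apply Complex.ext <;> simp [(h.real_pos x hx).1]

/-- Far out the asymptotics give the bound, and the remaining region is compact. The wedge `|Im x| ≤
π Re x` meets the imaginary axis only at `0`, which lies in the unit disc, so that region is inside
the domain of holomorphy. Half strip and wedge are both stable under multiplication by `v ∈ (0, 1]`.
-/
lemma IsKernel.exists_bound {b a e : ℝ} {g : ℂ → ℂ} (h : IsKernel b a e g) :
    ∃ K : ℝ, 0 < K ∧ ∀ x : ℂ, 0 ≤ x.re → |x.im| ≤ Real.pi → |x.im| ≤ Real.pi * x.re →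
      ‖g x‖ ≤ K * (1 + x.re) ^ e * Real.exp (-(a * x.re)) := by
  obtain ⟨c, hc, hlim⟩ := h.asymp
  have hev : ∀ᶠ x in stripEnd,
      ‖g x * Complex.exp (a * x) * (((1 + x.re) ^ (-e) : ℝ) : ℂ)‖ < ‖(c : ℂ)‖ + 1 :=
    hlim.norm.eventually (gt_mem_nhds (by linarith))
  obtain ⟨X, hX⟩ := eventually_stripEnd.1 hev
  have hcomp : IsCompact {x : ℂ | 0 ≤ x.re ∧ x.re ≤ X ∧ |x.im| ≤ Real.pi ∧
      |x.im| ≤ Real.pi * x.re} := by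
    refine IsCompact.of_isClosed_subset
      (IsCompact.reProdIm (isCompact_Icc (a := (0 : ℝ)) (b := X))
        (isCompact_Icc (a := -Real.pi) (b := Real.pi))) ?_ ?_
    · refine (isClosed_le continuous_const Complex.continuous_re).inter
        ((isClosed_le Complex.continuous_re continuous_const).inter
        ((isClosed_le Complex.continuous_im.abs continuous_const).inter
        (isClosed_le Complex.continuous_im.abs (continuous_const.mul Complex.continuous_re))))
    · rintro x ⟨h1, h2, h3, h4⟩
      exact ⟨⟨h1, h2⟩, abs_le.1 h3⟩
  obtain ⟨K₀, hK₀⟩ := hcomp.exists_bound_of_continuousOn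
    (f := fun x : ℂ => g x * Complex.exp (a * x) * (((1 + x.re) ^ (-e) : ℝ) : ℂ)) (by
      refine ((h.diff.continuousOn.mono ?_).mul (by fun_prop)).mul ?_
      · rintro x ⟨h1, h2, h3, h4⟩
        rcases h1.eq_or_lt with h0 | h0
        · left
          rw [← h0, mul_zero] at h4
          have : x = 0 := Complex.ext h0.symm (by simpa using h4)
          simp [this]
        · right; exact h0
      · refine Complex.continuous_ofReal.comp_continuousOn ?_
        refine ContinuousOn.rpow_const (by fun_prop) ?_
        rintro x ⟨h1, -⟩
        left; linarith)
  refine ⟨max K₀ (‖(c : ℂ)‖ + 1), lt_of_lt_of_le (by positivity) (le_max_right _ _), ?_⟩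
  intro x h1 h2 h3
  have hle : ‖g x * Complex.exp (a * x) * (((1 + x.re) ^ (-e) : ℝ) : ℂ)‖ ≤
      max K₀ (‖(c : ℂ)‖ + 1) := by
    rcases le_total x.re X with hx | hx
    · exact (hK₀ x ⟨h1, hx, h2, h3⟩).trans (le_max_left _ _)
    · exact (hX x hx h2).le.trans (le_max_right _ _)
  have hp : (0 : ℝ) < (1 + x.re) ^ e := Real.rpow_pos_of_pos (by linarith) _
  rw [norm_mul, norm_mul, Complex.norm_exp, Complex.norm_real, Real.rpow_neg (by linarith),
    Real.norm_of_nonneg (by positivity)] at hle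
  have : (↑a * x).re = a * x.re := by simp
  rw [this] at hle
  rw [Real.exp_neg]
  have he := Real.exp_pos (a * x.re)
  calc ‖g x‖ = (‖g x‖ * Real.exp (a * x.re) * ((1 + x.re) ^ e)⁻¹) * (1 + x.re) ^ e *
        (Real.exp (a * x.re))⁻¹ := by field_simp
    _ ≤ _ := by gcongr

lemma exists_one_add_rpow_mul_exp_le (q : ℝ) {δ : ℝ} (hδ : 0 < δ) :
    ∃ K : ℝ, 0 < K ∧ ∀ x : ℝ, 0 ≤ x → (1 + x) ^ q * Real.exp (-(δ * x)) ≤ K := by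
  obtain ⟨n, hn⟩ := exists_nat_gt q
  have hlim : Tendsto (fun x : ℝ => x ^ n * Real.exp (-(δ * x))) atTop (𝓝 0) := by
    have := (Real.tendsto_pow_mul_exp_neg_atTop_nhds_zero n).comp
      (tendsto_id.const_mul_atTop hδ)
    have := this.const_mul (δ ^ n)⁻¹
    simp only [mul_zero] at this
    refine this.congr fun x => ?_
    simp only [Function.comp, id]
    rw [mul_pow]; field_simp
  obtain ⟨X, hX⟩ := eventually_atTop.1 (hlim.eventually (gt_mem_nhds (zero_lt_one)))
  refine ⟨max (Real.exp δ) ((1 + max X 0) ^ n), by positivity, fun x hx => ?_⟩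
  have h1 : (1 + x) ^ q ≤ (1 + x) ^ n := by
    rw [← Real.rpow_natCast]
    exact Real.rpow_le_rpow_of_exponent_le (by linarith) hn.le
  have h2 : (1 + x) ^ q * Real.exp (-(δ * x)) ≤ (1 + x) ^ n * Real.exp (-(δ * x)) := by gcongr
  refine h2.trans ?_
  rcases le_total X (1 + x) with h | h
  · refine le_trans ?_ (le_max_left _ _)
    have h3 := (hX _ h).le
    have : Real.exp (-(δ * x)) = Real.exp (-(δ * (1 + x))) * Real.exp δ := by
      rw [← Real.exp_add]; congr 1; ring
    rw [this, ← mul_assoc]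
    have := Real.exp_pos δ
    nlinarith
  · refine le_trans ?_ (le_max_right _ _)
    have h3 : Real.exp (-(δ * x)) ≤ 1 := Real.exp_le_one_iff.2 (by nlinarith)
    have h4 : (1 + x) ^ n ≤ (1 + max X 0) ^ n := by
      gcongr; exact le_trans (by linarith) (le_max_left _ _)
    have h5 : (0 : ℝ) ≤ (1 + x) ^ n := by positivity
    nlinarith

lemma integrableOn_rpow_mul_one_add_rpow_mul_exp {b : ℝ} (hb : 0 < b) (q : ℝ) {δ : ℝ}
    (hδ : 0 < δ) :
    IntegrableOn (fun x : ℝ => x ^ (b - 1) * (1 + x) ^ q * Real.exp (-(δ * x))) (Ioi 0) := by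
  -- Half of the exponential decay absorbs the factor `(1 + x) ^ q`; the other half is kept for
  -- convergence of the integral.
  obtain ⟨K, hK, hb'⟩ := exists_one_add_rpow_mul_exp_le q (half_pos hδ)
  have h1 : IntegrableOn (fun x : ℝ => x ^ (b - 1) * Real.exp (-(δ / 2) * x)) (Ioi 0) := by
    have := integrableOn_rpow_mul_exp_neg_mul_rpow (s := b - 1) (p := 1) (b := δ / 2)
      (by linarith) one_pos (half_pos hδ)
    simpa using this
  refine Integrable.mono' (h1.const_mul K) ?_ ?_
  · refine ContinuousOn.aestronglyMeasurable ?_ measurableSet_Ioi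
    refine ((ContinuousOn.rpow_const (by fun_prop) ?_).mul
      (ContinuousOn.rpow_const (by fun_prop) ?_)).mul (by fun_prop)
    · intro x hx; left; exact (ne_of_gt hx)
    · intro x hx; left
      have : (0 : ℝ) < x := hx
      positivity
  · refine (ae_restrict_iff' measurableSet_Ioi).2 (Eventually.of_forall fun x hx => ?_)
    have hx : (0 : ℝ) < x := hx
    rw [Real.norm_of_nonneg (by positivity)]
    have h2 := hb' x hx.le
    have : Real.exp (-(δ * x)) = Real.exp (-(δ / 2 * x)) * Real.exp (-(δ / 2) * x) := by
      rw [← Real.exp_add]; congr 1; ring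
    rw [this]
    have h3 : 0 < x ^ (b - 1) * Real.exp (-(δ / 2) * x) := by positivity
    calc _ = (x ^ (b - 1) * Real.exp (-(δ / 2) * x)) *
          ((1 + x) ^ q * Real.exp (-(δ / 2 * x))) := by ring
      _ ≤ (x ^ (b - 1) * Real.exp (-(δ / 2) * x)) * K := by gcongr
      _ = _ := by ring

lemma IsKernel.continuousOn_density {b a e : ℝ} {g : ℂ → ℂ} (h : IsKernel b a e g) :
    ContinuousOn (density b g) (Ioi 0) := by
  unfold density
  refine (ContinuousOn.rpow_const (by fun_prop) ?_).mul ?_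
  · intro x hx; left; exact (ne_of_gt hx)
  · refine Complex.continuous_re.comp_continuousOn
      (h.diff.continuousOn.comp (by fun_prop) fun x hx => ?_)
    right; simpa using hx

lemma IsKernel.density_pos {b a e : ℝ} {g : ℂ → ℂ} (h : IsKernel b a e g) {x : ℝ} (hx : 0 < x) :
    0 < density b g x :=
  mul_pos (Real.rpow_pos_of_pos hx _) (h.real_pos x (by linarith)).2

lemma IsKernel.integrableOn_mul {b a e : ℝ} {g : ℂ → ℂ} (h : IsKernel b a e g)
    {E : Type*} [NormedAddCommGroup E] [NormedSpace ℝ E] {φ : ℝ → E}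
    (hφ : ContinuousOn φ (Ioi 0)) {q s K : ℝ} (hs : -a < s)
    (hK : ∀ x : ℝ, 0 < x → ‖φ x‖ ≤ K * (1 + x) ^ q * Real.exp (-(s * x))) :
    IntegrableOn (fun x => density b g x • φ x) (Ioi 0) := by
  obtain ⟨K₁, hK₁, hb⟩ := h.exists_bound
  have hi := (integrableOn_rpow_mul_one_add_rpow_mul_exp h.b_pos (e + q)
    (show 0 < s + a by linarith)).const_mul (K₁ * K)
  refine Integrable.mono' hi ?_ ?_
  · exact (h.continuousOn_density.smul hφ).aestronglyMeasurable measurableSet_Ioi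
  · refine (ae_restrict_iff' measurableSet_Ioi).2 (Eventually.of_forall fun x hx => ?_)
    have hx : (0 : ℝ) < x := hx
    have h1 := hb x (by simpa using hx.le) (by simp [Real.pi_pos.le])
      (by simp [Real.pi_pos.le, mul_nonneg, hx.le])
    have h2 : (g x).re ≤ ‖g x‖ := Complex.re_le_norm _
    have h3 := hK x hx
    simp only [Complex.ofReal_re] at h1
    rw [norm_smul, Real.norm_of_nonneg (h.density_pos hx).le, density]
    have h4 : Real.exp (-((s + a) * x)) = Real.exp (-(a * x)) * Real.exp (-(s * x)) := by
      rw [← Real.exp_add]; congr 1; ring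
    rw [h4, Real.rpow_add (by linarith)]
    calc x ^ (b - 1) * (g x).re * ‖φ x‖
        ≤ x ^ (b - 1) * (K₁ * (1 + x) ^ e * Real.exp (-(a * x))) *
          (K * (1 + x) ^ q * Real.exp (-(s * x))) := by
          have := (h.real_pos x (by linarith)).2.le
          gcongr
          exact h2.trans h1
      _ = _ := by ring

lemma IsKernel.integrableOn_exp {b a e : ℝ} {g : ℂ → ℂ} (h : IsKernel b a e g) {s : ℝ}
    (hs : -a < s) :
    IntegrableOn (fun x => density b g x * Real.exp (-(s * x))) (Ioi 0) := by
  refine h.integrableOn_mul (φ := fun x => Real.exp (-(s * x))) (q := 0) (K := 1)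
    (by fun_prop) hs fun x hx => ?_
  simp

lemma ofReal_mul_cpow {r : ℝ} (hr : 0 < r) {x : ℂ} (hx : x ≠ 0) (c : ℂ) :
    ((r : ℂ) * x) ^ c = (r : ℂ) ^ c * x ^ c := by
  have hr' : (r : ℂ) ≠ 0 := by exact_mod_cast hr.ne'
  rw [Complex.cpow_def_of_ne_zero (mul_ne_zero hr' hx), Complex.cpow_def_of_ne_zero hr',
    Complex.cpow_def_of_ne_zero hx, Complex.log_ofReal_mul hr hx, ← Complex.exp_add,
    Complex.ofReal_log hr.le]
  ring_nf

/-! ### The Beta kernel. -/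

/-- The entire function `(1 - exp (-x)) / x`. -/
def expQuot : ℂ → ℂ := dslope (fun x => 1 - Complex.exp (-x)) 0

lemma differentiable_expQuot : Differentiable ℂ expQuot := by
  have : DifferentiableOn ℂ expQuot univ := by
    rw [expQuot, Complex.differentiableOn_dslope univ_mem]
    fun_prop
  exact differentiableOn_univ.1 this

lemma expQuot_zero : expQuot 0 = 1 := by
  have h : HasDerivAt (fun x : ℂ => 1 - Complex.exp (-x)) 1 0 := by
    have := ((Complex.hasDerivAt_exp (-0)).comp (0 : ℂ) (hasDerivAt_neg (0 : ℂ))).const_sub 1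
    simpa [Function.comp_def] using this
  rw [expQuot, dslope_same, h.deriv]

lemma expQuot_of_ne {x : ℂ} (hx : x ≠ 0) : expQuot x = (1 - Complex.exp (-x)) / x := by
  rw [expQuot, dslope_of_ne _ hx, slope_def_field]
  simp

lemma mul_expQuot (x : ℂ) : x * expQuot x = 1 - Complex.exp (-x) := by
  rcases eq_or_ne x 0 with rfl | hx
  · simp
  · rw [expQuot_of_ne hx]; field_simp

lemma div_mem_slitPlane_of_re_pos {u v : ℂ} (hu : 0 < u.re) (hv : 0 < v.re) :
    u / v ∈ Complex.slitPlane := by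
  by_contra h
  rw [Complex.mem_slitPlane_iff, not_or, not_lt, not_not] at h
  have hv0 : v ≠ 0 := by rintro rfl; simp at hv
  have h1 : u / v = ((u / v).re : ℂ) := Complex.ext (by simp) (by simp [h.2])
  have h2 : u = ((u / v).re : ℂ) * v := by rw [← h1]; field_simp
  have h3 : u.re = (u / v).re * v.re := by
    conv_lhs => rw [h2]
    simp
  nlinarith [h.1]

lemma norm_expQuot_sub_one_le {x : ℂ} (hx : ‖x‖ < 1) : ‖expQuot x - 1‖ < 1 := by
  rcases eq_or_ne x 0 with rfl | h0
  · simp [expQuot_zero]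
  · have h1 := Complex.norm_exp_sub_one_sub_id_le (x := -x) (by simpa using hx.le)
    have h2 : expQuot x - 1 = -(Complex.exp (-x) - 1 - (-x)) / x := by
      rw [expQuot_of_ne h0]; field_simp; ring
    rw [h2, norm_div, norm_neg, div_lt_one (norm_pos_iff.2 h0)]
    refine h1.trans_lt ?_
    rw [norm_neg]
    nlinarith [norm_pos_iff.2 h0]

/-- In the unit disc the value has distance less than `1` from `1`; in the right half plane it is a
quotient of two numbers with positive real part. Hence the principal power of `expQuot` is
holomorphic on all of `kernelDomain`. -/
lemma expQuot_mem_slitPlane {x : ℂ} (hx : x ∈ kernelDomain) : expQuot x ∈ Complex.slitPlane := by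
  rcases hx with hx | hx
  · apply Complex.ball_one_subset_slitPlane
    rw [mem_ball_iff_norm]
    exact norm_expQuot_sub_one_le (by simpa using hx)
  · have hx : 0 < x.re := hx
    have h0 : x ≠ 0 := by rintro rfl; simp at hx
    rw [expQuot_of_ne h0]
    refine div_mem_slitPlane_of_re_pos ?_ hx
    have : ‖Complex.exp (-x)‖ < 1 := by
      rw [Complex.norm_exp]; simpa using hx
    have := (Complex.re_le_norm (Complex.exp (-x))).trans_lt this
    simp only [Complex.sub_re, Complex.one_re]
    linarith

/-- The entire function `(1 - exp (-x)) / x` on the real axis. -/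
def realExpQuot (x : ℝ) : ℝ := (expQuot x).re

lemma expQuot_ofReal (x : ℝ) : expQuot x = (realExpQuot x : ℂ) := by
  rcases eq_or_ne x 0 with rfl | hx
  · simp [realExpQuot, expQuot_zero]
  · have : expQuot x = (((1 - Real.exp (-x)) / x : ℝ) : ℂ) := by
      rw [expQuot_of_ne (by exact_mod_cast hx)]; push_cast; rfl
    rw [realExpQuot, this, Complex.ofReal_re]

lemma realExpQuot_of_ne {x : ℝ} (hx : x ≠ 0) : realExpQuot x = (1 - Real.exp (-x)) / x := by
  have : expQuot x = (((1 - Real.exp (-x)) / x : ℝ) : ℂ) := by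
    rw [expQuot_of_ne (by exact_mod_cast hx)]; push_cast; rfl
  rw [realExpQuot, this, Complex.ofReal_re]

lemma realExpQuot_pos (x : ℝ) : 0 < realExpQuot x := by
  rcases lt_trichotomy x 0 with hx | rfl | hx
  · rw [realExpQuot_of_ne hx.ne]
    exact div_pos_of_neg_of_neg (by linarith [Real.one_lt_exp_iff.2 (neg_pos.2 hx)]) hx
  · simp [realExpQuot, expQuot_zero]
  · rw [realExpQuot_of_ne hx.ne']
    exact div_pos (by linarith [Real.exp_lt_one_iff.2 (neg_lt_zero.2 hx)]) hx

/-- The kernel of the Beta density with parameters `α` and `1 - α` in the variable `x = -log t`,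
up to normalization by `κ`. -/
def betaKernel (κ α : ℝ) (x : ℂ) : ℂ :=
  κ * Complex.exp (-(α * x)) * expQuot x ^ (-(α : ℂ))

lemma betaKernel_ofReal (κ α x : ℝ) :
    betaKernel κ α x = ((κ * Real.exp (-(α * x)) * realExpQuot x ^ (-α) : ℝ) : ℂ) := by
  rw [betaKernel, expQuot_ofReal]
  push_cast
  rw [Complex.ofReal_cpow (realExpQuot_pos x).le]
  push_cast
  rfl

lemma tendsto_div_one_add_re_stripEnd :
    Tendsto (fun x : ℂ => x / ((1 + x.re : ℝ) : ℂ)) stripEnd (𝓝 1) := by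
  have hre := tendsto_re_stripEnd
  have h3 : Tendsto (fun x : ℂ => (x - ((1 + x.re : ℝ) : ℂ)) / ((1 + x.re : ℝ) : ℂ))
      stripEnd (𝓝 0) := by
    rw [tendsto_zero_iff_norm_tendsto_zero]
    have h4 : Tendsto (fun x : ℂ => (Real.pi + 1) / (1 + x.re)) stripEnd (𝓝 0) :=
      (tendsto_const_nhds.div_atTop (tendsto_atTop_add_const_left _ 1 hre))
    refine squeeze_zero' (Eventually.of_forall fun _ => norm_nonneg _) ?_ h4
    rw [eventually_stripEnd]
    refine ⟨0, fun x hx hi => ?_⟩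
    rw [norm_div, Complex.norm_real, Real.norm_of_nonneg (by linarith)]
    gcongr
    have : x - ((1 + x.re : ℝ) : ℂ) = x.im * Complex.I - 1 := by
      apply Complex.ext <;> simp
    rw [this]
    refine (norm_sub_le _ _).trans ?_
    simpa using hi
  have h5 : ∀ᶠ x in stripEnd, 1 + (x - ((1 + x.re : ℝ) : ℂ)) / ((1 + x.re : ℝ) : ℂ) =
      x / ((1 + x.re : ℝ) : ℂ) := by
    rw [eventually_stripEnd]
    refine ⟨0, fun x hx hi => ?_⟩
    have : ((1 + x.re : ℝ) : ℂ) ≠ 0 := by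
      exact_mod_cast (by linarith : (1 : ℝ) + x.re ≠ 0)
    field_simp
    ring
  have h6 := (tendsto_const_nhds (x := (1 : ℂ))).add h3
  rw [add_zero] at h6
  exact h6.congr' h5

lemma tendsto_expQuot_mul_stripEnd :
    Tendsto (fun x : ℂ => expQuot x * ((1 + x.re : ℝ) : ℂ)) stripEnd (𝓝 1) := by
  have hre := tendsto_re_stripEnd
  have h1 : Tendsto (fun x : ℂ => 1 - Complex.exp (-x)) stripEnd (𝓝 1) := by
    have : Tendsto (fun x : ℂ => Complex.exp (-x)) stripEnd (𝓝 0) := by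
      rw [tendsto_zero_iff_norm_tendsto_zero]
      have := Real.tendsto_exp_neg_atTop_nhds_zero.comp hre
      refine this.congr fun x => ?_
      simp [Complex.norm_exp]
    simpa using tendsto_const_nhds.sub this
  have h2 := tendsto_div_one_add_re_stripEnd
  have h7 := h1.div h2 one_ne_zero
  rw [div_one] at h7
  refine h7.congr' ?_
  rw [EventuallyEq, eventually_stripEnd]
  refine ⟨1, fun x hx hi => ?_⟩
  have hx0 : x ≠ 0 := by rintro rfl; norm_num at hx
  simp only [Pi.div_apply]
  rw [expQuot_of_ne hx0]
  have : ((1 + x.re : ℝ) : ℂ) ≠ 0 := by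
    exact_mod_cast (by linarith : (1 : ℝ) + x.re ≠ 0)
  field_simp

/-- Under `t = e^{-x}` the Beta density becomes a multiple of `e^{-αx} (1 - e^{-x}) ^ (-α)`.
Splitting off `x ^ (-α)` leaves `expQuot ^ (-α)`, which grows like `x ^ α`; so the power is `e = α`,
and `e + b = 1`. -/
lemma isKernel_betaKernel {κ α : ℝ} (hκ : 0 < κ) (h0 : 0 < α) (h1 : α < 1) :
    IsKernel (1 - α) α α (betaKernel κ α) where
  b_pos := by linarith
  a_pos := h0
  one_le := by linarith
  diff := by
    intro x hx
    have := (differentiable_expQuot x).cpow (differentiableAt_const (-(α : ℂ)))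
      (expQuot_mem_slitPlane hx)
    refine DifferentiableAt.differentiableWithinAt ?_
    unfold betaKernel
    exact DifferentiableAt.mul (by fun_prop) this
  real_pos := by
    intro x hx
    rw [betaKernel_ofReal]
    have := realExpQuot_pos x
    refine ⟨Complex.ofReal_im _, ?_⟩
    rw [Complex.ofReal_re]
    positivity
  asymp := by
    refine ⟨κ, hκ, ?_⟩
    have h2 : Tendsto (fun x : ℂ => (expQuot x * ((1 + x.re : ℝ) : ℂ)) ^ (-(α : ℂ)))
        stripEnd (𝓝 (1 ^ (-(α : ℂ)))) :=
      tendsto_expQuot_mul_stripEnd.cpow tendsto_const_nhds Complex.one_mem_slitPlane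
    rw [Complex.one_cpow] at h2
    have h3 := h2.const_mul (κ : ℂ)
    rw [mul_one] at h3
    refine h3.congr' ?_
    rw [EventuallyEq, eventually_stripEnd]
    refine ⟨1, fun x hx hi => ?_⟩
    have hp : (0 : ℝ) < 1 + x.re := by linarith
    have hD : expQuot x ≠ 0 := Complex.slitPlane_ne_zero (expQuot_mem_slitPlane
      (Or.inr (show 0 < x.re by linarith)))
    have h4 : (expQuot x * ((1 + x.re : ℝ) : ℂ)) ^ (-(α : ℂ)) =
        expQuot x ^ (-(α : ℂ)) * ((1 + x.re : ℝ) : ℂ) ^ (-(α : ℂ)) := by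
      rw [mul_comm, ofReal_mul_cpow hp hD, mul_comm]
    rw [h4, betaKernel, Complex.ofReal_cpow hp.le]
    have h5 : Complex.exp (-(α * x)) * Complex.exp (α * x) = 1 := by
      rw [← Complex.exp_add]; simp
    push_cast
    linear_combination (-κ * expQuot x ^ (-(α : ℂ)) * (1 + (x.re : ℂ)) ^ (-(α : ℂ))) * h5

lemma density_betaKernel (κ α : ℝ) {x : ℝ} (hx : 0 < x) :
    density (1 - α) (betaKernel κ α) x =
      κ * Real.exp (-(α * x)) * (1 - Real.exp (-x)) ^ (-α) := by
  have h1 : 0 < 1 - Real.exp (-x) := by linarith [Real.exp_lt_one_iff.2 (neg_lt_zero.2 hx)]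
  rw [density, betaKernel_ofReal, Complex.ofReal_re, realExpQuot_of_ne hx.ne',
    Real.div_rpow h1.le hx.le]
  have : x ^ (1 - α - 1) = x ^ (-α) := by congr 1; ring
  rw [this]
  have : x ^ (-α) ≠ 0 := (Real.rpow_pos_of_pos hx _).ne'
  field_simp

/-- Integration by parts: the difference of the two sides is the integral of the derivative of `κ (1
- e^{-x}) ^ (1 - α) e^{-(α + s) x}`, which vanishes at `0` and at infinity. -/
lemma laplace_betaKernel_succ {κ α s : ℝ} (hκ : 0 < κ) (h0 : 0 < α) (h1 : α < 1) (hs : -α < s) :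
    (1 + s) * laplace (1 - α) (betaKernel κ α) (s + 1) =
      (α + s) * laplace (1 - α) (betaKernel κ α) s := by
  have hker := isKernel_betaKernel hκ h0 h1
  have hi0 := hker.integrableOn_exp hs
  have hi1 := hker.integrableOn_exp (s := s + 1) (by linarith)
  set Y : ℝ → ℝ := fun x => κ * ((1 - Real.exp (-x)) ^ (1 - α) * Real.exp (-((α + s) * x)))
  have hcont : ContinuousWithinAt Y (Ici 0) 0 := by
    apply Continuous.continuousWithinAt
    refine continuous_const.mul (Continuous.mul ?_ (by fun_prop))
    exact Continuous.rpow_const (by fun_prop) (fun x => Or.inr (by linarith))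
  have hder : ∀ x ∈ Ioi (0 : ℝ), HasDerivAt Y
      ((1 + s) * (density (1 - α) (betaKernel κ α) x * Real.exp (-((s + 1) * x))) -
        (α + s) * (density (1 - α) (betaKernel κ α) x * Real.exp (-(s * x)))) x := by
    intro x hx
    have hx : 0 < x := hx
    have hp : 0 < 1 - Real.exp (-x) := by linarith [Real.exp_lt_one_iff.2 (neg_lt_zero.2 hx)]
    have d1 : HasDerivAt (fun x : ℝ => 1 - Real.exp (-x)) (Real.exp (-x)) x := by
      have := ((hasDerivAt_neg x).exp).const_sub 1
      simpa using this
    have d2 := d1.rpow_const (p := 1 - α) (Or.inl hp.ne')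
    have d3 : HasDerivAt (fun x : ℝ => Real.exp (-((α + s) * x)))
        (Real.exp (-((α + s) * x)) * (-(α + s))) x := by
      have := (((hasDerivAt_id x).const_mul (α + s)).neg).exp
      simpa using this
    have d4 := (d2.mul d3).const_mul κ
    convert! d4 using 1
    rw [density_betaKernel κ α hx]
    have e1 : (1 - Real.exp (-x)) ^ (1 - α) =
        (1 - Real.exp (-x)) * (1 - Real.exp (-x)) ^ (-α) := by
      rw [sub_eq_add_neg 1 α, Real.rpow_add hp, Real.rpow_one]
    have e2 : (1 - Real.exp (-x)) ^ (1 - α - 1) = (1 - Real.exp (-x)) ^ (-α) := by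
      congr 1; ring
    have e3 : Real.exp (-((α + s) * x)) = Real.exp (-(α * x)) * Real.exp (-(s * x)) := by
      rw [← Real.exp_add]; congr 1; ring
    have e4 : Real.exp (-((s + 1) * x)) = Real.exp (-(s * x)) * Real.exp (-x) := by
      rw [← Real.exp_add]; congr 1; ring
    rw [e1, e2, e3, e4]
    ring
  have hlim : Tendsto Y atTop (𝓝 0) := by
    have t1 : Tendsto (fun x : ℝ => (1 - Real.exp (-x)) ^ (1 - α)) atTop (𝓝 1) := by
      have : Tendsto (fun x : ℝ => 1 - Real.exp (-x)) atTop (𝓝 1) := by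
        simpa using tendsto_const_nhds.sub Real.tendsto_exp_neg_atTop_nhds_zero
      simpa using this.rpow_const (p := 1 - α) (Or.inl one_ne_zero)
    have t2 : Tendsto (fun x : ℝ => Real.exp (-((α + s) * x))) atTop (𝓝 0) :=
      Real.tendsto_exp_neg_atTop_nhds_zero.comp
        (tendsto_id.const_mul_atTop (by linarith : 0 < α + s))
    simpa using (t1.mul t2).const_mul κ
  have hint : IntegrableOn (fun x =>
      ((1 + s) * (density (1 - α) (betaKernel κ α) x * Real.exp (-((s + 1) * x))) -
        (α + s) * (density (1 - α) (betaKernel κ α) x * Real.exp (-(s * x))))) (Ioi 0) :=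
    (hi1.const_mul _).sub (hi0.const_mul _)
  have key := integral_Ioi_of_hasDerivAt_of_tendsto hcont hder hint hlim
  rw [integral_sub (hi1.const_mul _) (hi0.const_mul _), integral_const_mul,
    integral_const_mul] at key
  have hY0 : Y 0 = 0 := by
    simp only [Y, neg_zero, Real.exp_zero, sub_self]
    rw [Real.zero_rpow (by linarith)]; simp
  rw [hY0] at key
  unfold laplace
  linarith

lemma IsKernel.laplace_pos {b a e : ℝ} {g : ℂ → ℂ} (h : IsKernel b a e g) {s : ℝ}
    (hs : -a < s) : 0 < laplace b g s := by
  unfold laplace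
  rw [setIntegral_pos_iff_support_of_nonneg_ae]
  · have : Function.support (fun x => density b g x * Real.exp (-(s * x))) ∩ Ioi 0 = Ioi 0 := by
      rw [inter_eq_right]
      intro x hx
      exact (mul_pos (h.density_pos hx) (Real.exp_pos _)).ne'
    rw [this]; simp
  · refine (ae_restrict_iff' measurableSet_Ioi).2 (Eventually.of_forall fun x hx => ?_)
    exact (mul_pos (h.density_pos hx) (Real.exp_pos _)).le
  · exact h.integrableOn_exp hs

lemma laplace_betaKernel_mul (κ α s : ℝ) :
    laplace (1 - α) (betaKernel κ α) s = κ * laplace (1 - α) (betaKernel 1 α) s := by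
  unfold laplace
  rw [← integral_const_mul]
  refine setIntegral_congr_fun measurableSet_Ioi fun x hx => ?_
  simp only [density_betaKernel _ α hx]
  ring

lemma exists_betaKernel {α : ℝ} (h0 : 0 < α) (h1 : α < 1) :
    ∃ κ : ℝ, 0 < κ ∧ laplace (1 - α) (betaKernel κ α) 0 = 1 := by
  have := (isKernel_betaKernel one_pos h0 h1).laplace_pos (s := 0) (by linarith)
  refine ⟨(laplace (1 - α) (betaKernel 1 α) 0)⁻¹, by positivity, ?_⟩
  rw [laplace_betaKernel_mul]
  field_simp

/-! ### Convolution of kernels; the case of equal exponential rates. -/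

/-- The kernel of the convolution of the densities `x ^ (b - 1) * g x` and
`x ^ (b' - 1) * g' x`. -/
def convKernel (b b' : ℝ) (g g' : ℂ → ℂ) (x : ℂ) : ℂ :=
  ∫ v in Ioo (0 : ℝ) 1,
    (((1 - v) ^ (b - 1) * v ^ (b' - 1) : ℝ) : ℂ) * (g (x * ((1 - v : ℝ) : ℂ)) * g' (x * (v : ℂ)))

lemma convKernel_comm (b b' : ℝ) (g g' : ℂ → ℂ) :
    convKernel b b' g g' = convKernel b' b g' g := by
  ext x
  unfold convKernel
  rw [← integral_Ioc_eq_integral_Ioo, ← integral_Ioc_eq_integral_Ioo,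
    ← intervalIntegral.integral_of_le zero_le_one, ← intervalIntegral.integral_of_le zero_le_one]
  have := intervalIntegral.integral_comp_sub_left (a := (0 : ℝ)) (b := 1) (fun v : ℝ =>
    (((1 - v) ^ (b - 1) * v ^ (b' - 1) : ℝ) : ℂ) *
      (g (x * ((1 - v : ℝ) : ℂ)) * g' (x * (v : ℂ)))) 1
  simp only [sub_self, sub_zero, sub_sub_cancel] at this
  rw [← this]
  congr 1
  ext v
  rw [mul_comm ((1 - v) ^ _), mul_comm (g _)]

lemma integrableOn_beta {b b' : ℝ} (hb : 0 < b) (hb' : 0 < b') :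
    IntegrableOn (fun v : ℝ => (1 - v) ^ (b - 1) * v ^ (b' - 1)) (Ioo 0 1) := by
  have h := (Complex.betaIntegral_convergent (u := (b' : ℂ)) (v := (b : ℂ))
    (by simpa using hb') (by simpa using hb)).1
  have h2 : IntegrableOn _ (Ioo (0 : ℝ) 1) volume := (h.mono_set Ioo_subset_Ioc_self).norm
  refine h2.congr_fun (fun v hv => ?_) measurableSet_Ioo
  have hv1 : (0 : ℝ) < 1 - v := by linarith [hv.2]
  have e1 : (1 - (v : ℂ)) = ((1 - v : ℝ) : ℂ) := by push_cast; rfl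
  have e2 : (b' : ℂ) - 1 = ((b' - 1 : ℝ) : ℂ) := by push_cast; rfl
  have e3 : (b : ℂ) - 1 = ((b - 1 : ℝ) : ℂ) := by push_cast; rfl
  simp only []
  rw [e1, e2, e3, ← Complex.ofReal_cpow hv.1.le, ← Complex.ofReal_cpow hv1.le, norm_mul,
    Complex.norm_real, Complex.norm_real, Real.norm_of_nonneg (by have := hv.1; positivity),
    Real.norm_of_nonneg (by positivity), mul_comm]

lemma continuousOn_beta (b b' : ℝ) :
    ContinuousOn (fun v : ℝ => (1 - v) ^ (b - 1) * v ^ (b' - 1)) (Ioo 0 1) := by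
  refine (ContinuousOn.rpow_const (by fun_prop) ?_).mul (ContinuousOn.rpow_const (by fun_prop) ?_)
  · intro v hv; left; have := hv.2; linarith
  · intro v hv; left; exact hv.1.ne'

lemma continuousOn_conv_integrand {b b' : ℝ} {g g' : ℂ → ℂ}
    (hg : ContinuousOn g kernelDomain) (hg' : ContinuousOn g' kernelDomain) {x : ℂ}
    (hx : x ∈ kernelDomain) : ContinuousOn (fun v : ℝ =>
      (((1 - v) ^ (b - 1) * v ^ (b' - 1) : ℝ) : ℂ) *
        (g (x * ((1 - v : ℝ) : ℂ)) * g' (x * (v : ℂ)))) (Ioo 0 1) := by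
  refine (Complex.continuous_ofReal.comp_continuousOn (continuousOn_beta b b')).mul
    ((hg.comp (by fun_prop) fun v hv => ?_).mul (hg'.comp (by fun_prop) fun v hv => ?_))
  · exact smul_mem_kernelDomain hx (by linarith [hv.2]) (by linarith [hv.1])
  · exact smul_mem_kernelDomain hx hv.1.le hv.2.le

lemma exists_local_bound {g : ℂ → ℂ} (hg : ContinuousOn g kernelDomain) {x₀ : ℂ}
    (hx₀ : x₀ ∈ kernelDomain) : ∃ ε > 0, ∃ K : ℝ, 0 ≤ K ∧ ∀ x ∈ Metric.ball x₀ ε,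
      ∀ v : ℝ, 0 ≤ v → v ≤ 1 → ‖g (x * v)‖ ≤ K := by
  obtain ⟨ε, hε, hsub⟩ := Metric.nhds_basis_closedBall.mem_iff.1
    (isOpen_kernelDomain.mem_nhds hx₀)
  have hcomp : IsCompact ((fun p : ℂ × ℝ => p.1 * (p.2 : ℂ)) ''
      (Metric.closedBall x₀ ε ×ˢ Icc (0 : ℝ) 1)) :=
    ((isCompact_closedBall x₀ ε).prod isCompact_Icc).image (by fun_prop)
  obtain ⟨K, hK⟩ := hcomp.exists_bound_of_continuousOn (hg.mono (by
    rintro _ ⟨⟨x, v⟩, ⟨hx, hv⟩, rfl⟩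
    exact smul_mem_kernelDomain (hsub hx) hv.1 hv.2))
  refine ⟨ε, hε, max K 0, le_max_right _ _, fun x hx v h0 h1 => ?_⟩
  exact (hK _ ⟨(x, v), ⟨Metric.ball_subset_closedBall hx, h0, h1⟩, rfl⟩).trans (le_max_left _ _)

lemma differentiableOn_convKernel {b b' : ℝ} (hb : 0 < b) (hb' : 0 < b') {g g' : ℂ → ℂ}
    (hg : DifferentiableOn ℂ g kernelDomain) (hg' : DifferentiableOn ℂ g' kernelDomain) :
    DifferentiableOn ℂ (convKernel b b' g g') kernelDomain := by
  refine differentiableOn_integral_of_locally_dominated isOpen_kernelDomain ?_ ?_ ?_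
  · intro x hx
    exact (continuousOn_conv_integrand hg.continuousOn hg'.continuousOn hx).aestronglyMeasurable
      measurableSet_Ioo
  · refine (ae_restrict_iff' measurableSet_Ioo).2 (Eventually.of_forall fun v hv => ?_)
    refine (differentiableOn_const _).mul ((hg.comp (by fun_prop) fun x hx => ?_).mul
      (hg'.comp (by fun_prop) fun x hx => ?_))
    · exact smul_mem_kernelDomain hx (by linarith [hv.2]) (by linarith [hv.1])
    · exact smul_mem_kernelDomain hx hv.1.le hv.2.le
  · intro x₀ hx₀
    obtain ⟨ε, hε, K, hK0, hK⟩ := exists_local_bound hg.continuousOn hx₀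
    obtain ⟨ε', hε', K', hK0', hK'⟩ := exists_local_bound hg'.continuousOn hx₀
    refine ⟨min ε ε', by positivity, fun v => (1 - v) ^ (b - 1) * v ^ (b' - 1) * (K * K'),
      (integrableOn_beta hb hb').mul_const _, ?_⟩
    refine (ae_restrict_iff' measurableSet_Ioo).2 (Eventually.of_forall fun v hv x hx _ => ?_)
    have h1 := hK x (Metric.ball_subset_ball (min_le_left _ _) hx) (1 - v) (by linarith [hv.2])
      (by linarith [hv.1])
    have h2 := hK' x (Metric.ball_subset_ball (min_le_right _ _) hx) v hv.1.le hv.2.le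
    have hv0 := hv.1
    have hv1 : 0 < 1 - v := by linarith [hv.2]
    rw [norm_mul, norm_mul, Complex.norm_real, Real.norm_of_nonneg (by positivity)]
    exact mul_le_mul_of_nonneg_left (mul_le_mul h1 h2 (norm_nonneg _) hK0) (by positivity)

lemma convKernel_ofReal {b b' a a' e e' : ℝ} {g g' : ℂ → ℂ} (h : IsKernel b a e g)
    (h' : IsKernel b' a' e' g') {x : ℝ} (hx : -1 < x) :
    convKernel b b' g g' x = ((∫ v in Ioo (0 : ℝ) 1, (1 - v) ^ (b - 1) * v ^ (b' - 1) *
      ((g ((x * (1 - v) : ℝ) : ℂ)).re * (g' ((x * v : ℝ) : ℂ)).re) : ℝ) : ℂ) := by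
  unfold convKernel
  rw [← integral_complex_ofReal]
  refine setIntegral_congr_fun measurableSet_Ioo fun v hv => ?_
  have h1 : -1 < x * (1 - v) := by nlinarith [hv.1, hv.2]
  have h2 : -1 < x * v := by nlinarith [hv.1, hv.2]
  have e1 := h.eq_re h1
  have e2 := h'.eq_re h2
  rw [← Complex.ofReal_mul x (1 - v), ← Complex.ofReal_mul x v, e1, e2]
  push_cast
  simp

lemma convKernel_real_pos {b b' a a' e e' : ℝ} {g g' : ℂ → ℂ} (h : IsKernel b a e g)
    (h' : IsKernel b' a' e' g') {x : ℝ} (hx : -1 < x) :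
    (convKernel b b' g g' x).im = 0 ∧ 0 < (convKernel b b' g g' x).re := by
  have hpos : ∀ v ∈ Ioo (0 : ℝ) 1, 0 < (1 - v) ^ (b - 1) * v ^ (b' - 1) *
      ((g ((x * (1 - v) : ℝ) : ℂ)).re * (g' ((x * v : ℝ) : ℂ)).re) := by
    intro v hv
    have h1 : -1 < x * (1 - v) := by nlinarith [hv.1, hv.2]
    have h2 : -1 < x * v := by nlinarith [hv.1, hv.2]
    have h3 := (h.real_pos _ h1).2
    have h4 := (h'.real_pos _ h2).2
    have hv0 := hv.1
    have hv1 : 0 < 1 - v := by linarith [hv.2]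
    positivity
  have hxd := ofReal_mem_kernelDomain hx
  obtain ⟨ε, hε, K, hK0, hK⟩ := exists_local_bound h.diff.continuousOn hxd
  obtain ⟨ε', hε', K', hK0', hK'⟩ := exists_local_bound h'.diff.continuousOn hxd
  have hint : IntegrableOn (fun v : ℝ => (1 - v) ^ (b - 1) * v ^ (b' - 1) *
      ((g ((x * (1 - v) : ℝ) : ℂ)).re * (g' ((x * v : ℝ) : ℂ)).re)) (Ioo 0 1) := by
    refine Integrable.mono' ((integrableOn_beta h.b_pos h'.b_pos).mul_const (K * K')) ?_ ?_
    · refine ContinuousOn.aestronglyMeasurable ?_ measurableSet_Ioo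
      refine (continuousOn_beta b b').mul ((Complex.continuous_re.comp_continuousOn
        (h.diff.continuousOn.comp (by fun_prop) fun v hv => ?_)).mul
        (Complex.continuous_re.comp_continuousOn
        (h'.diff.continuousOn.comp (by fun_prop) fun v hv => ?_)))
      · exact ofReal_mem_kernelDomain (by nlinarith [hv.1, hv.2])
      · exact ofReal_mem_kernelDomain (by nlinarith [hv.1, hv.2])
    · refine (ae_restrict_iff' measurableSet_Ioo).2 (Eventually.of_forall fun v hv => ?_)
      rw [Real.norm_of_nonneg (hpos v hv).le]
      have h1 := hK x (Metric.mem_ball_self hε) (1 - v) (by linarith [hv.2]) (by linarith [hv.1])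
      have h2 := hK' x (Metric.mem_ball_self hε') v hv.1.le hv.2.le
      rw [← Complex.ofReal_mul] at h1 h2
      have h3 := (Complex.re_le_norm _).trans h1
      have h4 := (Complex.re_le_norm _).trans h2
      have h5 := (h'.real_pos (x * v) (by nlinarith [hv.1, hv.2])).2
      have hv0 := hv.1
      have hv1 : 0 < 1 - v := by linarith [hv.2]
      gcongr
  rw [convKernel_ofReal h h' hx]
  refine ⟨Complex.ofReal_im _, ?_⟩
  rw [Complex.ofReal_re, setIntegral_pos_iff_support_of_nonneg_ae _ hint]
  · rw [inter_eq_right.2 fun v hv => Function.mem_support.2 (hpos v hv).ne']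
    simp
  · exact (ae_restrict_iff' measurableSet_Ioo).2
      (Eventually.of_forall fun v hv => (hpos v hv).le)

/-- The substitution `t = x v` collects all powers of `x` into `x ^ (b + b' - 1)`. This is why
convolution preserves the form of a power times a holomorphic function, with the exponents `b`
adding up. -/
lemma density_convKernel {b b' a a' e e' : ℝ} {g g' : ℂ → ℂ} (h : IsKernel b a e g)
    (h' : IsKernel b' a' e' g') {x : ℝ} (hx : 0 < x) :
    density (b + b') (convKernel b b' g g') x =
      ∫ t in (0 : ℝ)..x, density b' g' t * density b g (x - t) := by
  rw [density, convKernel_ofReal h h' (by linarith), Complex.ofReal_re,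
    ← integral_Ioc_eq_integral_Ioo, ← intervalIntegral.integral_of_le zero_le_one]
  have key := intervalIntegral.smul_integral_comp_mul_left (a := (0 : ℝ)) (b := 1)
    (fun t => density b' g' t * density b g (x - t)) x
  rw [mul_zero, mul_one] at key
  rw [← key, ← intervalIntegral.integral_smul, ← intervalIntegral.integral_const_mul]
  rw [intervalIntegral.integral_of_le zero_le_one, intervalIntegral.integral_of_le zero_le_one,
    integral_Ioc_eq_integral_Ioo, integral_Ioc_eq_integral_Ioo]
  refine setIntegral_congr_fun measurableSet_Ioo fun v hv => ?_
  have hv0 := hv.1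
  have hv1 : 0 < 1 - v := by linarith [hv.2]
  have e1 : x - x * v = x * (1 - v) := by ring
  simp only [density, smul_eq_mul]
  rw [e1, Real.mul_rpow hx.le hv0.le, Real.mul_rpow hx.le hv1.le]
  have e2 : x ^ (b + b' - 1) = x * x ^ (b' - 1) * x ^ (b - 1) := by
    rw [← Real.rpow_one_add' hx.le (by linarith [h'.b_pos]), ← Real.rpow_add hx]
    congr 1; ring
  rw [e2]
  ring

lemma laplace_convKernel {b b' a a' e e' : ℝ} {g g' : ℂ → ℂ} (h : IsKernel b a e g)
    (h' : IsKernel b' a' e' g') {s : ℝ} (hs : -a < s) (hs' : -a' < s) :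
    laplace (b + b') (convKernel b b' g g') s = laplace b g s * laplace b' g' s := by
  have key := integral_posConvolution (μ := volume) (ν := volume) (h'.integrableOn_exp hs')
    (h.integrableOn_exp hs) (ContinuousLinearMap.mul ℝ ℝ)
  simp only [ContinuousLinearMap.mul_apply'] at key
  unfold laplace
  rw [mul_comm, ← key]
  refine setIntegral_congr_fun measurableSet_Ioi fun x hx => ?_
  rw [density_convKernel h h' hx, ← intervalIntegral.integral_mul_const]
  congr 1
  ext t
  have : Real.exp (-(s * x)) = Real.exp (-(s * t)) * Real.exp (-(s * (x - t))) := by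
    rw [← Real.exp_add]; congr 1; ring
  rw [this]; ring

lemma tendsto_stripEnd_iff {ι : Type*} {l : Filter ι} {u : ι → ℂ} :
    Tendsto u l stripEnd ↔
      Tendsto (fun i => (u i).re) l atTop ∧ ∀ᶠ i in l, |(u i).im| ≤ Real.pi := by
  unfold stripEnd
  rw [tendsto_inf, tendsto_comap_iff, tendsto_principal]
  rfl

/-- The argument of `g` is moved to `u x` while the power normalizing it stays at `x`; the ratio of
the two powers contributes `ρ ^ e`. It serves for scalings `x v`, where `ρ = v`, and for shifts,
where `ρ = 1`. -/
lemma tendsto_kernel_rescaled {a e c ρ : ℝ} {g : ℂ → ℂ}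
    (hlim : Tendsto (fun x : ℂ => g x * Complex.exp (a * x) * (((1 + x.re) ^ (-e) : ℝ) : ℂ))
      stripEnd (𝓝 c)) (hρ : 0 < ρ) {u : ℂ → ℂ} (hu : Tendsto u stripEnd stripEnd)
    (hratio : Tendsto (fun x : ℂ => (1 + (u x).re) / (1 + x.re)) stripEnd (𝓝 ρ)) :
    Tendsto (fun x : ℂ => g (u x) * Complex.exp (a * u x) * (((1 + x.re) ^ (-e) : ℝ) : ℂ))
      stripEnd (𝓝 ((c * ρ ^ e : ℝ) : ℂ)) := by
  have h1 := hlim.comp hu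
  have h2 := (Complex.continuous_ofReal.tendsto _).comp
    (hratio.rpow_const (p := e) (Or.inl hρ.ne'))
  have h3 := h1.mul h2
  rw [← Complex.ofReal_mul] at h3
  refine h3.congr' ?_
  have hre := tendsto_re_stripEnd.eventually (eventually_ge_atTop (0 : ℝ))
  filter_upwards [hre, hu.eventually hre] with x hx hux
  simp only [Function.comp]
  have p1 : (0 : ℝ) < 1 + x.re := by linarith
  have p2 : (0 : ℝ) < 1 + (u x).re := by linarith
  rw [mul_assoc, ← Complex.ofReal_mul]
  congr 2
  rw [Real.div_rpow p2.le p1.le, Real.rpow_neg p2.le, Real.rpow_neg p1.le]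
  have := (Real.rpow_pos_of_pos p2 e).ne'
  field_simp

lemma scaled_re (x : ℂ) (v : ℝ) : (x * (v : ℂ)).re = x.re * v := by simp

lemma scaled_im (x : ℂ) (v : ℝ) : (x * (v : ℂ)).im = x.im * v := by simp

lemma tendsto_mul_stripEnd {v : ℝ} (h0 : 0 < v) (h1 : v ≤ 1) :
    Tendsto (fun x : ℂ => x * (v : ℂ)) stripEnd stripEnd := by
  rw [tendsto_stripEnd_iff]
  constructor
  · simp only [scaled_re]
    exact tendsto_re_stripEnd.atTop_mul_const h0
  · rw [eventually_stripEnd]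
    refine ⟨0, fun x _ hi => ?_⟩
    rw [scaled_im, abs_mul, abs_of_pos h0]
    nlinarith [abs_nonneg x.im]

lemma tendsto_ratio_stripEnd (v : ℝ) :
    Tendsto (fun x : ℂ => (1 + (x * (v : ℂ)).re) / (1 + x.re)) stripEnd (𝓝 v) := by
  have h : Tendsto (fun x : ℂ => v + (1 - v) / (1 + x.re)) stripEnd (𝓝 (v + 0)) :=
    tendsto_const_nhds.add
      (tendsto_const_nhds.div_atTop (tendsto_atTop_add_const_left _ 1 tendsto_re_stripEnd))
  rw [add_zero] at h
  refine h.congr' ?_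
  filter_upwards [tendsto_re_stripEnd.eventually (eventually_ge_atTop (0 : ℝ))] with x hx
  rw [scaled_re]
  have : (1 : ℝ) + x.re ≠ 0 := by linarith
  field_simp
  ring

/-- The quotient `(1 + X v) / (1 + X)` lies in `[v, 1]`. The resulting majorant `v ^ (b - 1 + min e
0)` is integrable at `0` because both `b` and `b + e` are positive. -/
lemma one_add_mul_rpow_le {v X e : ℝ} (h0 : 0 < v) (h1 : v ≤ 1) (hX : 0 ≤ X) :
    (1 + X * v) ^ e * (1 + X) ^ (-e) ≤ v ^ min e 0 := by
  have p1 : (0 : ℝ) < 1 + X := by linarith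
  have p2 : (0 : ℝ) < 1 + X * v := by positivity
  rw [Real.rpow_neg p1.le, ← div_eq_mul_inv, ← Real.div_rpow p2.le p1.le]
  have r1 : (1 + X * v) / (1 + X) ≤ 1 := by rw [div_le_one p1]; nlinarith
  have r2 : v ≤ (1 + X * v) / (1 + X) := by rw [le_div_iff₀ p1]; nlinarith
  rcases le_total 0 e with he | he
  · rw [min_eq_right he, Real.rpow_zero]
    exact Real.rpow_le_one (by positivity) r1 he
  · rw [min_eq_left he]
    exact Real.rpow_le_rpow_of_nonpos h0 r2 he

lemma IsKernel.exists_scaled_bound {b a e : ℝ} {g : ℂ → ℂ} (h : IsKernel b a e g) :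
    ∃ K : ℝ, 0 < K ∧ ∀ x : ℂ, 1 ≤ x.re → |x.im| ≤ Real.pi → ∀ v : ℝ, 0 < v → v ≤ 1 →
      ‖g (x * v)‖ ≤ K * (1 + x.re * v) ^ e * Real.exp (-(a * (x.re * v))) := by
  obtain ⟨K, hK, hb⟩ := h.exists_bound
  refine ⟨K, hK, fun x hx hi v h0 h1 => ?_⟩
  have := hb (x * v) (by rw [scaled_re]; positivity)
    (by rw [scaled_im, abs_mul, abs_of_pos h0]; nlinarith [abs_nonneg x.im])
    (by
      rw [scaled_im, scaled_re, abs_mul, abs_of_pos h0, ← mul_assoc]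
      have : |x.im| ≤ Real.pi * x.re := by nlinarith [Real.pi_pos]
      gcongr)
  rwa [scaled_re] at this

lemma norm_exp_scaled (a : ℝ) (x : ℂ) (v : ℝ) :
    ‖Complex.exp (a * (x * v))‖ = Real.exp (a * (x.re * v)) := by
  rw [Complex.norm_exp, Complex.re_ofReal_mul, scaled_re]

/-- With equal rates the exponentials at `x (1 - v)` and `x v` multiply exactly to `e^{-a x}`, so
every `v` contributes. The powers scale like `(1 - v) ^ e * v ^ e'`, and dominated convergence
produces a Beta integral. -/
lemma tendsto_convKernel_of_eq {b b' a e e' c c' : ℝ} {g g' : ℂ → ℂ} (h : IsKernel b a e g)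
    (h' : IsKernel b' a e' g')
    (hlim : Tendsto (fun x : ℂ => g x * Complex.exp (a * x) * (((1 + x.re) ^ (-e) : ℝ) : ℂ))
      stripEnd (𝓝 c))
    (hlim' : Tendsto (fun x : ℂ => g' x * Complex.exp (a * x) * (((1 + x.re) ^ (-e') : ℝ) : ℂ))
      stripEnd (𝓝 c')) :
    Tendsto (fun x : ℂ => convKernel b b' g g' x * Complex.exp (a * x) *
      (((1 + x.re) ^ (-(e + e')) : ℝ) : ℂ)) stripEnd
      (𝓝 ((c * c' * ∫ v in Ioo (0 : ℝ) 1, (1 - v) ^ (e + b - 1) * v ^ (e' + b' - 1) : ℝ) : ℂ)) := by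
  obtain ⟨K, hK, hbd⟩ := h.exists_scaled_bound
  obtain ⟨K', hK', hbd'⟩ := h'.exists_scaled_bound
  have hdom := tendsto_integral_filter_of_dominated_convergence (μ := volume.restrict (Ioo 0 1))
    (l := stripEnd)
    (F := fun (x : ℂ) (v : ℝ) => (((1 - v) ^ (b - 1) * v ^ (b' - 1) : ℝ) : ℂ) *
      ((g (x * ((1 - v : ℝ) : ℂ)) * Complex.exp (a * (x * ((1 - v : ℝ) : ℂ))) *
        (((1 + x.re) ^ (-e) : ℝ) : ℂ)) *
      (g' (x * (v : ℂ)) * Complex.exp (a * (x * (v : ℂ))) * (((1 + x.re) ^ (-e') : ℝ) : ℂ))))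
    (f := fun v : ℝ => ((c * c' * ((1 - v) ^ (e + b - 1) * v ^ (e' + b' - 1)) : ℝ) : ℂ))
    (fun v => (K * K') * ((1 - v) ^ (b + min e 0 - 1) * v ^ (b' + min e' 0 - 1))) ?_ ?_ ?_ ?_
  · rw [integral_complex_ofReal, integral_const_mul] at hdom
    refine hdom.congr' ?_
    filter_upwards [tendsto_re_stripEnd.eventually (eventually_ge_atTop (0 : ℝ))] with x hx
    rw [convKernel, mul_assoc, ← integral_mul_const]
    congr 1
    ext v
    have e1 : Complex.exp (a * x) =
        Complex.exp (a * (x * ((1 - v : ℝ) : ℂ))) * Complex.exp (a * (x * (v : ℂ))) := by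
      rw [← Complex.exp_add]; congr 1; push_cast; ring
    have e2 : (1 + x.re) ^ (-(e + e')) = (1 + x.re) ^ (-e) * (1 + x.re) ^ (-e') := by
      rw [← Real.rpow_add (by linarith)]; congr 1; ring
    rw [e1, e2]
    push_cast
    ring
  · rw [eventually_stripEnd]
    refine ⟨1, fun x hx _ => ?_⟩
    have hxd : x ∈ kernelDomain := Or.inr (show 0 < x.re by linarith)
    refine ContinuousOn.aestronglyMeasurable ?_ measurableSet_Ioo
    have hc := continuousOn_conv_integrand (b := b) (b' := b') h.diff.continuousOn
      h'.diff.continuousOn hxd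
    have hc2 : ContinuousOn (fun v : ℝ => Complex.exp (a * (x * ((1 - v : ℝ) : ℂ))) *
      (((1 + x.re) ^ (-e) : ℝ) : ℂ) * (Complex.exp (a * (x * (v : ℂ))) *
      (((1 + x.re) ^ (-e') : ℝ) : ℂ))) (Ioo 0 1) := by fun_prop
    refine (hc.mul hc2).congr fun v _ => ?_
    simp only [Pi.mul_apply]
    ring
  · rw [eventually_stripEnd]
    refine ⟨1, fun x hx hi => ?_⟩
    refine (ae_restrict_iff' measurableSet_Ioo).2 (Eventually.of_forall fun v hv => ?_)
    have hv0 := hv.1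
    have hv1 : 0 < 1 - v := by linarith [hv.2]
    have b1 := hbd x hx hi (1 - v) hv1 (by linarith)
    have b2 := hbd' x hx hi v hv0 hv.2.le
    have b3 := one_add_mul_rpow_le (e := e) hv1 (by linarith) (by linarith : 0 ≤ x.re)
    have b4 := one_add_mul_rpow_le (e := e') hv0 hv.2.le (by linarith : 0 ≤ x.re)
    have gen : ∀ (G : ℂ) (κ u q : ℝ), 0 < κ → 0 < u →
        ‖G‖ ≤ κ * (1 + x.re * u) ^ q * Real.exp (-(a * (x.re * u))) →
        (1 + x.re * u) ^ q * (1 + x.re) ^ (-q) ≤ u ^ min q 0 →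
        ‖G * Complex.exp (a * (x * (u : ℂ))) * (((1 + x.re) ^ (-q) : ℝ) : ℂ)‖ ≤
          κ * u ^ min q 0 := by
      intro G κ u q hκ hu h1 h2
      have hp : (0 : ℝ) < (1 + x.re) ^ (-q) := Real.rpow_pos_of_pos (by linarith) _
      rw [norm_mul, norm_mul, norm_exp_scaled, Complex.norm_real, Real.norm_of_nonneg hp.le]
      calc ‖G‖ * Real.exp (a * (x.re * u)) * (1 + x.re) ^ (-q)
          ≤ κ * (1 + x.re * u) ^ q * Real.exp (-(a * (x.re * u))) *
            Real.exp (a * (x.re * u)) * (1 + x.re) ^ (-q) := by gcongr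
        _ = κ * ((1 + x.re * u) ^ q * (1 + x.re) ^ (-q)) := by
            rw [Real.exp_neg]; field_simp
        _ ≤ _ := by gcongr
    have n1 := gen _ K (1 - v) e hK hv1 b1 b3
    have n2 := gen _ K' v e' hK' hv0 b2 b4
    have e1 : (1 - v) ^ (b + min e 0 - 1) = (1 - v) ^ (b - 1) * (1 - v) ^ min e 0 := by
      rw [← Real.rpow_add hv1]; congr 1; ring
    have e2 : v ^ (b' + min e' 0 - 1) = v ^ (b' - 1) * v ^ min e' 0 := by
      rw [← Real.rpow_add hv0]; congr 1; ring
    rw [norm_mul, norm_mul, Complex.norm_real, Real.norm_of_nonneg (by positivity), e1, e2]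
    calc _ ≤ (1 - v) ^ (b - 1) * v ^ (b' - 1) *
        ((K * (1 - v) ^ min e 0) * (K' * v ^ min e' 0)) :=
          mul_le_mul_of_nonneg_left (mul_le_mul n1 n2 (norm_nonneg _) (by positivity))
            (by positivity)
      _ = _ := by ring
  · refine (integrableOn_beta ?_ ?_).const_mul _
    · rcases min_cases e 0 with ⟨h1, _⟩ | ⟨h1, _⟩ <;> rw [h1] <;> linarith [h.b_pos, h.one_le]
    · rcases min_cases e' 0 with ⟨h1, _⟩ | ⟨h1, _⟩ <;> rw [h1] <;> linarith [h'.b_pos, h'.one_le]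
  · refine (ae_restrict_iff' measurableSet_Ioo).2 (Eventually.of_forall fun v hv => ?_)
    have hv0 := hv.1
    have hv1 : 0 < 1 - v := by linarith [hv.2]
    have t1 := tendsto_kernel_rescaled hlim hv1 (tendsto_mul_stripEnd hv1 (by linarith))
      (tendsto_ratio_stripEnd (1 - v))
    have t2 := tendsto_kernel_rescaled hlim' hv0 (tendsto_mul_stripEnd hv0 hv.2.le)
      (tendsto_ratio_stripEnd v)
    have t3 := (t1.mul t2).const_mul (((1 - v) ^ (b - 1) * v ^ (b' - 1) : ℝ) : ℂ)
    convert! t3 using 2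
    have e1 : (1 - v) ^ (e + b - 1) = (1 - v) ^ (b - 1) * (1 - v) ^ e := by
      rw [← Real.rpow_add hv1]; congr 1; ring
    have e2 : v ^ (e' + b' - 1) = v ^ (b' - 1) * v ^ e' := by
      rw [← Real.rpow_add hv0]; congr 1; ring
    rw [e1, e2]
    push_cast
    ring

lemma beta_integral_pos {b b' : ℝ} (hb : 0 < b) (hb' : 0 < b') :
    0 < ∫ v in Ioo (0 : ℝ) 1, (1 - v) ^ (b - 1) * v ^ (b' - 1) := by
  have hpos : ∀ v ∈ Ioo (0 : ℝ) 1, 0 < (1 - v) ^ (b - 1) * v ^ (b' - 1) := by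
    intro v hv
    have hv0 := hv.1
    have hv1 : 0 < 1 - v := by linarith [hv.2]
    positivity
  rw [setIntegral_pos_iff_support_of_nonneg_ae _ (integrableOn_beta hb hb')]
  · rw [inter_eq_right.2 fun v hv => Function.mem_support.2 (hpos v hv).ne']
    simp
  · exact (ae_restrict_iff' measurableSet_Ioo).2
      (Eventually.of_forall fun v hv => (hpos v hv).le)

lemma isKernel_convKernel_of_eq {b b' a e e' : ℝ} {g g' : ℂ → ℂ} (h : IsKernel b a e g)
    (h' : IsKernel b' a e' g') :
    IsKernel (b + b') a (e + e') (convKernel b b' g g') where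
  b_pos := add_pos h.b_pos h'.b_pos
  a_pos := h.a_pos
  one_le := by linarith [h.one_le, h'.one_le]
  diff := differentiableOn_convKernel h.b_pos h'.b_pos h.diff h'.diff
  real_pos := fun _ hx => convKernel_real_pos h h' hx
  asymp := by
    obtain ⟨c, hc, hl⟩ := h.asymp
    obtain ⟨c', hc', hl'⟩ := h'.asymp
    refine ⟨_, ?_, tendsto_convKernel_of_eq h h' hl hl'⟩
    have := beta_integral_pos (b := e + b) (b' := e' + b') (by linarith [h.one_le])
      (by linarith [h'.one_le])
    positivity

lemma integrableOn_conv_integrand {b b' : ℝ} (hb : 0 < b) (hb' : 0 < b') {g g' : ℂ → ℂ}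
    (hg : ContinuousOn g kernelDomain) (hg' : ContinuousOn g' kernelDomain) {x : ℂ}
    (hx : x ∈ kernelDomain) : IntegrableOn (fun v : ℝ =>
      (((1 - v) ^ (b - 1) * v ^ (b' - 1) : ℝ) : ℂ) *
        (g (x * ((1 - v : ℝ) : ℂ)) * g' (x * (v : ℂ)))) (Ioo 0 1) := by
  obtain ⟨ε, hε, K, hK0, hK⟩ := exists_local_bound hg hx
  obtain ⟨ε', hε', K', hK0', hK'⟩ := exists_local_bound hg' hx
  refine Integrable.mono' ((integrableOn_beta hb hb').mul_const (K * K'))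
    ((continuousOn_conv_integrand hg hg' hx).aestronglyMeasurable measurableSet_Ioo) ?_
  refine (ae_restrict_iff' measurableSet_Ioo).2 (Eventually.of_forall fun v hv => ?_)
  have h1 := hK x (Metric.mem_ball_self hε) (1 - v) (by linarith [hv.2]) (by linarith [hv.1])
  have h2 := hK' x (Metric.mem_ball_self hε') v hv.1.le hv.2.le
  have hv0 := hv.1
  have hv1 : 0 < 1 - v := by linarith [hv.2]
  rw [norm_mul, norm_mul, Complex.norm_real, Real.norm_of_nonneg (by positivity)]
  exact mul_le_mul_of_nonneg_left (mul_le_mul h1 h2 (norm_nonneg _) hK0) (by positivity)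

lemma rpow_le_two_rpow_abs {u : ℝ} (h : 1 / 2 ≤ u) (h1 : u ≤ 1) (q : ℝ) :
    u ^ q ≤ 2 ^ |q| := by
  rcases le_total 0 q with hq | hq
  · rw [abs_of_nonneg hq]
    exact Real.rpow_le_rpow (by linarith) (by linarith) hq
  · rw [abs_of_nonpos hq, Real.rpow_neg (by norm_num), ← Real.inv_rpow (by norm_num)]
    exact Real.rpow_le_rpow_of_nonpos (by norm_num) (by linarith) hq

/-! ### Convolution of kernels with different exponential rates. -/

section DominantFactor

variable {b b' a a' e e' c : ℝ} {g g' : ℂ → ℂ}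

/-- For `v > 1/2` the faster decaying factor is evaluated beyond `Re x / 2`. Its excess rate gains
at least `exp (-(a' - a) Re x / 2)` over `e^{-a x}`, which beats all powers. -/
lemma tendsto_convKernel_upper_half (h : IsKernel b a e g) (h' : IsKernel b' a' e' g')
    (haa : a < a') :
    Tendsto (fun x : ℂ => (∫ v in Ioo (1 / 2 : ℝ) 1,
      (((1 - v) ^ (b - 1) * v ^ (b' - 1) : ℝ) : ℂ) *
        (g (x * ((1 - v : ℝ) : ℂ)) * g' (x * (v : ℂ)))) *
      (Complex.exp (a * x) * (((1 + x.re) ^ (-(e - b')) : ℝ) : ℂ))) stripEnd (𝓝 0) := by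
  obtain ⟨K, hK, hbd⟩ := h.exists_scaled_bound
  obtain ⟨K', hK', hbd'⟩ := h'.exists_scaled_bound
  set J := ∫ v in Ioo (1 / 2 : ℝ) 1, (1 - v) ^ (b + min e 0 - 1) * v ^ (b' - 1)
  have hint : IntegrableOn (fun v : ℝ => (1 - v) ^ (b + min e 0 - 1) * v ^ (b' - 1))
      (Ioo (1 / 2) 1) := by
    refine (integrableOn_beta ?_ h'.b_pos).mono_set (Ioo_subset_Ioo_left (by norm_num))
    rcases min_cases e 0 with ⟨h1, _⟩ | ⟨h1, _⟩ <;> rw [h1] <;> linarith [h.b_pos, h.one_le]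
  have hdecay : Tendsto (fun x : ℂ => J * (K * K') *
      ((1 + x.re) ^ (b' + |e'|) * Real.exp (-((a' - a) / 2 * x.re)))) stripEnd (𝓝 0) := by
    have t1 : Tendsto (fun X : ℝ => (1 + X) ^ (b' + |e'|) * Real.exp (-((a' - a) / 2 * X)))
        atTop (𝓝 0) := by
      have := (tendsto_rpow_mul_exp_neg_mul_atTop_nhds_zero (b' + |e'|) ((a' - a) / 2)
        (by linarith)).comp (tendsto_atTop_add_const_left atTop (1 : ℝ) tendsto_id)
      have := this.mul_const (Real.exp ((a' - a) / 2))
      rw [zero_mul] at this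
      refine this.congr fun X => ?_
      simp only [Function.comp, id]
      rw [mul_assoc, ← Real.exp_add]
      congr 2
      ring
    simpa using (t1.comp tendsto_re_stripEnd).const_mul (J * (K * K'))
  refine squeeze_zero_norm' ?_ hdecay
  rw [eventually_stripEnd]
  refine ⟨1, fun x hx hi => ?_⟩
  have hX : 0 < 1 + x.re := by linarith
  rw [← integral_mul_const]
  have : J * (K * K') * ((1 + x.re) ^ (b' + |e'|) * Real.exp (-((a' - a) / 2 * x.re))) =
      ∫ v in Ioo (1 / 2 : ℝ) 1, (1 - v) ^ (b + min e 0 - 1) * v ^ (b' - 1) *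
        ((K * K') * ((1 + x.re) ^ (b' + |e'|) * Real.exp (-((a' - a) / 2 * x.re)))) := by
    rw [integral_mul_const]; ring
  rw [this]
  refine norm_integral_le_of_norm_le (hint.mul_const _) ?_
  refine (ae_restrict_iff' measurableSet_Ioo).2 (Eventually.of_forall fun v hv => ?_)
  have hvh := hv.1
  have hv0 : 0 < v := by linarith [hv.1]
  have hv1 : 0 < 1 - v := by linarith [hv.2]
  have b1 := hbd x hx hi (1 - v) hv1 (by linarith)
  have b2 := hbd' x hx hi v hv0 hv.2.le
  have b3 := one_add_mul_rpow_le (e := e) hv1 (by linarith) (by linarith : 0 ≤ x.re)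
  have hp : (0 : ℝ) < (1 + x.re) ^ (-(e - b')) := Real.rpow_pos_of_pos hX _
  have hax : (a * x : ℂ).re = a * x.re := Complex.re_ofReal_mul _ _
  have e1 : (1 - v) ^ (b + min e 0 - 1) = (1 - v) ^ (b - 1) * (1 - v) ^ min e 0 := by
    rw [← Real.rpow_add hv1]; congr 1; ring
  have e2 : (1 + x.re) ^ (-(e - b')) = (1 + x.re) ^ (-e) * (1 + x.re) ^ b' := by
    rw [← Real.rpow_add hX]; congr 1; ring
  have e3 : Real.exp (a * x.re) =
      Real.exp (a * (x.re * (1 - v))) * Real.exp (a * (x.re * v)) := by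
    rw [← Real.exp_add]; congr 1; ring
  have b4 : (1 + x.re * v) ^ e' ≤ (1 + x.re) ^ |e'| := by
    refine (Real.rpow_le_rpow_of_exponent_le (by nlinarith) (le_abs_self e')).trans ?_
    exact Real.rpow_le_rpow (by positivity) (by nlinarith [hv.2]) (abs_nonneg _)
  have b5 : Real.exp (-(a' * (x.re * v))) * Real.exp (a * (x.re * v)) ≤
      Real.exp (-((a' - a) / 2 * x.re)) := by
    rw [← Real.exp_add, Real.exp_le_exp]
    nlinarith [mul_pos (sub_pos.2 haa) (by linarith : 0 < x.re)]
  rw [norm_mul, norm_mul, norm_mul, norm_mul, Complex.norm_real, Complex.norm_real,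
    Real.norm_of_nonneg (by positivity), Real.norm_of_nonneg hp.le, Complex.norm_exp, hax, e1, e2,
    e3, Real.rpow_add hX]
  have hxv : 0 < 1 + x.re * v := by positivity
  have hxv' : 0 < 1 + x.re * (1 - v) := by positivity
  calc (1 - v) ^ (b - 1) * v ^ (b' - 1) *
        (‖g (x * ((1 - v : ℝ) : ℂ))‖ * ‖g' (x * (v : ℂ))‖) *
        (Real.exp (a * (x.re * (1 - v))) * Real.exp (a * (x.re * v)) *
          ((1 + x.re) ^ (-e) * (1 + x.re) ^ b'))
      ≤ (1 - v) ^ (b - 1) * v ^ (b' - 1) *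
        ((K * (1 + x.re * (1 - v)) ^ e * Real.exp (-(a * (x.re * (1 - v))))) *
          (K' * (1 + x.re * v) ^ e' * Real.exp (-(a' * (x.re * v))))) *
        (Real.exp (a * (x.re * (1 - v))) * Real.exp (a * (x.re * v)) *
          ((1 + x.re) ^ (-e) * (1 + x.re) ^ b')) := by gcongr
    _ = (1 - v) ^ (b - 1) * v ^ (b' - 1) * (K * K') *
        ((1 + x.re * (1 - v)) ^ e * (1 + x.re) ^ (-e)) * (1 + x.re * v) ^ e' *
        (Real.exp (-(a' * (x.re * v))) * Real.exp (a * (x.re * v))) * (1 + x.re) ^ b' := by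
        rw [Real.exp_neg (a * (x.re * (1 - v)))]; field_simp
    _ ≤ (1 - v) ^ (b - 1) * v ^ (b' - 1) * (K * K') * (1 - v) ^ min e 0 * (1 + x.re) ^ |e'| *
        Real.exp (-((a' - a) / 2 * x.re)) * (1 + x.re) ^ b' := by gcongr
    _ = _ := by ring

/-- After the substitution `y = v Re x` the faster decaying factor is evaluated near the fixed point
`y`, and the slower one near `x - y`, where it contributes `c e^{-a x} e^{a y}`. The limit is `c`
times the Laplace transform of the second density at `-a`, convergent because `a < a'`. The Jacobian
together with `v ^ (b' - 1)` yields `(Re x) ^ (-b')`, whence the exponent `e - b'`. -/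
lemma tendsto_convKernel_lower_half (h : IsKernel b a e g) (h' : IsKernel b' a' e' g')
    (haa : a < a')
    (hlim : Tendsto (fun x : ℂ => g x * Complex.exp (a * x) * (((1 + x.re) ^ (-e) : ℝ) : ℂ))
      stripEnd (𝓝 c)) :
    Tendsto (fun x : ℂ => (∫ v in Ioc (0 : ℝ) (1 / 2),
      (((1 - v) ^ (b - 1) * v ^ (b' - 1) : ℝ) : ℂ) *
        (g (x * ((1 - v : ℝ) : ℂ)) * g' (x * (v : ℂ)))) *
      (Complex.exp (a * x) * (((1 + x.re) ^ (-(e - b')) : ℝ) : ℂ))) stripEnd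
      (𝓝 ((c * laplace b' g' (-a) : ℝ) : ℂ)) := by
  obtain ⟨K, hK, hbd⟩ := h.exists_scaled_bound
  obtain ⟨K', hK', hbd'⟩ := h'.exists_scaled_bound
  set W : ℂ → ℝ → ℂ := fun x v => (((1 - v) ^ (b - 1) * v ^ (b' - 1) : ℝ) : ℂ) *
    ((g (x * ((1 - v : ℝ) : ℂ)) * Complex.exp (a * (x * ((1 - v : ℝ) : ℂ))) *
      (((1 + x.re) ^ (-e) : ℝ) : ℂ)) *
    (g' (x * (v : ℂ)) * Complex.exp (a * (x * (v : ℂ))) * (((1 + x.re) ^ b' : ℝ) : ℂ))) with hW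
  -- The integrand in the variable `y = v Re x`, extended by zero so that the domain of integration
  -- no longer depends on `x`.
  set Φ : ℂ → ℝ → ℂ := fun x y =>
    ((x.re)⁻¹ : ℂ) * (Ioc (0 : ℝ) (1 / 2)).indicator (W x) ((x.re)⁻¹ * y) with hΦ
  have hrepr : ∀ x : ℂ, 1 ≤ x.re → ∫ y, Φ x y = (∫ v in Ioc (0 : ℝ) (1 / 2),
      (((1 - v) ^ (b - 1) * v ^ (b' - 1) : ℝ) : ℂ) *
        (g (x * ((1 - v : ℝ) : ℂ)) * g' (x * (v : ℂ)))) *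
      (Complex.exp (a * x) * (((1 + x.re) ^ (-(e - b')) : ℝ) : ℂ)) := by
    intro x hx
    have hX : 0 < x.re := by linarith
    have hXc : (x.re : ℂ) ≠ 0 := by exact_mod_cast hX.ne'
    rw [hΦ, integral_const_mul, Measure.integral_comp_mul_left, inv_inv, abs_of_pos hX,
      Complex.real_smul, ← mul_assoc, inv_mul_cancel₀ hXc, one_mul,
      integral_indicator measurableSet_Ioc, ← integral_mul_const]
    congr 1
    ext v
    have e1 : Complex.exp (a * x) =
        Complex.exp (a * (x * ((1 - v : ℝ) : ℂ))) * Complex.exp (a * (x * (v : ℂ))) := by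
      rw [← Complex.exp_add]; congr 1; push_cast; ring
    have e2 : (1 + x.re) ^ (-(e - b')) = (1 + x.re) ^ (-e) * (1 + x.re) ^ b' := by
      rw [← Real.rpow_add (by linarith)]; congr 1; ring
    rw [hW, e1, e2]
    push_cast
    ring
  have hvals : ∀ x : ℂ, 1 ≤ x.re → ∀ y : ℝ, 0 < y → y ≤ x.re / 2 → Φ x y =
      (((1 - (x.re)⁻¹ * y) ^ (b - 1) * y ^ (b' - 1) * ((1 + x.re) / x.re) ^ b' : ℝ) : ℂ) *
      ((g (x * ((1 - (x.re)⁻¹ * y : ℝ) : ℂ)) *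
        Complex.exp (a * (x * ((1 - (x.re)⁻¹ * y : ℝ) : ℂ))) *
        (((1 + x.re) ^ (-e) : ℝ) : ℂ)) *
      (g' (x * (((x.re)⁻¹ * y : ℝ) : ℂ)) *
        Complex.exp (a * (x * (((x.re)⁻¹ * y : ℝ) : ℂ))))) := by
    intro x hx y hy hyx
    have hX : 0 < x.re := by linarith
    have hmem : (x.re)⁻¹ * y ∈ Ioc (0 : ℝ) (1 / 2) := by
      refine ⟨by positivity, ?_⟩
      rw [inv_mul_le_iff₀ hX]; linarith
    simp only [hΦ, indicator_of_mem hmem, hW]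
    have e1 : (1 - (x.re)⁻¹ * y) ^ (b - 1) * y ^ (b' - 1) * ((1 + x.re) / x.re) ^ b' =
        (x.re)⁻¹ * ((1 - (x.re)⁻¹ * y) ^ (b - 1) * ((x.re)⁻¹ * y) ^ (b' - 1)) *
          (1 + x.re) ^ b' := by
      rw [Real.mul_rpow (by positivity) hy.le, Real.div_rpow (by linarith) hX.le,
        Real.inv_rpow hX.le, Real.rpow_sub_one hX.ne']
      have := (Real.rpow_pos_of_pos hX b').ne'
      field_simp
    rw [e1]
    push_cast
    ring
  have hzero : ∀ x : ℂ, 1 ≤ x.re → ∀ y : ℝ, ¬ (0 < y ∧ y ≤ x.re / 2) → Φ x y = 0 := by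
    intro x hx y hy
    have hX : 0 < x.re := by linarith
    have hmem : (x.re)⁻¹ * y ∉ Ioc (0 : ℝ) (1 / 2) := by
      rintro ⟨h1, h2⟩
      rw [inv_mul_le_iff₀ hX] at h2
      exact hy ⟨(pos_iff_pos_of_mul_pos h1).1 (by positivity), by linarith⟩
    simp only [hΦ, indicator_of_notMem hmem, mul_zero]
  -- Here `1 - v` lies in `[1/2, 1]` and `(1 + Re x) / Re x ≤ 2`; these two facts give the powers of
  -- `2`.
  set M : ℝ := K * 2 ^ |b - 1 + min e 0| * 2 ^ b' * K'
  have hdom := tendsto_integral_filter_of_dominated_convergence (μ := volume)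
    (l := stripEnd) (F := Φ)
    (f := (Ioi (0 : ℝ)).indicator
      (fun y => ((c * (density b' g' y * Real.exp (-(-a * y))) : ℝ) : ℂ)))
    ((Ioi (0 : ℝ)).indicator
      (fun y => M * (y ^ (b' - 1) * (1 + y) ^ e' * Real.exp (-((a' - a) * y))))) ?_ ?_ ?_ ?_
  · rw [integral_indicator measurableSet_Ioi, integral_complex_ofReal, integral_const_mul] at hdom
    refine hdom.congr' ?_
    rw [EventuallyEq, eventually_stripEnd]
    exact ⟨1, fun x hx _ => hrepr x hx⟩
  · rw [eventually_stripEnd]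
    refine ⟨1, fun x hx _ => ?_⟩
    have hX : 0 < x.re := by linarith
    have hxd : x ∈ kernelDomain := Or.inr hX
    have hc : ContinuousOn (W x) (Ioc 0 (1 / 2)) := by
      have hc := (continuousOn_conv_integrand (b := b) (b' := b') h.diff.continuousOn
        h'.diff.continuousOn hxd).mono
        (fun v (hv : v ∈ Ioc (0 : ℝ) (1 / 2)) => ⟨hv.1, by linarith [hv.2]⟩)
      have hc2 : ContinuousOn (fun v : ℝ => Complex.exp (a * (x * ((1 - v : ℝ) : ℂ))) *
        (((1 + x.re) ^ (-e) : ℝ) : ℂ) * (Complex.exp (a * (x * (v : ℂ))) *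
        (((1 + x.re) ^ b' : ℝ) : ℂ))) (Ioc 0 (1 / 2)) := by fun_prop
      refine (hc.mul hc2).congr fun v _ => ?_
      simp only [hW, Pi.mul_apply]
      ring
    have hms : MeasurableSet ((fun y : ℝ => (x.re)⁻¹ * y) ⁻¹' Ioc (0 : ℝ) (1 / 2)) :=
      (measurable_const_mul _) measurableSet_Ioc
    have hcc : ContinuousOn (W x ∘ fun y : ℝ => (x.re)⁻¹ * y)
        ((fun y : ℝ => (x.re)⁻¹ * y) ⁻¹' Ioc (0 : ℝ) (1 / 2)) :=
      hc.comp (by fun_prop) (fun y hy => hy)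
    have hm := (aestronglyMeasurable_indicator_iff hms).2
      (hcc.aestronglyMeasurable hms (μ := volume))
    exact hm.const_mul _
  · rw [eventually_stripEnd]
    refine ⟨1, fun x hx hi => Eventually.of_forall fun y => ?_⟩
    by_cases hy : 0 < y ∧ y ≤ x.re / 2
    · obtain ⟨hy, hyx⟩ := hy
      have hX : 0 < x.re := by linarith
      set v := (x.re)⁻¹ * y with hv
      have hv0 : 0 < v := by positivity
      have hvh : v ≤ 1 / 2 := by rw [hv, inv_mul_le_iff₀ hX]; linarith
      have hv1 : 0 < 1 - v := by linarith
      have hXv : x.re * v = y := by rw [hv]; field_simp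
      have b1 := hbd x hx hi (1 - v) hv1 (by linarith)
      have b2 := hbd' x hx hi v hv0 (by linarith)
      have b3 := one_add_mul_rpow_le (e := e) hv1 (by linarith) (by linarith : 0 ≤ x.re)
      rw [hXv] at b2
      have b4 : (1 - v) ^ (b - 1) * (1 - v) ^ min e 0 ≤ 2 ^ |b - 1 + min e 0| := by
        rw [← Real.rpow_add hv1]
        exact rpow_le_two_rpow_abs (by linarith) (by linarith) _
      have b5 : ((1 + x.re) / x.re) ^ b' ≤ 2 ^ b' := by
        refine Real.rpow_le_rpow (by positivity) ?_ h'.b_pos.le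
        rw [div_le_iff₀ hX]; linarith
      have hp : (0 : ℝ) < (1 + x.re) ^ (-e) := Real.rpow_pos_of_pos (by linarith) _
      have hp2 : (0 : ℝ) < ((1 + x.re) / x.re) ^ b' := Real.rpow_pos_of_pos (by positivity) _
      rw [hvals x hx y hy hyx, indicator_of_mem (show y ∈ Ioi (0 : ℝ) from hy), ← hv]
      rw [norm_mul, norm_mul, norm_mul, norm_mul, norm_mul, norm_exp_scaled, norm_exp_scaled,
        Complex.norm_real, Complex.norm_real, Real.norm_of_nonneg (by positivity),
        Real.norm_of_nonneg hp.le, hXv]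
      have hxv' : 0 < 1 + x.re * (1 - v) := by positivity
      calc (1 - v) ^ (b - 1) * y ^ (b' - 1) * ((1 + x.re) / x.re) ^ b' *
            (‖g (x * ((1 - v : ℝ) : ℂ))‖ * Real.exp (a * (x.re * (1 - v))) * (1 + x.re) ^ (-e) *
            (‖g' (x * (v : ℂ))‖ * Real.exp (a * y)))
          ≤ (1 - v) ^ (b - 1) * y ^ (b' - 1) * 2 ^ b' *
            (K * (1 + x.re * (1 - v)) ^ e * Real.exp (-(a * (x.re * (1 - v)))) *
              Real.exp (a * (x.re * (1 - v))) * (1 + x.re) ^ (-e) *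
            (K' * (1 + y) ^ e' * Real.exp (-(a' * y)) * Real.exp (a * y))) := by gcongr
        _ = (1 - v) ^ (b - 1) * y ^ (b' - 1) * 2 ^ b' *
            (K * ((1 + x.re * (1 - v)) ^ e * (1 + x.re) ^ (-e)) *
            (K' * (1 + y) ^ e' * Real.exp (-((a' - a) * y)))) := by
            have e1 : Real.exp (-((a' - a) * y)) = Real.exp (-(a' * y)) * Real.exp (a * y) := by
              rw [← Real.exp_add]; congr 1; ring
            rw [e1, Real.exp_neg (a * (x.re * (1 - v)))]; field_simp
        _ ≤ (1 - v) ^ (b - 1) * y ^ (b' - 1) * 2 ^ b' * (K * (1 - v) ^ min e 0 *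
            (K' * (1 + y) ^ e' * Real.exp (-((a' - a) * y)))) := by gcongr
        _ = ((1 - v) ^ (b - 1) * (1 - v) ^ min e 0) * y ^ (b' - 1) * 2 ^ b' * (K *
            (K' * (1 + y) ^ e' * Real.exp (-((a' - a) * y)))) := by ring
        _ ≤ 2 ^ |b - 1 + min e 0| * y ^ (b' - 1) * 2 ^ b' * (K *
            (K' * (1 + y) ^ e' * Real.exp (-((a' - a) * y)))) := by gcongr
        _ = _ := by simp only [M]; ring
    · rw [hzero x hx y hy, norm_zero]
      refine indicator_nonneg (fun y (hy : 0 < y) => ?_) y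
      positivity
  · rw [integrable_indicator_iff measurableSet_Ioi]
    exact (integrableOn_rpow_mul_one_add_rpow_mul_exp h'.b_pos e' (sub_pos.2 haa)).const_mul _
  · refine Eventually.of_forall fun y => ?_
    rcases le_or_gt y 0 with hy | hy
    · rw [indicator_of_notMem (by simpa using hy)]
      refine tendsto_const_nhds.congr' ?_
      rw [EventuallyEq, eventually_stripEnd]
      exact ⟨1, fun x hx _ => (hzero x hx y (fun h => absurd h.1 (not_lt.2 hy))).symm⟩
    · rw [indicator_of_mem (show y ∈ Ioi (0 : ℝ) from hy)]
      have hre := tendsto_re_stripEnd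
      have hinv : Tendsto (fun x : ℂ => (x.re)⁻¹ * y) stripEnd (𝓝 0) := by
        simpa using (tendsto_inv_atTop_zero.comp hre).mul_const y
      have hsub : Tendsto (fun x : ℂ => 1 - (x.re)⁻¹ * y) stripEnd (𝓝 1) := by
        simpa using tendsto_const_nhds.sub hinv
      have hbig : ∀ᶠ x : ℂ in stripEnd, 1 ≤ x.re ∧ y ≤ x.re / 2 := by
        rw [eventually_stripEnd]
        exact ⟨max 1 (2 * y), fun x hx _ => ⟨le_of_max_le_left hx, by
          linarith [le_of_max_le_right hx]⟩⟩
      have hu_re : ∀ᶠ x : ℂ in stripEnd,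
          x.re - y = (x * ((1 - (x.re)⁻¹ * y : ℝ) : ℂ)).re := by
        filter_upwards [hbig] with x hx
        have : x.re ≠ 0 := by linarith [hx.1]
        rw [scaled_re]; field_simp
      have hu : Tendsto (fun x : ℂ => x * ((1 - (x.re)⁻¹ * y : ℝ) : ℂ)) stripEnd stripEnd := by
        rw [tendsto_stripEnd_iff]
        refine ⟨(tendsto_atTop_add_const_right _ (-y) hre).congr' hu_re, ?_⟩
        rw [eventually_stripEnd]
        refine ⟨max 1 y, fun x hx hi => ?_⟩
        have hX : 0 < x.re := by linarith [le_of_max_le_left hx]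
        have h1 : (x.re)⁻¹ * y ≤ 1 := by
          rw [inv_mul_le_iff₀ hX]; linarith [le_of_max_le_right hx]
        have h2 : 0 < (x.re)⁻¹ * y := by positivity
        rw [scaled_im, abs_mul, abs_of_nonneg (by linarith : 0 ≤ 1 - (x.re)⁻¹ * y)]
        nlinarith [abs_nonneg x.im]
      have hratio : Tendsto (fun x : ℂ =>
          (1 + (x * ((1 - (x.re)⁻¹ * y : ℝ) : ℂ)).re) / (1 + x.re)) stripEnd (𝓝 1) := by
        have t : Tendsto (fun x : ℂ => 1 - y / (1 + x.re)) stripEnd (𝓝 (1 - 0)) :=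
          tendsto_const_nhds.sub
            (tendsto_const_nhds.div_atTop (tendsto_atTop_add_const_left _ 1 hre))
        rw [sub_zero] at t
        refine t.congr' ?_
        filter_upwards [hu_re, hbig] with x hx hx1
        rw [← hx]
        have : (1 : ℝ) + x.re ≠ 0 := by linarith [hx1.1]
        field_simp
        ring
      have t1 := tendsto_kernel_rescaled hlim one_pos hu hratio
      have hpt : Tendsto (fun x : ℂ => x * (((x.re)⁻¹ * y : ℝ) : ℂ)) stripEnd (𝓝 (y : ℂ)) := by
        rw [tendsto_iff_norm_sub_tendsto_zero]
        have t : Tendsto (fun x : ℂ => Real.pi * ((x.re)⁻¹ * y)) stripEnd (𝓝 0) := by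
          simpa using hinv.const_mul Real.pi
        refine squeeze_zero' (Eventually.of_forall fun _ => norm_nonneg _) ?_ t
        rw [eventually_stripEnd]
        refine ⟨1, fun x hx hi => ?_⟩
        have hX : 0 < x.re := by linarith
        have : x * (((x.re)⁻¹ * y : ℝ) : ℂ) - y =
            ((x.im * ((x.re)⁻¹ * y) : ℝ) : ℂ) * Complex.I := by
          apply Complex.ext
          · rw [Complex.sub_re, scaled_re, Complex.ofReal_re, Complex.re_ofReal_mul]
            simp only [Complex.I_re, mul_zero]
            field_simp
            ring
          · rw [Complex.sub_im, scaled_im]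
            simp
        rw [this, norm_mul, Complex.norm_I, mul_one, Complex.norm_real, Real.norm_eq_abs,
          abs_mul, abs_of_pos (by positivity : 0 < (x.re)⁻¹ * y)]
        gcongr
      have t2 : Tendsto (fun x : ℂ => g' (x * (((x.re)⁻¹ * y : ℝ) : ℂ)) *
          Complex.exp (a * (x * (((x.re)⁻¹ * y : ℝ) : ℂ)))) stripEnd
          (𝓝 (g' y * Complex.exp (a * (y : ℂ)))) := by
        have hc : ContinuousAt (fun z : ℂ => g' z * Complex.exp (a * z)) y := by
          refine ContinuousAt.mul ?_ (by fun_prop)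
          exact h'.diff.continuousOn.continuousAt
            (isOpen_kernelDomain.mem_nhds (ofReal_mem_kernelDomain (by linarith)))
        exact hc.tendsto.comp hpt
      have t3 : Tendsto (fun x : ℂ => (1 - (x.re)⁻¹ * y) ^ (b - 1) * y ^ (b' - 1) *
          ((1 + x.re) / x.re) ^ b') stripEnd (𝓝 (1 ^ (b - 1) * y ^ (b' - 1) * 1 ^ b')) := by
        refine ((hsub.rpow_const (Or.inl one_ne_zero)).mul tendsto_const_nhds).mul
          (Tendsto.rpow_const ?_ (Or.inl one_ne_zero))
        have t : Tendsto (fun x : ℂ => (x.re)⁻¹ + 1) stripEnd (𝓝 (0 + 1)) :=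
          (tendsto_inv_atTop_zero.comp hre).add tendsto_const_nhds
        rw [zero_add] at t
        refine t.congr' ?_
        filter_upwards [hbig] with x hx
        have : x.re ≠ 0 := by linarith [hx.1]
        field_simp
      have t4 := ((Complex.continuous_ofReal.tendsto _).comp t3).mul (t1.mul t2)
      have hval : (((1 : ℝ) ^ (b - 1) * y ^ (b' - 1) * 1 ^ b' : ℝ) : ℂ) *
          (((c * 1 ^ e : ℝ) : ℂ) * (g' y * Complex.exp (a * (y : ℂ)))) =
          ((c * (density b' g' y * Real.exp (-(-a * y))) : ℝ) : ℂ) := by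
        rw [h'.eq_re (by linarith : -1 < y), density]
        simp only [Real.one_rpow]
        push_cast
        rw [show -(-(a : ℂ) * y) = a * y by ring]
        ring
      rw [hval] at t4
      refine t4.congr' ?_
      filter_upwards [hbig] with x hx
      rw [hvals x hx.1 y hy hx.2]
      simp only [Function.comp]

/-- The slower exponential dominates and the other factor only changes the constant and the power.
The sum `(e - b') + (b + b') = e + b` is unchanged, so the lower bound `1` survives. -/
lemma isKernel_convKernel_of_lt (h : IsKernel b a e g) (h' : IsKernel b' a' e' g')
    (haa : a < a') :
    IsKernel (b + b') a (e - b') (convKernel b b' g g') where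
  b_pos := add_pos h.b_pos h'.b_pos
  a_pos := h.a_pos
  one_le := by linarith [h.one_le]
  diff := differentiableOn_convKernel h.b_pos h'.b_pos h.diff h'.diff
  real_pos := fun _ hx => convKernel_real_pos h h' hx
  asymp := by
    obtain ⟨c, hc, hl⟩ := h.asymp
    refine ⟨c * laplace b' g' (-a), mul_pos hc (h'.laplace_pos (by linarith)), ?_⟩
    have t := (tendsto_convKernel_lower_half h h' haa hl).add
      (tendsto_convKernel_upper_half h h' haa)
    rw [add_zero] at t
    refine t.congr' ?_
    rw [EventuallyEq, eventually_stripEnd]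
    refine ⟨1, fun x hx _ => ?_⟩
    have hi := integrableOn_conv_integrand h.b_pos h'.b_pos h.diff.continuousOn
      h'.diff.continuousOn (show x ∈ kernelDomain from Or.inr (show 0 < x.re by linarith))
    have hU : Ioc (0 : ℝ) (1 / 2) ∪ Ioo (1 / 2) 1 = Ioo 0 1 :=
      Ioc_union_Ioo_eq_Ioo (by norm_num) (by norm_num)
    rw [← add_mul, ← setIntegral_union, hU, mul_assoc]
    · rfl
    · exact disjoint_left.2 fun v h1 h2 => absurd h1.2 (not_le.2 h2.1)
    · exact measurableSet_Ioo
    · exact hi.mono_set (hU ▸ subset_union_left)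
    · exact hi.mono_set (hU ▸ subset_union_right)

end DominantFactor

/-! ### The density attached to a family of hypergeometric parameters. -/

/-- The kernel `g` is normalized and its Laplace transform satisfies the recurrence of
`t ↦ ∏ i, Γ (α i + t) / Γ (1 + t)`. -/
structure HasLaplaceRecurrence {ι : Type*} (s : Finset ι) (α : ι → ℝ) (b a : ℝ) (g : ℂ → ℂ) :
    Prop where
  zero : laplace b g 0 = 1
  succ : ∀ t : ℝ, -a < t →
    (∏ _i ∈ s, (1 + t)) * laplace b g (t + 1) = (∏ i ∈ s, (α i + t)) * laplace b g t

lemma HasLaplaceRecurrence.conv {ι : Type*} {s : Finset ι} {i : ι} (hi : i ∉ s) {α : ι → ℝ}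
    {b b' a a' e e' a₀ : ℝ} {g g' : ℂ → ℂ} (k : IsKernel b a e g) (k' : IsKernel b' a' e' g')
    (h : HasLaplaceRecurrence {i} α b a g) (h' : HasLaplaceRecurrence s α b' a' g')
    (ha : a₀ ≤ a) (ha' : a₀ ≤ a') :
    HasLaplaceRecurrence (Finset.cons i s hi) α (b + b') a₀ (convKernel b b' g g') where
  zero := by
    rw [laplace_convKernel k k' (by linarith [k.a_pos]) (by linarith [k'.a_pos]), h.zero, h'.zero,
      mul_one]
  succ := by
    intro t ht
    rw [laplace_convKernel k k' (by linarith) (by linarith),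
      laplace_convKernel k k' (by linarith) (by linarith), Finset.prod_cons, Finset.prod_cons]
    have h1 := h.succ t (by linarith)
    have h2 := h'.succ t (by linarith)
    rw [Finset.prod_singleton, Finset.prod_singleton] at h1
    calc _ = ((1 + t) * laplace b g (t + 1)) *
          ((∏ _i ∈ s, (1 + t)) * laplace b' g' (t + 1)) := by ring
      _ = _ := by rw [h1, h2]; ring

/-- One Beta kernel is convolved in at a time. Comparing the new parameter with the rate found so
far decides which convolution asymptotics apply, and the rate remains the minimum of the parameters.
-/
theorem exists_kernel {ι : Type*} {s : Finset ι} (hs : s.Nonempty) {α : ι → ℝ}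
    (hα : ∀ i ∈ s, 0 < α i ∧ α i < 1) :
    ∃ a e g, IsKernel (∑ i ∈ s, (1 - α i)) a e g ∧ (∀ i ∈ s, a ≤ α i) ∧ (∃ i ∈ s, a = α i) ∧
      HasLaplaceRecurrence s α (∑ i ∈ s, (1 - α i)) a g := by
  have base : ∀ i, 0 < α i → α i < 1 → ∃ κ : ℝ,
      IsKernel (1 - α i) (α i) (α i) (betaKernel κ (α i)) ∧
      HasLaplaceRecurrence {i} α (1 - α i) (α i) (betaKernel κ (α i)) := by
    intro i h0 h1
    obtain ⟨κ, hκ, hz⟩ := exists_betaKernel h0 h1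
    refine ⟨κ, isKernel_betaKernel hκ h0 h1, hz, fun t ht => ?_⟩
    rw [Finset.prod_singleton, Finset.prod_singleton]
    exact laplace_betaKernel_succ hκ h0 h1 ht
  induction hs using Finset.Nonempty.cons_induction with
  | singleton i =>
    obtain ⟨h0, h1⟩ := hα i (Finset.mem_singleton_self i)
    obtain ⟨κ, k, r⟩ := base i h0 h1
    refine ⟨α i, α i, betaKernel κ (α i), ?_, by simp, by simp, ?_⟩ <;>
      rw [Finset.sum_singleton] <;> assumption
  | cons i s hi hs ih =>
    obtain ⟨a', e', g', k', hle, ⟨i', hi', hmin⟩, r'⟩ :=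
      ih fun j hj => hα j (Finset.mem_cons_of_mem hj)
    obtain ⟨h0, h1⟩ := hα i (Finset.mem_cons_self i s)
    obtain ⟨κ, k, r⟩ := base i h0 h1
    rw [Finset.sum_cons]
    rcases lt_trichotomy (α i) a' with hlt | heq | hgt
    · refine ⟨_, _, _, isKernel_convKernel_of_lt k k' hlt, ?_, ⟨i, Finset.mem_cons_self i s, rfl⟩,
        r.conv hi k k' r' le_rfl hlt.le⟩
      intro j hj
      rcases Finset.mem_cons.1 hj with rfl | hj
      · exact le_rfl
      · exact hlt.le.trans (hle j hj)
    · rw [← heq] at k' r'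
      refine ⟨_, _, _, isKernel_convKernel_of_eq k k', ?_, ⟨i, Finset.mem_cons_self i s, rfl⟩,
        r.conv hi k k' r' le_rfl le_rfl⟩
      intro j hj
      rcases Finset.mem_cons.1 hj with rfl | hj
      · exact le_rfl
      · exact heq.le.trans (hle j hj)
    -- Now the accumulated kernel decays more slowly, so it takes the role of the dominant factor;
    -- commutativity restores the order used for the recurrence.
    · have kc := isKernel_convKernel_of_lt k' k hgt
      rw [convKernel_comm, add_comm] at kc
      refine ⟨_, _, _, kc, ?_, ⟨i', Finset.mem_cons_of_mem hi', hmin⟩,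
        r.conv hi k k' r' hgt.le le_rfl⟩
      intro j hj
      rcases Finset.mem_cons.1 hj with rfl | hj
      · exact hgt.le
      · exact hle j hj

/-! ### The logarithmic derivative of the Laplace transform and harmonic sums. -/

/-- The derivative of the Laplace transform of the density. -/
def laplaceDeriv (b : ℝ) (g : ℂ → ℂ) (s : ℝ) : ℝ :=
  ∫ x in Ioi (0 : ℝ), density b g x * (-x * Real.exp (-(s * x)))

section

variable {b a e : ℝ} {g : ℂ → ℂ}

lemma IsKernel.integrableOn_mul_exp (h : IsKernel b a e g) {s : ℝ} (hs : -a < s) :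
    IntegrableOn (fun x => density b g x * (-x * Real.exp (-(s * x)))) (Ioi 0) := by
  refine h.integrableOn_mul (φ := fun x => -x * Real.exp (-(s * x))) (q := 1) (K := 1)
    (by fun_prop) hs fun x hx => ?_
  rw [norm_mul, norm_neg, Real.norm_of_nonneg hx.le, Real.norm_of_nonneg (Real.exp_pos _).le,
    Real.rpow_one, one_mul]
  gcongr
  linarith

lemma IsKernel.hasDerivAt_laplace (h : IsKernel b a e g) {s : ℝ} (hs : -a < s) :
    HasDerivAt (laplace b g) (laplaceDeriv b g s) s := by
  -- The midpoint of `-a` and `s`: the integrand at `r` dominates all those at parameters beyond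
  -- `r`.
  set r := (s - a) / 2
  have hr : -a < r := by simp only [r]; linarith
  have hrs : r < s := by simp only [r]; linarith
  refine (hasDerivAt_integral_of_dominated_loc_of_deriv_le (μ := volume.restrict (Ioi 0))
    (F := fun s x => density b g x * Real.exp (-(s * x)))
    (F' := fun s x => density b g x * (-x * Real.exp (-(s * x)))) (x₀ := s)
    (bound := fun x => ‖density b g x * (-x * Real.exp (-(r * x)))‖) (s := Ioi r)
    (Ioi_mem_nhds hrs) ?_ (h.integrableOn_exp hs) (h.integrableOn_mul_exp hs).1 ?_
    (h.integrableOn_mul_exp hr).norm ?_).2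
  · filter_upwards [Ioi_mem_nhds hs] with t ht
    exact (h.integrableOn_exp ht).1
  · refine (ae_restrict_iff' measurableSet_Ioi).2 (Eventually.of_forall fun x hx t ht => ?_)
    have hx : 0 < x := hx
    have ht : r < t := ht
    rw [norm_mul, norm_mul, norm_mul, norm_mul]
    gcongr
    rw [Real.norm_of_nonneg (Real.exp_pos _).le, Real.norm_of_nonneg (Real.exp_pos _).le,
      Real.exp_le_exp]
    nlinarith
  · refine Eventually.of_forall fun x t _ => ?_
    have := (((hasDerivAt_id t).mul_const x).neg.exp).const_mul (density b g x)
    convert! this using 1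
    simp only [Pi.neg_apply, id, one_mul]
    ring

lemma IsKernel.laplaceDeriv_nonpos (h : IsKernel b a e g) (s : ℝ) : laplaceDeriv b g s ≤ 0 := by
  refine setIntegral_nonpos measurableSet_Ioi fun x hx => ?_
  have hx : 0 < x := hx
  have h1 := mul_pos (h.density_pos hx) (mul_pos hx (Real.exp_pos (-(s * x))))
  linarith

/-- Pointwise this is `x ≤ e^x - 1`. It bounds the derivative by a difference of two values, which
the recurrence controls. -/
lemma IsKernel.neg_laplaceDeriv_le (h : IsKernel b a e g) {s : ℝ} (hs : -a < s) :
    -laplaceDeriv b g (s + 1) ≤ laplace b g s - laplace b g (s + 1) := by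
  have i0 := h.integrableOn_exp hs
  have i1 := h.integrableOn_exp (s := s + 1) (by linarith)
  have i2 := h.integrableOn_mul_exp (s := s + 1) (by linarith)
  unfold laplaceDeriv laplace
  rw [← integral_neg, ← integral_sub i0 i1]
  refine setIntegral_mono_on i2.neg (i0.sub i1) measurableSet_Ioi fun x hx => ?_
  have hx : 0 < x := hx
  have e1 : Real.exp (-(s * x)) = Real.exp (-((s + 1) * x)) * Real.exp x := by
    rw [← Real.exp_add]; congr 1; ring
  rw [e1]
  have h1 : 0 ≤ density b g x * Real.exp (-((s + 1) * x)) *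
      (Real.exp x - (x + 1)) :=
    mul_nonneg (mul_pos (h.density_pos hx) (Real.exp_pos _)).le (by
      linarith [Real.add_one_le_exp x])
  linarith

variable {ι : Type*} {s : Finset ι} {α : ι → ℝ}

/-- Logarithmic differentiation of the recurrence in the real variable `t`. -/
lemma laplaceDeriv_div_succ (h : IsKernel b a e g)
    (hr : HasLaplaceRecurrence s α b a g) (ha : ∀ i ∈ s, a ≤ α i) {t : ℝ} (ht : 0 ≤ t) :
    laplaceDeriv b g (t + 1) / laplace b g (t + 1) =
      laplaceDeriv b g t / laplace b g t + ∑ i ∈ s, (1 / (α i + t) - 1 / (1 + t)) := by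
  have hat : -a < t := by linarith [h.a_pos]
  have hpos : ∀ i ∈ s, 0 < α i + t := fun i hi => by linarith [ha i hi, h.a_pos]
  have hd0 := (h.hasDerivAt_laplace hat).log (h.laplace_pos hat).ne'
  have hd1 : HasDerivAt (fun u => Real.log (laplace b g (u + 1)))
      (laplaceDeriv b g (t + 1) / laplace b g (t + 1)) t := by
    have hp := h.laplace_pos (s := t + 1) (by linarith)
    have := ((h.hasDerivAt_laplace (s := t + 1) (by linarith)).comp_add_const t 1).log hp.ne'
    exact this
  have hd2 : HasDerivAt (fun u => ∑ i ∈ s, (Real.log (α i + u) - Real.log (1 + u)))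
      (∑ i ∈ s, (1 / (α i + t) - 1 / (1 + t))) t := by
    refine HasDerivAt.fun_sum fun i hi => ?_
    have d1 := ((hasDerivAt_id t).const_add (α i)).log (hpos i hi).ne'
    have d2 := ((hasDerivAt_id t).const_add 1).log (by simp only [id]; linarith)
    exact d1.sub d2
  refine hd1.unique ((hd0.add hd2).congr_of_eventuallyEq ?_)
  filter_upwards [Ioi_mem_nhds (show max (-a) (-1) < t from max_lt hat (by linarith))] with u hu
  have hu1 : -a < u := (le_max_left _ _).trans_lt hu
  have hu2 : -1 < u := (le_max_right _ _).trans_lt hu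
  have hp0 := h.laplace_pos hu1
  have hp1 := h.laplace_pos (s := u + 1) (by linarith)
  have hq : ∀ i ∈ s, α i + u ≠ 0 := fun i hi => by linarith [ha i hi]
  have hq1 : ∀ i ∈ s, (1 : ℝ) + u ≠ 0 := fun i hi => by linarith
  have key := congrArg Real.log (hr.succ u hu1)
  rw [Real.log_mul (Finset.prod_ne_zero_iff.2 hq1) hp1.ne',
    Real.log_mul (Finset.prod_ne_zero_iff.2 hq) hp0.ne', Real.log_prod hq1,
    Real.log_prod hq] at key
  simp only [Pi.add_apply]
  rw [Finset.sum_sub_distrib]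
  linarith

/-- The sum `∑ i, (H (α i, m) - H (1, m))`. -/
def harmonicDiff (s : Finset ι) (α : ι → ℝ) (m : ℕ) : ℝ :=
  ∑ n ∈ Finset.range m, ∑ i ∈ s, (1 / (α i + n) - 1 / (1 + n))

lemma laplaceDeriv_natCast (h : IsKernel b a e g)
    (hr : HasLaplaceRecurrence s α b a g) (ha : ∀ i ∈ s, a ≤ α i) (m : ℕ) :
    laplaceDeriv b g m / laplace b g m = laplaceDeriv b g 0 + harmonicDiff s α m := by
  induction m with
  | zero => simp [harmonicDiff, hr.zero]
  | succ m ih =>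
    have := laplaceDeriv_div_succ h hr ha (t := m) (by positivity)
    push_cast
    rw [this, ih, harmonicDiff, harmonicDiff, Finset.sum_range_succ]
    ring

/-- The logarithmic derivative at `m + 1` is nonpositive and at least `1 - ∏ (1 + m) / (α_i + m)`,
so it tends to `0`; in the telescoped formula this forces the harmonic sums to converge to `-ℒ'(0)`.
-/
lemma tendsto_harmonicDiff (h : IsKernel b a e g)
    (hr : HasLaplaceRecurrence s α b a g) (ha : ∀ i ∈ s, a ≤ α i) :
    Tendsto (harmonicDiff s α) atTop (𝓝 (-laplaceDeriv b g 0)) := by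
  have hlim : Tendsto (fun m : ℕ => laplaceDeriv b g (m + 1 : ℝ) / laplace b g (m + 1 : ℝ))
      atTop (𝓝 0) := by
    have hprod : Tendsto (fun m : ℕ => 1 - ∏ i ∈ s, ((1 + (m : ℝ)) / (α i + m))) atTop (𝓝 0) := by
      have : Tendsto (fun m : ℕ => ∏ i ∈ s, ((1 + (m : ℝ)) / (α i + m))) atTop
          (𝓝 (∏ _i ∈ s, (1 : ℝ))) := by
        refine tendsto_finsetProd s fun i hi => ?_
        have hα : 0 < α i := h.a_pos.trans_le (ha i hi)
        have t : Tendsto (fun m : ℕ => 1 + (1 - α i) / (α i + (m : ℝ))) atTop (𝓝 (1 + 0)) :=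
          tendsto_const_nhds.add (tendsto_const_nhds.div_atTop
            (tendsto_atTop_add_const_left _ _ tendsto_natCast_atTop_atTop))
        rw [add_zero] at t
        refine t.congr fun m => ?_
        have : α i + (m : ℝ) ≠ 0 := by positivity
        field_simp
        ring
      simpa using tendsto_const_nhds (x := (1 : ℝ)).sub this
    refine tendsto_of_tendsto_of_tendsto_of_le_of_le hprod tendsto_const_nhds ?_ ?_
    · intro m
      have hm : (0 : ℝ) ≤ m := by positivity
      have hp := h.laplace_pos (s := (m : ℝ) + 1) (by linarith [h.a_pos])
      have h1 := h.neg_laplaceDeriv_le (s := m) (by linarith [h.a_pos])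
      have h2 := hr.succ m (by linarith [h.a_pos])
      have h3 : ∏ i ∈ s, (α i + (m : ℝ)) ≠ 0 :=
        Finset.prod_ne_zero_iff.2 fun i hi => by linarith [ha i hi, h.a_pos]
      have h4 : laplace b g m = (∏ i ∈ s, ((1 + (m : ℝ)) / (α i + m))) * laplace b g (m + 1) := by
        rw [Finset.prod_div_distrib]
        field_simp
        linarith
      simp only []
      rw [le_div_iff₀ hp]
      rw [h4] at h1
      linarith
    · intro m
      exact div_nonpos_of_nonpos_of_nonneg (h.laplaceDeriv_nonpos _)
        (h.laplace_pos (by have : (0 : ℝ) ≤ m := by positivity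
                           linarith [h.a_pos])).le
  rw [← tendsto_add_atTop_iff_nat 1]
  have t := hlim.sub_const (laplaceDeriv b g 0)
  rw [zero_sub] at t
  refine t.congr fun m => ?_
  have := laplaceDeriv_natCast h hr ha (m + 1)
  push_cast at this
  rw [this]; ring

lemma laplace_natCast (h : IsKernel b a e g) (hr : HasLaplaceRecurrence s α b a g) (m : ℕ) :
    laplace b g m = ∏ i ∈ s, ((ascPochhammer ℝ m).eval (α i) / m.factorial) := by
  induction m with
  | zero => simp [hr.zero]
  | succ m ih =>
    have hm : (0 : ℝ) ≤ m := by positivity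
    have h2 := hr.succ m (by linarith [h.a_pos])
    have h3 : ∏ _i ∈ s, (1 + (m : ℝ)) ≠ 0 :=
      Finset.prod_ne_zero_iff.2 fun i hi => by linarith
    push_cast
    have h4 : laplace b g (m + 1) =
        (∏ i ∈ s, (α i + m)) * laplace b g m / ∏ _i ∈ s, (1 + (m : ℝ)) := by
      field_simp
      linarith
    rw [h4, ih, ← Finset.prod_mul_distrib, ← Finset.prod_div_distrib]
    refine Finset.prod_congr rfl fun i _ => ?_
    rw [ascPochhammer_succ_eval, Nat.factorial_succ]
    push_cast
    have : (m.factorial : ℝ) ≠ 0 := by positivity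
    have : (1 : ℝ) + m ≠ 0 := by positivity
    have : (m : ℝ) + 1 ≠ 0 := by positivity
    field_simp
    ring

end

/-! ### Stieltjes transforms on the slit plane. -/

/-- The Stieltjes type transform `∫ ρ x / (1 - w * exp (-x))` of a density on `(0, ∞)`. -/
def stieltjes (ρ : ℝ → ℝ) (w : ℂ) : ℂ :=
  ∫ x in Ioi (0 : ℝ), (ρ x : ℂ) / (1 - w * Real.exp (-x))

/-- The complement of `[1, ∞)`. -/
def unitSlit : Set ℂ := {w | 1 - w ∈ Complex.slitPlane}

lemma isOpen_unitSlit : IsOpen unitSlit :=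
  Complex.isOpen_slitPlane.preimage (by fun_prop : Continuous fun w : ℂ => 1 - w)

lemma one_sub_mul_mem_slitPlane {w : ℂ} (hw : w ∈ unitSlit) {t : ℝ} (h0 : 0 ≤ t) (h1 : t ≤ 1) :
    1 - w * t ∈ Complex.slitPlane := by
  have := Complex.starConvex_one_slitPlane hw (a := 1 - t) (b := t) (by linarith) h0 (by ring)
  convert this using 1
  simp only [Complex.real_smul]
  push_cast
  ring

lemma one_sub_mul_exp_ne_zero {w : ℂ} (hw : w ∈ unitSlit) {x : ℝ} (hx : 0 ≤ x) :
    1 - w * Real.exp (-x) ≠ 0 :=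
  Complex.slitPlane_ne_zero (one_sub_mul_mem_slitPlane hw (Real.exp_pos _).le
    (Real.exp_le_one_iff.2 (by linarith)))

lemma exists_lower_bound {w₀ : ℂ} (hw₀ : w₀ ∈ unitSlit) :
    ∃ ε > 0, ∃ K : ℝ, 0 ≤ K ∧ ∀ w ∈ Metric.ball w₀ ε, ∀ x : ℝ, 0 ≤ x →
      ‖(1 - w * Real.exp (-x))⁻¹‖ ≤ K := by
  obtain ⟨ε, hε, hsub⟩ := Metric.nhds_basis_closedBall.mem_iff.1 (isOpen_unitSlit.mem_nhds hw₀)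
  obtain ⟨K, hK⟩ := ((isCompact_closedBall w₀ ε).prod
    (isCompact_Icc (a := (0 : ℝ)) (b := 1))).exists_bound_of_continuousOn
    (f := fun p : ℂ × ℝ => (1 - p.1 * (p.2 : ℂ))⁻¹) (by
      refine ContinuousOn.inv₀ (by fun_prop) ?_
      rintro ⟨w, t⟩ ⟨hw, ht⟩
      exact Complex.slitPlane_ne_zero (one_sub_mul_mem_slitPlane (hsub hw) ht.1 ht.2))
  refine ⟨ε, hε, max K 0, le_max_right _ _, fun w hw x hx => ?_⟩
  exact (hK (w, Real.exp (-x)) ⟨Metric.ball_subset_closedBall hw, (Real.exp_pos _).le,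
    Real.exp_le_one_iff.2 (by linarith)⟩).trans (le_max_left _ _)

section

variable {ρ : ℝ → ℝ}

lemma aestronglyMeasurable_stieltjes (hi : IntegrableOn ρ (Ioi 0)) (w : ℂ) :
    AEStronglyMeasurable (fun x : ℝ => (ρ x : ℂ) / (1 - w * Real.exp (-x)))
      (volume.restrict (Ioi 0)) := by
  refine (hi.ofReal (𝕜 := ℂ)).1.mul (Measurable.aestronglyMeasurable ?_)
  fun_prop

lemma integrableOn_stieltjes (hi : IntegrableOn ρ (Ioi 0)) {w : ℂ} (hw : w ∈ unitSlit) :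
    IntegrableOn (fun x : ℝ => (ρ x : ℂ) / (1 - w * Real.exp (-x))) (Ioi 0) := by
  obtain ⟨ε, hε, K, hK0, hK⟩ := exists_lower_bound hw
  refine Integrable.mono' (hi.norm.mul_const K) (aestronglyMeasurable_stieltjes hi w) ?_
  refine (ae_restrict_iff' measurableSet_Ioi).2 (Eventually.of_forall fun x hx => ?_)
  rw [div_eq_mul_inv, norm_mul, Complex.norm_real]
  gcongr
  exact hK w (Metric.mem_ball_self hε) x (le_of_lt hx)

lemma differentiableOn_stieltjes (hi : IntegrableOn ρ (Ioi 0)) :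
    DifferentiableOn ℂ (stieltjes ρ) unitSlit := by
  refine differentiableOn_integral_of_locally_dominated isOpen_unitSlit ?_ ?_ ?_
  · exact fun w _ => aestronglyMeasurable_stieltjes hi w
  · refine (ae_restrict_iff' measurableSet_Ioi).2 (Eventually.of_forall fun x hx => ?_)
    refine DifferentiableOn.div (by fun_prop) (by fun_prop) fun w hw => ?_
    exact one_sub_mul_exp_ne_zero hw (le_of_lt hx)
  · intro w₀ hw₀
    obtain ⟨ε, hε, K, hK0, hK⟩ := exists_lower_bound hw₀
    refine ⟨ε, hε, fun x => ‖ρ x‖ * K, hi.norm.mul_const K, ?_⟩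
    refine (ae_restrict_iff' measurableSet_Ioi).2 (Eventually.of_forall fun x hx w hw _ => ?_)
    rw [div_eq_mul_inv, norm_mul, Complex.norm_real]
    exact mul_le_mul_of_nonneg_left (hK w hw x (le_of_lt hx)) (norm_nonneg _)

lemma stieltjes_ofReal (ρ : ℝ → ℝ) (r : ℝ) :
    stieltjes ρ r = ((∫ x in Ioi (0 : ℝ), ρ x / (1 - r * Real.exp (-x)) : ℝ) : ℂ) := by
  rw [stieltjes, ← integral_complex_ofReal]
  congr 1
  ext x
  push_cast
  rfl

lemma ofReal_mem_unitSlit {r : ℝ} (hr : r < 1) : (r : ℂ) ∈ unitSlit := by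
  left; simpa using hr

lemma integrableOn_stieltjes_ofReal (hi : IntegrableOn ρ (Ioi 0)) {r : ℝ} (hr : r < 1) :
    IntegrableOn (fun x => ρ x / (1 - r * Real.exp (-x))) (Ioi 0) := by
  have : IntegrableOn _ (Ioi (0 : ℝ)) := (integrableOn_stieltjes hi (ofReal_mem_unitSlit hr)).re
  refine this.congr_fun (fun x _ => ?_) measurableSet_Ioi
  have : (ρ x : ℂ) / (1 - r * Real.exp (-x)) = ((ρ x / (1 - r * Real.exp (-x)) : ℝ) : ℂ) := by
    push_cast; rfl
  simp only [this]
  exact Complex.ofReal_re _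

lemma one_sub_mul_exp_pos {r x : ℝ} (hr : r < 1) (hx : 0 ≤ x) : 0 < 1 - r * Real.exp (-x) := by
  have h1 := Real.exp_pos (-x)
  have h2 : Real.exp (-x) ≤ 1 := Real.exp_le_one_iff.2 (by linarith)
  nlinarith

lemma setIntegral_Ioi_pos {f : ℝ → ℝ} (hf : IntegrableOn f (Ioi 0)) (hpos : ∀ x, 0 < x → 0 < f x) :
    0 < ∫ x in Ioi (0 : ℝ), f x := by
  rw [setIntegral_pos_iff_support_of_nonneg_ae _ hf]
  · have : Function.support f ∩ Ioi 0 = Ioi 0 :=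
      inter_eq_right.2 fun x hx => Function.mem_support.2 (hpos x hx).ne'
    rw [this]
    simp
  · exact (ae_restrict_iff' measurableSet_Ioi).2 (Eventually.of_forall fun x hx => (hpos x hx).le)

/-- For real `w < 1` the integrand is positive. Otherwise the imaginary part of the integrand has
the sign of `Im w`; dividing by `Im w` makes it positive in both half planes. -/
lemma stieltjes_ne_zero (hi : IntegrableOn ρ (Ioi 0)) (hpos : ∀ x, 0 < x → 0 < ρ x) {w : ℂ}
    (hw : w ∈ unitSlit) : stieltjes ρ w ≠ 0 := by
  have hint := integrableOn_stieltjes hi hw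
  by_cases him : w.im = 0
  · have hwr : w = (w.re : ℂ) := Complex.ext (by simp) (by simp [him])
    have hr : w.re < 1 := by
      rcases hw with h | h
      · simpa using h
      · simp [him] at h
    rw [hwr, stieltjes_ofReal]
    have := setIntegral_Ioi_pos (integrableOn_stieltjes_ofReal hi hr) fun x hx =>
      div_pos (hpos x hx) (one_sub_mul_exp_pos hr hx.le)
    exact_mod_cast this.ne'
  · intro h0
    have h1 : ∫ x in Ioi (0 : ℝ), (((ρ x : ℂ) / (1 - w * Real.exp (-x))) / (w.im : ℂ)).im = 0 := by
      have := Complex.imCLM.integral_comp_comm (hint.div_const (w.im : ℂ))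
      simp only [Complex.imCLM_apply] at this
      rw [this, integral_div]
      rw [stieltjes] at h0
      rw [h0]
      simp
    refine (setIntegral_Ioi_pos ?_ ?_).ne' h1
    · have : IntegrableOn _ (Ioi (0 : ℝ)) := (hint.div_const (w.im : ℂ)).im
      exact this
    · intro x hx
      have hne := one_sub_mul_exp_ne_zero hw hx.le
      have hE := Real.exp_pos (-x)
      have hn : 0 < Complex.normSq (1 - w * Real.exp (-x)) := Complex.normSq_pos.2 hne
      rw [Complex.div_ofReal_im, Complex.div_im]
      simp only [Complex.ofReal_im, Complex.ofReal_re, zero_mul, zero_div, zero_sub]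
      have : (1 - w * (Real.exp (-x) : ℂ)).im = -(w.im * Real.exp (-x)) := by
        rw [Complex.sub_im, Complex.im_mul_ofReal]
        simp
      rw [this]
      have : -(ρ x * -(w.im * Real.exp (-x)) / Complex.normSq (1 - w * Real.exp (-x))) / w.im =
          ρ x * Real.exp (-x) / Complex.normSq (1 - w * Real.exp (-x)) := by
        field_simp
      rw [this]
      have := hpos x hx
      positivity

/-- Geometric expansion of `1 / (1 - w e^{-x})`: the Taylor coefficients are the values of the
Laplace transform at the natural numbers. -/
lemma hasSum_stieltjes (hi : IntegrableOn ρ (Ioi 0)) {w : ℂ} (hw : ‖w‖ < 1) :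
    HasSum (fun m : ℕ => ((∫ x in Ioi (0 : ℝ), ρ x * Real.exp (-(m * x)) : ℝ) : ℂ) * w ^ m)
      (stieltjes ρ w) := by
  have hexp : ∀ (m : ℕ) (x : ℝ), Real.exp (-(m * x)) = Real.exp (-x) ^ m := by
    intro m x
    rw [← Real.exp_nat_mul]; congr 1; ring
  have hmeas : ∀ m : ℕ, IntegrableOn (fun x : ℝ => (ρ x : ℂ) * (w * Real.exp (-x)) ^ m)
      (Ioi 0) := by
    intro m
    refine Integrable.mono' (hi.norm.mul_const (‖w‖ ^ m))
      ((hi.ofReal (𝕜 := ℂ)).1.mul (Continuous.aestronglyMeasurable (by fun_prop))) ?_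
    refine (ae_restrict_iff' measurableSet_Ioi).2 (Eventually.of_forall fun x hx => ?_)
    have hx : (0 : ℝ) < x := hx
    rw [norm_mul, Complex.norm_real, norm_pow, norm_mul, Complex.norm_real,
      Real.norm_of_nonneg (Real.exp_pos _).le]
    have : Real.exp (-x) ≤ 1 := Real.exp_le_one_iff.2 (by linarith)
    gcongr
    exact mul_le_of_le_one_right (norm_nonneg _) this
  have key := hasSum_integral_of_summable_integral_norm (μ := volume.restrict (Ioi 0)) hmeas ?_
  · convert! key using 1
    · ext m
      rw [← integral_complex_ofReal, ← integral_mul_const]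
      congr 1
      ext x
      rw [hexp]
      push_cast
      ring
    · rw [stieltjes]
      refine setIntegral_congr_fun measurableSet_Ioi fun x hx => ?_
      have hx : (0 : ℝ) < x := hx
      have hlt : ‖w * (Real.exp (-x) : ℂ)‖ < 1 := by
        rw [norm_mul, Complex.norm_real, Real.norm_of_nonneg (Real.exp_pos _).le]
        have : Real.exp (-x) ≤ 1 := Real.exp_le_one_iff.2 (by linarith)
        exact (mul_le_of_le_one_right (norm_nonneg _) this).trans_lt hw
      have := ((hasSum_geometric_of_norm_lt_one hlt).mul_left (ρ x : ℂ)).tsum_eq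
      rw [this, div_eq_mul_inv]
  · refine Summable.of_nonneg_of_le (fun m => integral_nonneg fun x => norm_nonneg _) (fun m => ?_)
      ((summable_geometric_of_lt_one (norm_nonneg w) hw).mul_left (∫ x in Ioi (0 : ℝ), ‖ρ x‖))
    rw [← integral_mul_const]
    refine setIntegral_mono_on (hmeas m).norm (hi.norm.mul_const _) measurableSet_Ioi
      fun x hx => ?_
    have hx : (0 : ℝ) < x := hx
    rw [norm_mul, Complex.norm_real, norm_pow, norm_mul, Complex.norm_real,
      Real.norm_of_nonneg (Real.exp_pos _).le]
    have : Real.exp (-x) ≤ 1 := Real.exp_le_one_iff.2 (by linarith)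
    gcongr
    exact mul_le_of_le_one_right (norm_nonneg _) this

end

section

variable {b a e : ℝ} {g : ℂ → ℂ}

/-- The density weighted by the logarithm of `exp (-x)`. -/
def logDensity (b : ℝ) (g : ℂ → ℂ) (x : ℝ) : ℝ := -x * density b g x

lemma IsKernel.integrableOn_density (h : IsKernel b a e g) :
    IntegrableOn (density b g) (Ioi 0) := by
  simpa using h.integrableOn_exp (s := 0) (by linarith [h.a_pos])

lemma IsKernel.integrableOn_logDensity (h : IsKernel b a e g) :
    IntegrableOn (logDensity b g) (Ioi 0) := by
  refine (h.integrableOn_mul_exp (s := 0) (by linarith [h.a_pos])).congr_fun (fun x _ => ?_)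
    measurableSet_Ioi
  simp [logDensity, mul_comm]

lemma integral_logDensity_mul_exp (b : ℝ) (g : ℂ → ℂ) (s : ℝ) :
    ∫ x in Ioi (0 : ℝ), logDensity b g x * Real.exp (-(s * x)) = laplaceDeriv b g s := by
  rw [laplaceDeriv]
  congr 1
  ext x
  rw [logDensity]; ring

/-- On `[0, 1)` the factor `1 / (1 - r e^{-x})` is at least `1`. This lower bound is uniform up to
the singularity, where it excludes zeros of the denominator. -/
lemma IsKernel.one_le_stieltjes_density (h : IsKernel b a e g) (h1 : laplace b g 0 = 1) {r : ℝ}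
    (h0 : 0 ≤ r) (hr : r < 1) :
    1 ≤ ∫ x in Ioi (0 : ℝ), density b g x / (1 - r * Real.exp (-x)) := by
  have : laplace b g 0 = ∫ x in Ioi (0 : ℝ), density b g x := by simp [laplace]
  refine (h1.symm.trans this).le.trans ?_
  refine setIntegral_mono_on h.integrableOn_density
    (integrableOn_stieltjes_ofReal h.integrableOn_density hr) measurableSet_Ioi fun x hx => ?_
  have hx : (0 : ℝ) < x := hx
  rw [le_div_iff₀ (one_sub_mul_exp_pos hr hx.le)]
  have := h.density_pos hx
  have : 0 ≤ r * Real.exp (-x) := by positivity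
  nlinarith

lemma IsKernel.stieltjes_logDensity_nonpos (h : IsKernel b a e g) {r : ℝ} (hr : r < 1) :
    ∫ x in Ioi (0 : ℝ), logDensity b g x / (1 - r * Real.exp (-x)) ≤ 0 := by
  refine setIntegral_nonpos measurableSet_Ioi fun x hx => ?_
  have hx : (0 : ℝ) < x := hx
  have := h.density_pos hx
  refine div_nonpos_of_nonpos_of_nonneg ?_ (one_sub_mul_exp_pos hr hx.le).le
  rw [logDensity]
  nlinarith

end

/-! ### The integrals producing the cotangent. -/

lemma integral_Ioo_beta_reflection {a : ℝ} (h0 : 0 < a) (h1 : a < 1) :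
    ∫ t in Ioo (0 : ℝ) 1, t ^ (a - 1) * (1 - t) ^ (-a) = Real.pi / Real.sin (Real.pi * a) := by
  have key : ((∫ t in Ioo (0 : ℝ) 1, t ^ (a - 1) * (1 - t) ^ (-a) : ℝ) : ℂ) =
      Complex.betaIntegral a ((1 - a : ℝ) : ℂ) := by
    rw [Complex.betaIntegral, intervalIntegral.integral_of_le zero_le_one,
      integral_Ioc_eq_integral_Ioo, ← integral_complex_ofReal]
    refine setIntegral_congr_fun measurableSet_Ioo fun t ht => ?_
    have ht1 : (0 : ℝ) ≤ 1 - t := by linarith [ht.2]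
    have e1 : (1 - (t : ℂ)) = ((1 - t : ℝ) : ℂ) := by push_cast; rfl
    have e2 : (a : ℂ) - 1 = ((a - 1 : ℝ) : ℂ) := by push_cast; rfl
    have e3 : ((1 - a : ℝ) : ℂ) - 1 = ((-a : ℝ) : ℂ) := by push_cast; ring
    rw [e1, e2, e3, ← Complex.ofReal_cpow ht.1.le, ← Complex.ofReal_cpow ht1]
    push_cast
    rfl
  have h2 := Complex.Gamma_mul_Gamma_eq_betaIntegral (s := (a : ℂ)) (t := ((1 - a : ℝ) : ℂ))
    (by simpa using h0) (by simpa using h1)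
  have h3 : (a : ℂ) + ((1 - a : ℝ) : ℂ) = 1 := by push_cast; ring
  rw [h3, Complex.Gamma_one, one_mul, ← key, Complex.Gamma_ofReal, Complex.Gamma_ofReal,
    ← Complex.ofReal_mul, Real.Gamma_mul_Gamma_one_sub] at h2
  exact_mod_cast h2.symm

/-- The function `exp (-a ξ) / (1 + exp (-ξ))`. -/
def fermi (a ξ : ℝ) : ℝ := Real.exp (-(a * ξ)) / (1 + Real.exp (-ξ))

lemma fermi_pos (a ξ : ℝ) : 0 < fermi a ξ := by unfold fermi; positivity

lemma continuous_fermi (a : ℝ) : Continuous (fermi a) := by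
  unfold fermi
  exact Continuous.div (by fun_prop) (by fun_prop) fun ξ => by positivity

lemma fermi_le {a δ : ℝ} (h0 : δ ≤ a) (h1 : δ ≤ 1 - a) (ξ : ℝ) :
    fermi a ξ ≤ Real.exp (-(δ * |ξ|)) := by
  rw [fermi, div_le_iff₀ (by positivity)]
  rcases le_total 0 ξ with h | h
  · rw [abs_of_nonneg h]
    have h2 : Real.exp (-(a * ξ)) ≤ Real.exp (-(δ * ξ)) := Real.exp_le_exp.2 (by nlinarith)
    have := mul_pos (Real.exp_pos (-(δ * ξ))) (Real.exp_pos (-ξ))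
    nlinarith
  · rw [abs_of_nonpos h]
    have h2 : Real.exp (-(a * ξ)) ≤ Real.exp (-(δ * -ξ)) * Real.exp (-ξ) := by
      rw [← Real.exp_add, Real.exp_le_exp]; nlinarith
    have := Real.exp_pos (-(δ * -ξ))
    nlinarith

lemma integrable_one_add_abs_rpow_mul_exp (q : ℝ) {δ : ℝ} (hδ : 0 < δ) :
    Integrable (fun ξ : ℝ => (1 + |ξ|) ^ q * Real.exp (-(δ * |ξ|))) := by
  have h := integrableOn_rpow_mul_one_add_rpow_mul_exp one_pos q hδ
  have h1 : IntegrableOn (fun ξ : ℝ => (1 + |ξ|) ^ q * Real.exp (-(δ * |ξ|))) (Ioi 0) := by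
    refine h.congr_fun (fun x hx => ?_) measurableSet_Ioi
    simp [abs_of_pos (show (0 : ℝ) < x from hx)]
  have h2 : IntegrableOn (fun ξ : ℝ => (1 + |ξ|) ^ q * Real.exp (-(δ * |ξ|))) (Iic 0) := by
    rw [integrableOn_Iic_iff_integrableOn_Iio]
    have := (Measure.measurePreserving_neg (volume : Measure ℝ)).integrableOn_comp_preimage
      (MeasurableEquiv.neg ℝ).measurableEmbedding (s := Ioi (0 : ℝ))
      (f := fun ξ : ℝ => (1 + |ξ|) ^ q * Real.exp (-(δ * |ξ|)))
    rw [← this] at h1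
    simpa [Function.comp_def] using h1
  rw [← integrableOn_univ, ← Iic_union_Ioi (a := (0 : ℝ))]
  exact h2.union h1

lemma integrable_fermi_mul {a : ℝ} (h0 : 0 < a) (h1 : a < 1) (q : ℝ) :
    Integrable (fun ξ : ℝ => (1 + |ξ|) ^ q * fermi a ξ) := by
  set δ := min a (1 - a)
  have hδ : 0 < δ := lt_min h0 (by linarith)
  refine Integrable.mono' (integrable_one_add_abs_rpow_mul_exp q hδ) ?_ ?_
  · refine Continuous.aestronglyMeasurable (Continuous.mul ?_ (continuous_fermi a))
    exact Continuous.rpow_const (by fun_prop) fun ξ => Or.inl (by positivity)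
  · refine Eventually.of_forall fun ξ => ?_
    have := fermi_pos a ξ
    rw [Real.norm_of_nonneg (by positivity)]
    gcongr
    exact fermi_le (min_le_left _ _) (min_le_right _ _) ξ

lemma integrable_fermi {a : ℝ} (h0 : 0 < a) (h1 : a < 1) : Integrable (fermi a) := by
  simpa using integrable_fermi_mul h0 h1 0

/-- The substitution `t = 1 / (1 + e^ξ)` turns the integral into the Beta integral evaluated by the
reflection formula. -/
lemma integral_fermi {a : ℝ} (h0 : 0 < a) (h1 : a < 1) :
    ∫ ξ, fermi a ξ = Real.pi / Real.sin (Real.pi * a) := by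
  rw [← integral_Ioo_beta_reflection h0 h1]
  have himg : (fun ξ : ℝ => (1 + Real.exp ξ)⁻¹) '' univ = Ioo 0 1 := by
    ext t
    constructor
    · rintro ⟨ξ, -, rfl⟩
      have := Real.exp_pos ξ
      exact ⟨by positivity, inv_lt_one_of_one_lt₀ (by linarith)⟩
    · rintro ⟨ht0, ht1⟩
      refine ⟨Real.log (t⁻¹ - 1), mem_univ _, ?_⟩
      have : 0 < t⁻¹ - 1 := by linarith [(one_lt_inv₀ ht0).2 ht1]
      simp only [Real.exp_log this]
      simp
  have hinj : InjOn (fun ξ : ℝ => (1 + Real.exp ξ)⁻¹) univ := by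
    intro x _ y _ hxy
    have h2 := inv_inj.1 hxy
    exact Real.exp_injective (by linarith)
  have hder : ∀ ξ ∈ (univ : Set ℝ), HasDerivWithinAt (fun ξ : ℝ => (1 + Real.exp ξ)⁻¹)
      (-Real.exp ξ / (1 + Real.exp ξ) ^ 2) univ ξ := by
    intro ξ _
    exact (((Real.hasDerivAt_exp ξ).const_add 1).inv (by positivity)).hasDerivWithinAt
  have key := integral_image_eq_integral_abs_deriv_smul MeasurableSet.univ hder hinj
    (fun t => t ^ (a - 1) * (1 - t) ^ (-a))
  rw [himg, setIntegral_univ] at key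
  rw [key]
  congr 1
  ext ξ
  have hE := Real.exp_pos ξ
  have hp : 0 < 1 + Real.exp ξ := by positivity
  have e1 : 1 - (1 + Real.exp ξ)⁻¹ = Real.exp ξ * (1 + Real.exp ξ)⁻¹ := by field_simp; ring
  have e2 : |-Real.exp ξ / (1 + Real.exp ξ) ^ 2| = Real.exp ξ / (1 + Real.exp ξ) ^ 2 := by
    rw [neg_div, abs_neg, abs_of_pos (by positivity)]
  have e3 : ((1 + Real.exp ξ)⁻¹) ^ (a - 1) * ((1 + Real.exp ξ)⁻¹) ^ (-a) = 1 + Real.exp ξ := by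
    rw [← Real.rpow_add (by positivity), show a - 1 + -a = -1 by ring, Real.rpow_neg_one, inv_inv]
  rw [e1, e2, Real.mul_rpow hE.le (by positivity), smul_eq_mul, fermi]
  have e4 : Real.exp ξ ^ (-a) = Real.exp (-(a * ξ)) := by
    rw [← Real.exp_mul]; congr 1; ring
  have e5 : Real.exp (-ξ) = (Real.exp ξ)⁻¹ := Real.exp_neg ξ
  rw [e4, e5]
  calc _ = Real.exp ξ / (1 + Real.exp ξ) ^ 2 * Real.exp (-(a * ξ)) * (1 + Real.exp ξ) := by
        field_simp
        ring
    _ = Real.exp ξ / (1 + Real.exp ξ) ^ 2 * Real.exp (-(a * ξ)) *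
        (((1 + Real.exp ξ)⁻¹) ^ (a - 1) * ((1 + Real.exp ξ)⁻¹) ^ (-a)) := by rw [e3]
    _ = _ := by ring

lemma integrable_neg_mul_fermi {a : ℝ} (h0 : 0 < a) (h1 : a < 1) :
    Integrable (fun ξ => -ξ * fermi a ξ) := by
  refine Integrable.mono' (integrable_fermi_mul h0 h1 1) ?_ ?_
  · exact Continuous.aestronglyMeasurable (Continuous.mul (by fun_prop) (continuous_fermi a))
  · refine Eventually.of_forall fun ξ => ?_
    have := fermi_pos a ξ
    rw [norm_mul, norm_neg, Real.norm_eq_abs, Real.norm_of_nonneg this.le, Real.rpow_one]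
    gcongr
    linarith

lemma hasDerivAt_integral_fermi {a : ℝ} (h0 : 0 < a) (h1 : a < 1) :
    HasDerivAt (fun a => ∫ ξ, fermi a ξ) (∫ ξ, -ξ * fermi a ξ) a := by
  set δ := min a (1 - a) / 2 with hδ
  have hδ0 : 0 < δ := half_pos (lt_min h0 (by linarith))
  have ha1 : 2 * δ ≤ a := by rw [hδ]; linarith [min_le_left a (1 - a)]
  have ha2 : 2 * δ ≤ 1 - a := by rw [hδ]; linarith [min_le_right a (1 - a)]
  refine (hasDerivAt_integral_of_dominated_loc_of_deriv_le (μ := volume)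
    (F := fun a ξ => fermi a ξ) (F' := fun a ξ => -ξ * fermi a ξ) (x₀ := a)
    (bound := fun ξ => (1 + |ξ|) ^ (1 : ℝ) * Real.exp (-(δ * |ξ|))) (s := Ioo (a - δ) (a + δ))
    (Ioo_mem_nhds (by linarith) (by linarith)) ?_ (integrable_fermi h0 h1)
    (integrable_neg_mul_fermi h0 h1).1 ?_ (integrable_one_add_abs_rpow_mul_exp 1 hδ0) ?_).2
  · exact Eventually.of_forall fun t => (continuous_fermi t).aestronglyMeasurable
  · refine Eventually.of_forall fun ξ t ht => ?_
    rw [norm_mul, norm_neg, Real.norm_eq_abs, Real.norm_of_nonneg (fermi_pos t ξ).le,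
      Real.rpow_one]
    have := fermi_le (a := t) (δ := δ) (by linarith [ht.1]) (by linarith [ht.2]) ξ
    have h2 := (fermi_pos t ξ).le
    gcongr
    linarith
  · refine Eventually.of_forall fun ξ t _ => ?_
    have := (((hasDerivAt_id t).mul_const ξ).neg.exp).div_const (1 + Real.exp (-ξ))
    convert! this using 1
    simp only [Pi.neg_apply, id, one_mul, fermi]
    ring

/-- The left side is the derivative in `a` of `∫ fermi a = π / sin (π a)`; the factor `-π cot (π a)`
is the logarithmic derivative of the closed form. -/
lemma integral_neg_mul_fermi {a : ℝ} (h0 : 0 < a) (h1 : a < 1) :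
    ∫ ξ, -ξ * fermi a ξ = -(Real.pi * Real.cot (Real.pi * a)) * ∫ ξ, fermi a ξ := by
  have hs : 0 < Real.sin (Real.pi * a) :=
    Real.sin_pos_of_pos_of_lt_pi (by positivity) (by nlinarith [Real.pi_pos])
  have d1 : HasDerivAt (fun a => Real.pi / Real.sin (Real.pi * a))
      (-(Real.pi * (Real.cos (Real.pi * a) * Real.pi)) / Real.sin (Real.pi * a) ^ 2) a := by
    have h2 := ((hasDerivAt_id a).const_mul Real.pi).sin
    have := (hasDerivAt_const a Real.pi).div h2 hs.ne'
    convert! this using 1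
    simp
  have d2 := (hasDerivAt_integral_fermi h0 h1).congr_of_eventuallyEq
    (f₁ := fun a => Real.pi / Real.sin (Real.pi * a)) (by
      filter_upwards [Ioo_mem_nhds h0 h1] with t ht using (integral_fermi ht.1 ht.2).symm)
  rw [d2.unique d1, integral_fermi h0 h1, Real.cot_eq_cos_div_sin]
  field_simp

lemma integral_fermi_pos {a : ℝ} (h0 : 0 < a) (h1 : a < 1) : 0 < ∫ ξ, fermi a ξ := by
  rw [integral_fermi h0 h1]
  have hs : 0 < Real.sin (Real.pi * a) :=
    Real.sin_pos_of_pos_of_lt_pi (by positivity) (by nlinarith [Real.pi_pos])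
  positivity

/-! ### Contour shift and behaviour at infinity. -/

/-- The holomorphic extension `x ^ (b - 1) * g x` of the density to the right half plane. -/
def complexDensity (b : ℝ) (g : ℂ → ℂ) (x : ℂ) : ℂ := x ^ ((b - 1 : ℝ) : ℂ) * g x

lemma rpow_le_four_rpow_abs {r : ℝ} (h : 1 / 4 ≤ r) (h1 : r ≤ 4) (q : ℝ) : r ^ q ≤ 4 ^ |q| := by
  rcases le_total 0 q with hq | hq
  · rw [abs_of_nonneg hq]
    exact Real.rpow_le_rpow (by linarith) h1 hq
  · rw [abs_of_nonpos hq, Real.rpow_neg (by norm_num), ← Real.inv_rpow (by norm_num)]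
    exact Real.rpow_le_rpow_of_nonpos (by norm_num) (by linarith) hq

lemma one_add_exp_ne_zero {u : ℂ} (hu : |u.im| < Real.pi) : 1 + Complex.exp u ≠ 0 := by
  intro h
  have h1 : Complex.exp u = -1 := by linear_combination h
  have h2 := Complex.log_exp (x := u) (abs_lt.1 hu).1 (abs_lt.1 hu).2.le
  rw [h1, Complex.log_neg_one] at h2
  have h3 := congrArg Complex.im h2
  simp at h3
  rw [← h3, abs_of_pos Real.pi_pos] at hu
  exact lt_irrefl _ hu

lemma neg_exp_mem_unitSlit {Λ : ℂ} (h : |Λ.im| < Real.pi) : -Complex.exp Λ ∈ unitSlit := by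
  have h1 : Complex.exp Λ ∈ Complex.slitPlane := by
    rw [Complex.mem_slitPlane_iff_arg]
    refine ⟨?_, Complex.exp_ne_zero _⟩
    have h2 := Complex.log_exp (x := Λ) (abs_lt.1 h).1 (abs_lt.1 h).2.le
    rw [← Complex.log_im, h2]
    exact (abs_lt.1 h).2.ne
  show 1 - -Complex.exp Λ ∈ Complex.slitPlane
  rcases h1 with h1 | h1
  · left; simp only [sub_neg_eq_add, Complex.add_re, Complex.one_re]; linarith
  · right; simpa using h1

section

variable {b a e : ℝ} {g : ℂ → ℂ}

lemma IsKernel.complexDensity_ofReal (h : IsKernel b a e g) {x : ℝ} (hx : 0 < x) :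
    complexDensity b g x = (density b g x : ℂ) := by
  rw [complexDensity, h.eq_re (by linarith : -1 < x), density, ← Complex.ofReal_cpow hx.le]
  push_cast
  simp

lemma IsKernel.differentiableAt_complexDensity (h : IsKernel b a e g) {x : ℂ} (hx : 0 < x.re) :
    DifferentiableAt ℂ (complexDensity b g) x := by
  unfold complexDensity
  refine DifferentiableAt.mul ?_ (h.diff.differentiableAt
    (isOpen_kernelDomain.mem_nhds (Or.inr hx)))
  exact differentiableAt_id.cpow (differentiableAt_const _) (Or.inl hx)

lemma IsKernel.exists_complexDensity_bound (h : IsKernel b a e g) :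
    ∃ K : ℝ, 0 < K ∧ ∀ x : ℂ, 1 ≤ x.re → |x.im| ≤ Real.pi →
      ‖complexDensity b g x‖ ≤ K * (1 + x.re) ^ (e + b - 1) * Real.exp (-(a * x.re)) := by
  obtain ⟨K, hK, hb⟩ := h.exists_bound
  refine ⟨4 ^ |b - 1| * K, by positivity, fun x hx hi => ?_⟩
  have hpi := Real.pi_pos
  have h1 := hb x (by linarith) hi (by nlinarith)
  have hX : 0 < 1 + x.re := by linarith
  have hlow : x.re ≤ ‖x‖ := Complex.re_le_norm x
  have hup : ‖x‖ ≤ x.re + Real.pi := by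
    have := Complex.norm_le_abs_re_add_abs_im x
    rw [abs_of_pos (by linarith : 0 < x.re)] at this
    linarith
  have h2 : ‖x‖ ^ (b - 1) ≤ 4 ^ |b - 1| * (1 + x.re) ^ (b - 1) := by
    have h3 : ‖x‖ = ‖x‖ / (1 + x.re) * (1 + x.re) := by field_simp
    rw [h3, Real.mul_rpow (by positivity) hX.le]
    gcongr
    -- For `Re x ≥ 1` and `|Im x| ≤ π ≤ 4` the modulus of `x` lies between `(1 + Re x) / 4` and `4
    -- (1 + Re x)`.
    refine rpow_le_four_rpow_abs ?_ ?_ _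
    · rw [le_div_iff₀ hX]; linarith
    · rw [div_le_iff₀ hX]; linarith [Real.pi_le_four]
  rw [complexDensity, norm_mul, Complex.norm_cpow_real,
    show e + b - 1 = (b - 1) + e by ring, Real.rpow_add hX]
  calc _ ≤ (4 ^ |b - 1| * (1 + x.re) ^ (b - 1)) * (K * (1 + x.re) ^ e * Real.exp (-(a * x.re))) := by
        gcongr
    _ = _ := by ring

lemma tendsto_complexDensity {c : ℝ}
    (hlim : Tendsto (fun x : ℂ => g x * Complex.exp (a * x) * (((1 + x.re) ^ (-e) : ℝ) : ℂ))
      stripEnd (𝓝 c)) :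
    Tendsto (fun x : ℂ => complexDensity b g x * Complex.exp (a * x) *
      (((1 + x.re) ^ (-(e + b - 1)) : ℝ) : ℂ)) stripEnd (𝓝 c) := by
  have h1 : Tendsto (fun x : ℂ => (x / ((1 + x.re : ℝ) : ℂ)) ^ ((b - 1 : ℝ) : ℂ)) stripEnd
      (𝓝 (1 ^ ((b - 1 : ℝ) : ℂ))) :=
    tendsto_div_one_add_re_stripEnd.cpow tendsto_const_nhds Complex.one_mem_slitPlane
  rw [Complex.one_cpow] at h1
  have h2 := h1.mul hlim
  rw [one_mul] at h2
  refine h2.congr' ?_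
  rw [EventuallyEq, eventually_stripEnd]
  refine ⟨1, fun x hx _ => ?_⟩
  have hX : 0 < 1 + x.re := by linarith
  have hXc : ((1 + x.re : ℝ) : ℂ) ≠ 0 := by exact_mod_cast hX.ne'
  have hx0 : x ≠ 0 := by rintro rfl; norm_num at hx
  have e1 : x ^ ((b - 1 : ℝ) : ℂ) = (((1 + x.re) ^ (b - 1) : ℝ) : ℂ) *
      (x / ((1 + x.re : ℝ) : ℂ)) ^ ((b - 1 : ℝ) : ℂ) := by
    rw [Complex.ofReal_cpow hX.le, ← ofReal_mul_cpow hX (div_ne_zero hx0 hXc)]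
    congr 1
    field_simp
  have e2 : (1 + x.re) ^ (-e) = (1 + x.re) ^ (b - 1) * (1 + x.re) ^ (-(e + b - 1)) := by
    rw [← Real.rpow_add hX]; congr 1; ring
  rw [complexDensity, e1, e2]
  push_cast
  ring

/-- The integrand whose integral over `(0, ∞)` is a combination of the Stieltjes transforms of
the density and the logarithmic density at `-exp Λ`. -/
def shiftIntegrand (b : ℝ) (g : ℂ → ℂ) (j : ℕ) (Λ x : ℂ) : ℂ :=
  complexDensity b g x * ((Λ - x) ^ j / (1 + Complex.exp (Λ - x)))

lemma IsKernel.integrableOn_shiftIntegrand (h : IsKernel b a e g) (j : ℕ) {Λ : ℂ}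
    (hΛ : |Λ.im| < Real.pi) :
    IntegrableOn (fun x : ℝ => shiftIntegrand b g j Λ x) (Ioi 0) := by
  obtain ⟨ε, hε, K, hK0, hK⟩ := exists_lower_bound (neg_exp_mem_unitSlit hΛ)
  have hden : ∀ x : ℝ, 1 + Complex.exp (Λ - x) = 1 - -Complex.exp Λ * Real.exp (-x) := by
    intro x
    rw [sub_eq_add_neg Λ, Complex.exp_add]; push_cast; ring
  have key := h.integrableOn_mul
    (φ := fun x : ℝ => (Λ - x) ^ j / (1 + Complex.exp (Λ - x))) (q := j) (s := 0)
    (K := (1 + ‖Λ‖) ^ j * K) ?_ (by linarith [h.a_pos]) ?_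
  · refine key.congr_fun (fun x hx => ?_) measurableSet_Ioi
    simp only [Complex.real_smul, shiftIntegrand, h.complexDensity_ofReal hx]
  · refine ContinuousOn.div (by fun_prop) (by fun_prop) fun x hx => ?_
    refine one_add_exp_ne_zero ?_
    simpa using hΛ
  · intro x hx
    have h1 := hK _ (Metric.mem_ball_self hε) x hx.le
    rw [← hden, norm_inv] at h1
    have h2 : ‖Λ - x‖ ≤ (1 + ‖Λ‖) * (1 + x) := by
      refine (norm_sub_le _ _).trans ?_
      rw [Complex.norm_real, Real.norm_of_nonneg hx.le]
      nlinarith [norm_nonneg Λ]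
    rw [norm_div, norm_pow, Real.rpow_natCast, div_eq_mul_inv]
    calc ‖Λ - x‖ ^ j * ‖1 + Complex.exp (Λ - x)‖⁻¹ ≤ ((1 + ‖Λ‖) * (1 + x)) ^ j * K := by gcongr
      _ = _ := by rw [mul_pow]; simp; ring

lemma norm_one_add_exp_ofReal (r : ℝ) : ‖1 + Complex.exp (r : ℂ)‖ = 1 + Real.exp r := by
  have : 1 + Complex.exp (r : ℂ) = ((1 + Real.exp r : ℝ) : ℂ) := by push_cast; rfl
  rw [this, Complex.norm_real, Real.norm_of_nonneg (by positivity)]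

lemma shift_sub_eq (Λ : ℂ) (x : ℝ) : Λ - (x + Λ.im * Complex.I) = ((Λ.re - x : ℝ) : ℂ) := by
  apply Complex.ext <;> simp

lemma shift_re (x y : ℝ) : ((x : ℂ) + y * Complex.I).re = x := by simp

lemma shift_im (x y : ℝ) : ((x : ℂ) + y * Complex.I).im = y := by simp

lemma IsKernel.integrableOn_shiftIntegrand_shifted (h : IsKernel b a e g) (j : ℕ) {Λ : ℂ}
    (hΛ : |Λ.im| ≤ Real.pi) :
    IntegrableOn (fun x : ℝ => shiftIntegrand b g j Λ (x + Λ.im * Complex.I)) (Ioi 1) := by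
  obtain ⟨K, hK, hb⟩ := h.exists_complexDensity_bound
  have hmaj := ((integrableOn_rpow_mul_one_add_rpow_mul_exp one_pos (e + b - 1 + j)
    h.a_pos).mono_set (Ioi_subset_Ioi zero_le_one)).const_mul (K * (1 + |Λ.re|) ^ j)
  refine Integrable.mono' hmaj ?_ ?_
  · refine ContinuousOn.aestronglyMeasurable ?_ measurableSet_Ioi
    unfold shiftIntegrand
    refine ContinuousOn.mul ?_ (ContinuousOn.div (by fun_prop) (by fun_prop) ?_)
    · intro x hx
      refine ContinuousAt.continuousWithinAt ?_
      have hd := (h.differentiableAt_complexDensity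
        (x := (x : ℂ) + Λ.im * Complex.I) (by rw [shift_re]; linarith [show (1 : ℝ) < x from hx]))
      exact ContinuousAt.comp (f := fun x : ℝ => (x : ℂ) + Λ.im * Complex.I) hd.continuousAt
        (by fun_prop)
    · intro x _
      rw [shift_sub_eq]
      exact one_add_exp_ne_zero (by simpa using Real.pi_pos)
  · refine (ae_restrict_iff' measurableSet_Ioi).2 (Eventually.of_forall fun x hx => ?_)
    have hx : (1 : ℝ) < x := hx
    have h1 := hb (x + Λ.im * Complex.I) (by rw [shift_re]; exact hx.le)
      (by rw [shift_im]; exact hΛ)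
    rw [shift_re] at h1
    rw [shiftIntegrand, shift_sub_eq, norm_mul, norm_div, norm_one_add_exp_ofReal, norm_pow,
      Complex.norm_real, Real.norm_eq_abs]
    have h2 : |Λ.re - x| ≤ (1 + |Λ.re|) * (1 + x) := by
      refine (abs_sub _ _).trans ?_
      rw [abs_of_pos (by linarith : 0 < x)]
      nlinarith [abs_nonneg Λ.re]
    have h3 : |Λ.re - x| ^ j / (1 + Real.exp (Λ.re - x)) ≤ ((1 + |Λ.re|) * (1 + x)) ^ j := by
      rw [div_le_iff₀ (by positivity)]
      have h4 : |Λ.re - x| ^ j ≤ ((1 + |Λ.re|) * (1 + x)) ^ j := by gcongr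
      have h5 : 0 ≤ ((1 + |Λ.re|) * (1 + x)) ^ j := by positivity
      nlinarith [Real.exp_pos (Λ.re - x)]
    have hX : 0 < 1 + x := by linarith
    rw [Real.rpow_add hX, Real.rpow_natCast, sub_self, Real.rpow_zero, one_mul]
    calc _ ≤ (K * (1 + x) ^ (e + b - 1) * Real.exp (-(a * x))) *
          ((1 + |Λ.re|) * (1 + x)) ^ j := by gcongr
      _ = _ := by rw [mul_pow]; ring

lemma IsKernel.norm_shiftIntegrand_le_of_far (h : IsKernel b a e g) (j : ℕ) {Λ : ℂ} :
    ∃ K : ℝ, ∀ T y : ℝ, max 1 (Λ.re + 1) ≤ T → |y| ≤ Real.pi →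
      ‖shiftIntegrand b g j Λ (T + y * Complex.I)‖ ≤
        K * ((1 + T) ^ (e + b - 1 + j) * Real.exp (-(a * T))) := by
  obtain ⟨K, hK, hb⟩ := h.exists_complexDensity_bound
  refine ⟨K * (2 * (5 + ‖Λ‖) ^ j), fun T y hT hy => ?_⟩
  have hT1 : 1 ≤ T := (le_max_left _ _).trans hT
  have hT2 : Λ.re + 1 ≤ T := (le_max_right _ _).trans hT
  have h1 := hb (T + y * Complex.I) (by rw [shift_re]; exact hT1) (by rw [shift_im]; exact hy)
  rw [shift_re] at h1
  have h2 : ‖Complex.exp (Λ - (T + y * Complex.I))‖ ≤ 1 / 2 := by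
    rw [Complex.norm_exp, Complex.sub_re, shift_re]
    have h3 : Real.exp (Λ.re - T) ≤ Real.exp (-1) := Real.exp_le_exp.2 (by linarith)
    refine h3.trans ?_
    rw [Real.exp_neg, one_div]
    exact inv_anti₀ (by norm_num) (by linarith [Real.add_one_le_exp (1 : ℝ)])
  have h3 : 1 / 2 ≤ ‖1 + Complex.exp (Λ - (T + y * Complex.I))‖ := by
    have := norm_sub_le (1 + Complex.exp (Λ - (T + y * Complex.I)))
      (Complex.exp (Λ - (T + y * Complex.I)))
    rw [add_sub_cancel_right, norm_one] at this
    linarith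
  have h4 : ‖Λ - (T + y * Complex.I)‖ ≤ (5 + ‖Λ‖) * (1 + T) := by
    refine (norm_sub_le _ _).trans ?_
    have : ‖(T : ℂ) + y * Complex.I‖ ≤ T + 4 := by
      refine (norm_add_le _ _).trans ?_
      rw [norm_mul, Complex.norm_I, Complex.norm_real, Complex.norm_real, mul_one,
        Real.norm_of_nonneg (by linarith), Real.norm_eq_abs]
      linarith [Real.pi_le_four]
    nlinarith [norm_nonneg Λ]
  have hX : 0 < 1 + T := by linarith
  rw [shiftIntegrand, norm_mul, norm_div, norm_pow, Real.rpow_add hX, Real.rpow_natCast]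
  have h5 : ‖Λ - (T + y * Complex.I)‖ ^ j / ‖1 + Complex.exp (Λ - (T + y * Complex.I))‖ ≤
      2 * ((5 + ‖Λ‖) * (1 + T)) ^ j := by
    rw [div_le_iff₀ (by linarith)]
    have h6 : ‖Λ - (T + y * Complex.I)‖ ^ j ≤ ((5 + ‖Λ‖) * (1 + T)) ^ j := by gcongr
    have h7 : 0 ≤ ((5 + ‖Λ‖) * (1 + T)) ^ j := by positivity
    nlinarith
  calc _ ≤ (K * (1 + T) ^ (e + b - 1) * Real.exp (-(a * T))) *
        (2 * ((5 + ‖Λ‖) * (1 + T)) ^ j) := by gcongr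
    _ = _ := by rw [mul_pow]; ring

/-- Cauchy's theorem on the rectangle with real parts in `[1, T]` and imaginary parts between `0`
and `Im Λ`, with `T → ∞`. No pole is met since `|Im (Λ - x)| ≤ |Im Λ| < π`. Starting at `1` avoids
the branch point of `x ^ (b - 1)` at `0`. On the shifted line `Λ - x` is real. -/
lemma IsKernel.integral_shiftIntegrand_eq (h : IsKernel b a e g) (j : ℕ) {Λ : ℂ}
    (hΛ : |Λ.im| < Real.pi) :
    ∫ x in Ioi (1 : ℝ), shiftIntegrand b g j Λ x =
      (∫ x in Ioi (1 : ℝ), shiftIntegrand b g j Λ (x + Λ.im * Complex.I)) +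
        Complex.I * ∫ y in (0 : ℝ)..Λ.im, shiftIntegrand b g j Λ (1 + y * Complex.I) := by
  have hrect : ∀ T : ℝ, 1 ≤ T →
      (∫ x in (1 : ℝ)..T, shiftIntegrand b g j Λ x) -
        (∫ x in (1 : ℝ)..T, shiftIntegrand b g j Λ (x + Λ.im * Complex.I)) +
        Complex.I * (∫ y in (0 : ℝ)..Λ.im, shiftIntegrand b g j Λ (T + y * Complex.I)) -
        Complex.I * (∫ y in (0 : ℝ)..Λ.im, shiftIntegrand b g j Λ (1 + y * Complex.I)) = 0 := by
    intro T hT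
    have := Complex.integral_boundary_rect_eq_zero_of_differentiableOn
      (shiftIntegrand b g j Λ) 1 (T + Λ.im * Complex.I) (by
        intro x hx
        rw [Complex.mem_reProdIm, shift_re, shift_im, Complex.one_re, Complex.one_im,
          uIcc_of_le hT] at hx
        obtain ⟨⟨hx1, -⟩, hx2⟩ := hx
        refine DifferentiableAt.differentiableWithinAt ?_
        unfold shiftIntegrand
        refine (h.differentiableAt_complexDensity (by linarith)).mul
          (DifferentiableAt.div (by fun_prop) (by fun_prop) (one_add_exp_ne_zero ?_))
        rw [Complex.sub_im]
        refine lt_of_le_of_lt ?_ hΛ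
        have := abs_sub_right_of_mem_uIcc hx2
        simpa using this)
    simpa [smul_eq_mul] using this
  have t1 := intervalIntegral_tendsto_integral_Ioi 1
    ((h.integrableOn_shiftIntegrand j hΛ).mono_set (Ioi_subset_Ioi zero_le_one)) tendsto_id
  have t2 := intervalIntegral_tendsto_integral_Ioi 1
    (h.integrableOn_shiftIntegrand_shifted j hΛ.le) tendsto_id
  have t3 : Tendsto (fun T : ℝ => ∫ y in (0 : ℝ)..Λ.im,
      shiftIntegrand b g j Λ (T + y * Complex.I)) atTop (𝓝 0) := by
    obtain ⟨K, hK⟩ := h.norm_shiftIntegrand_le_of_far j (Λ := Λ)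
    have td : Tendsto (fun T : ℝ => K * ((1 + T) ^ (e + b - 1 + j) * Real.exp (-(a * T))) *
        |Λ.im - 0|) atTop (𝓝 0) := by
      have := (tendsto_rpow_mul_exp_neg_mul_atTop_nhds_zero (e + b - 1 + j) a h.a_pos).comp
        (tendsto_atTop_add_const_left atTop (1 : ℝ) tendsto_id)
      have := ((this.mul_const (Real.exp a)).const_mul K).mul_const |Λ.im - 0|
      rw [zero_mul, mul_zero, zero_mul] at this
      refine this.congr fun T => ?_
      simp only [Function.comp, id]
      rw [mul_assoc (_ ^ _), ← Real.exp_add]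
      congr 4
      ring
    refine squeeze_zero_norm' ?_ td
    filter_upwards [eventually_ge_atTop (max 1 (Λ.re + 1))] with T hT
    refine intervalIntegral.norm_integral_le_of_norm_le_const fun y hy => hK T y hT ?_
    have := abs_sub_left_of_mem_uIcc (uIoc_subset_uIcc hy)
    rw [sub_zero, sub_zero] at this
    exact this.trans hΛ.le
  have t4 := ((t1.sub t2).add (t3.const_mul Complex.I)).sub_const
    (Complex.I * (∫ y in (0 : ℝ)..Λ.im, shiftIntegrand b g j Λ (1 + y * Complex.I)))
  have h0 := tendsto_nhds_unique t4 (tendsto_const_nhds.congr' (by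
    filter_upwards [eventually_ge_atTop (1 : ℝ)] with T hT
    exact (hrect T hT).symm))
  linear_combination h0

end

section

variable {b a e c : ℝ} {g : ℂ → ℂ}

/-- Writing the shifted line as `Λ + ξ` with real `ξ`, the normalized density tends to `c e^{-a ξ}`
and the remaining factor is `(-ξ) ^ j / (1 + e^{-ξ})`, independent of `Λ`. -/
lemma IsKernel.tendsto_integral_shifted (h : IsKernel b a e g) (ha : a < 1)
    (hlim : Tendsto (fun x : ℂ => g x * Complex.exp (a * x) * (((1 + x.re) ^ (-e) : ℝ) : ℂ))
      stripEnd (𝓝 c)) (j : ℕ) :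
    Tendsto (fun Λ : ℂ =>
      (∫ x in Ioi (1 : ℝ), shiftIntegrand b g j Λ (x + Λ.im * Complex.I)) *
        (Complex.exp (a * Λ) * (((1 + Λ.re) ^ (-(e + b - 1)) : ℝ) : ℂ))) stripEnd
      (𝓝 ((c * ∫ ξ, (-ξ) ^ j * fermi a ξ : ℝ) : ℂ)) := by
  obtain ⟨K, hK, hb⟩ := h.exists_complexDensity_bound
  -- This is the use of the kernel condition `1 ≤ e + b`: with a nonnegative exponent, `((1 + Re Λ +
  -- ξ) / (1 + Re Λ)) ^ κ` is at most `(1 + |ξ|) ^ κ`.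
  have hκ : 0 ≤ e + b - 1 := by linarith [h.one_le]
  set κ := e + b - 1 with hκd
  have hlim' := tendsto_complexDensity (b := b) hlim
  rw [← hκd] at hlim'
  set Φ : ℂ → ℝ → ℂ := fun Λ ξ => (Ioi (1 - Λ.re)).indicator (fun ξ : ℝ =>
    (complexDensity b g (Λ + ξ) * Complex.exp (a * (Λ + ξ)) * (((1 + Λ.re) ^ (-κ) : ℝ) : ℂ)) *
      (((-ξ) ^ j * fermi a ξ : ℝ) : ℂ)) ξ with hΦ
  have hrepr : ∀ Λ : ℂ, ∫ ξ, Φ Λ ξ =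
      (∫ x in Ioi (1 : ℝ), shiftIntegrand b g j Λ (x + Λ.im * Complex.I)) *
        (Complex.exp (a * Λ) * (((1 + Λ.re) ^ (-κ) : ℝ) : ℂ)) := by
    intro Λ
    symm
    rw [← integral_mul_const, ← integral_indicator measurableSet_Ioi,
      ← integral_add_right_eq_self _ Λ.re]
    congr 1
    ext ξ
    simp only [hΦ, indicator, mem_Ioi]
    by_cases hξ : 1 - Λ.re < ξ
    · rw [if_pos hξ, if_pos (by linarith : 1 < ξ + Λ.re), shiftIntegrand, shift_sub_eq]
      have e1 : ((ξ + Λ.re : ℝ) : ℂ) + Λ.im * Complex.I = Λ + ξ := by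
        apply Complex.ext <;> simp [add_comm]
      have e2 : (((Λ.re - (ξ + Λ.re) : ℝ)) : ℂ) = ((-ξ : ℝ) : ℂ) := by congr 1; ring
      have e3 : 1 + Complex.exp ((-ξ : ℝ) : ℂ) = ((1 + Real.exp (-ξ) : ℝ) : ℂ) := by
        push_cast; rfl
      have e4 : Complex.exp (a * (Λ + ξ)) =
          Complex.exp (a * Λ) * ((Real.exp (a * ξ) : ℝ) : ℂ) := by
        rw [mul_add, Complex.exp_add]; push_cast; rfl
      have e5 : Real.exp (a * ξ) * Real.exp (-(a * ξ)) = 1 := by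
        rw [← Real.exp_add]; simp
      have e5' : ((Real.exp (a * ξ) : ℝ) : ℂ) * ((Real.exp (-(a * ξ)) : ℝ) : ℂ) = 1 := by
        exact_mod_cast e5
      rw [e1, e2, e3, e4, fermi]
      simp only [Complex.ofReal_mul, Complex.ofReal_div, Complex.ofReal_pow]
      linear_combination (-complexDensity b g (Λ + ξ) * Complex.exp (a * Λ) *
        (((1 + Λ.re) ^ (-κ) : ℝ) : ℂ) * ((-ξ : ℝ) : ℂ) ^ j / ((1 + Real.exp (-ξ) : ℝ) : ℂ)) * e5'
    · rw [if_neg hξ, if_neg (by linarith)]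
  have hdom := tendsto_integral_filter_of_dominated_convergence (μ := volume) (l := stripEnd)
    (F := Φ) (f := fun ξ : ℝ => ((c * ((-ξ) ^ j * fermi a ξ) : ℝ) : ℂ))
    (fun ξ => K * ((1 + |ξ|) ^ (κ + j) * fermi a ξ)) ?_ ?_ ?_ ?_
  · rw [integral_complex_ofReal, integral_const_mul] at hdom
    exact hdom.congr hrepr
  · refine Eventually.of_forall fun Λ => ?_
    refine (aestronglyMeasurable_indicator_iff measurableSet_Ioi).2
      (ContinuousOn.aestronglyMeasurable ?_ measurableSet_Ioi)
    refine ContinuousOn.mul (ContinuousOn.mul (ContinuousOn.mul ?_ (by fun_prop)) (by fun_prop)) ?_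
    · intro ξ hξ
      refine ContinuousAt.continuousWithinAt ?_
      have hd := h.differentiableAt_complexDensity (x := Λ + ξ) (by
        simp only [Complex.add_re, Complex.ofReal_re]
        linarith [show 1 - Λ.re < ξ from hξ])
      exact ContinuousAt.comp (f := fun ξ : ℝ => Λ + (ξ : ℂ)) hd.continuousAt (by fun_prop)
    · exact (Complex.continuous_ofReal.comp
        (Continuous.mul (by fun_prop) (continuous_fermi a))).continuousOn
  · rw [eventually_stripEnd]
    refine ⟨0, fun Λ hR hi => Eventually.of_forall fun ξ => ?_⟩
    have hf := fermi_pos a ξ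
    by_cases hξ : ξ ∈ Ioi (1 - Λ.re)
    · simp only [hΦ]
      rw [indicator_of_mem hξ]
      have hξ : 1 - Λ.re < ξ := hξ
      have h1 := hb (Λ + ξ) (by simp; linarith) (by simpa using hi)
      have hre : (Λ + (ξ : ℂ)).re = Λ.re + ξ := by simp
      rw [hre] at h1
      have hp : (0 : ℝ) < (1 + Λ.re) ^ (-κ) := Real.rpow_pos_of_pos (by linarith) _
      rw [norm_mul, norm_mul, norm_mul, Complex.norm_real, Complex.norm_real, Complex.norm_exp,
        Complex.re_ofReal_mul, hre, Real.norm_of_nonneg hp.le, Real.norm_eq_abs, abs_mul, abs_pow,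
        abs_neg, abs_of_pos hf]
      have h2 : (1 + (Λ.re + ξ)) ^ κ * (1 + Λ.re) ^ (-κ) ≤ (1 + |ξ|) ^ κ := by
        rw [Real.rpow_neg (by linarith), ← div_eq_mul_inv,
          ← Real.div_rpow (by linarith) (by linarith)]
        refine Real.rpow_le_rpow (div_nonneg (by linarith) (by linarith)) ?_ hκ
        rw [div_le_iff₀ (by linarith)]
        nlinarith [le_abs_self ξ, abs_nonneg ξ]
      have h3 : |ξ| ^ j ≤ (1 + |ξ|) ^ j := by gcongr; linarith
      rw [Real.rpow_add (by positivity), Real.rpow_natCast]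
      calc _ ≤ (K * (1 + (Λ.re + ξ)) ^ κ * Real.exp (-(a * (Λ.re + ξ)))) *
            Real.exp (a * (Λ.re + ξ)) * (1 + Λ.re) ^ (-κ) * (|ξ| ^ j * fermi a ξ) := by gcongr
        _ = K * (((1 + (Λ.re + ξ)) ^ κ * (1 + Λ.re) ^ (-κ)) * |ξ| ^ j) * fermi a ξ := by
            rw [Real.exp_neg]; field_simp
        _ ≤ K * ((1 + |ξ|) ^ κ * (1 + |ξ|) ^ j) * fermi a ξ := by gcongr
        _ = _ := by ring
    · simp only [hΦ]
      rw [indicator_of_notMem hξ, norm_zero]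
      positivity
  · exact (integrable_fermi_mul h.a_pos ha (κ + j)).const_mul K
  · refine Eventually.of_forall fun ξ => ?_
    have hu : Tendsto (fun Λ : ℂ => Λ + (ξ : ℂ)) stripEnd stripEnd := by
      rw [tendsto_stripEnd_iff]
      constructor
      · simpa using tendsto_atTop_add_const_right _ ξ tendsto_re_stripEnd
      · rw [eventually_stripEnd]
        exact ⟨0, fun x _ hi => by simpa using hi⟩
    have hratio : Tendsto (fun Λ : ℂ => (1 + (Λ + (ξ : ℂ)).re) / (1 + Λ.re)) stripEnd (𝓝 1) := by
      have t : Tendsto (fun x : ℂ => 1 + ξ / (1 + x.re)) stripEnd (𝓝 (1 + 0)) :=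
        tendsto_const_nhds.add (tendsto_const_nhds.div_atTop
          (tendsto_atTop_add_const_left _ 1 tendsto_re_stripEnd))
      rw [add_zero] at t
      refine t.congr' ?_
      filter_upwards [tendsto_re_stripEnd.eventually (eventually_ge_atTop (0 : ℝ))] with x hx
      have : (1 : ℝ) + x.re ≠ 0 := by linarith
      simp only [Complex.add_re, Complex.ofReal_re]
      field_simp
      ring
    have t := (tendsto_kernel_rescaled hlim' one_pos hu hratio).mul_const
      (((-ξ) ^ j * fermi a ξ : ℝ) : ℂ)
    rw [Real.one_rpow, mul_one, ← Complex.ofReal_mul] at t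
    refine t.congr' ?_
    filter_upwards [tendsto_re_stripEnd.eventually (eventually_gt_atTop (1 - ξ))] with x hx
    simp only [hΦ]
    rw [indicator_of_mem (show ξ ∈ Ioi (1 - x.re) by simp only [mem_Ioi]; linarith)]

lemma norm_shift_factor_le {Λ x : ℂ} (j : ℕ) (hR : 2 ≤ Λ.re) (hi : |Λ.im| ≤ Real.pi)
    (hx0 : 0 ≤ x.re) (hx1 : x.re ≤ 1) (hxi : |x.im| ≤ Real.pi) :
    ‖(Λ - x) ^ j / (1 + Complex.exp (Λ - x))‖ ≤ (Λ.re + 9) ^ j * (2 * Real.exp (1 - Λ.re)) := by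
  -- The constant `9` is `1 + 2 * 4`, from `Re x ≤ 1` and two imaginary parts bounded by `π ≤ 4`.
  have h1 : ‖Λ - x‖ ≤ Λ.re + 9 := by
    refine (norm_sub_le _ _).trans ?_
    have h2 := Complex.norm_le_abs_re_add_abs_im Λ
    have h3 := Complex.norm_le_abs_re_add_abs_im x
    rw [abs_of_nonneg (by linarith)] at h2 h3
    linarith [Real.pi_le_four]
  have h2 : Real.exp (Λ.re - 1) ≤ ‖Complex.exp (Λ - x)‖ := by
    rw [Complex.norm_exp, Real.exp_le_exp, Complex.sub_re]; linarith
  have h3 : 2 ≤ Real.exp (Λ.re - 1) := by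
    have : Real.exp 1 ≤ Real.exp (Λ.re - 1) := Real.exp_le_exp.2 (by linarith)
    linarith [Real.add_one_le_exp (1 : ℝ)]
  have h4 : Real.exp (Λ.re - 1) / 2 ≤ ‖1 + Complex.exp (Λ - x)‖ := by
    have := norm_sub_le (1 + Complex.exp (Λ - x)) 1
    rw [add_sub_cancel_left, norm_one] at this
    linarith
  rw [norm_div, norm_pow, div_le_iff₀ (by linarith)]
  have h5 : Real.exp (1 - Λ.re) * Real.exp (Λ.re - 1) = 1 := by
    rw [← Real.exp_add]; simp
  have h6 : 1 ≤ 2 * Real.exp (1 - Λ.re) * ‖1 + Complex.exp (Λ - x)‖ := by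
    calc (1 : ℝ) = 2 * Real.exp (1 - Λ.re) * (Real.exp (Λ.re - 1) / 2) := by linarith
      _ ≤ _ := by gcongr
  calc ‖Λ - x‖ ^ j ≤ (Λ.re + 9) ^ j * 1 := by rw [mul_one]; gcongr
    _ ≤ (Λ.re + 9) ^ j * (2 * Real.exp (1 - Λ.re) * ‖1 + Complex.exp (Λ - x)‖) := by gcongr
    _ = _ := by ring

/-- Where `Re x ≤ 1` the factor `1 / (1 + e^{Λ - x})` is of order `e^{-Re Λ}`. As `a < 1`, this
beats the normalization `e^{a Re Λ}` and all powers. -/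
lemma IsKernel.tendsto_remainder (h : IsKernel b a e g) (ha : a < 1) (j : ℕ) :
    Tendsto (fun Λ : ℂ =>
      ((∫ x in Ioc (0 : ℝ) 1, shiftIntegrand b g j Λ x) +
        Complex.I * ∫ y in (0 : ℝ)..Λ.im, shiftIntegrand b g j Λ (1 + y * Complex.I)) *
        (Complex.exp (a * Λ) * (((1 + Λ.re) ^ (-(e + b - 1)) : ℝ) : ℂ))) stripEnd (𝓝 0) := by
  obtain ⟨K, hK, hb⟩ := h.exists_complexDensity_bound
  have hκ : 0 ≤ e + b - 1 := by linarith [h.one_le]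
  set κ := e + b - 1
  set D := ∫ x in Ioc (0 : ℝ) 1, density b g x
  set C := D + K * 2 ^ κ * Real.exp (-a) * Real.pi
  have hdecay : Tendsto (fun Λ : ℂ => C * ((Λ.re + 9) ^ j * (2 * Real.exp (1 - Λ.re))) *
      Real.exp (a * Λ.re)) stripEnd (𝓝 0) := by
    have t := (tendsto_rpow_mul_exp_neg_mul_atTop_nhds_zero (j : ℝ) (1 - a) (by linarith)).comp
      (tendsto_atTop_add_const_right atTop (9 : ℝ) tendsto_id)
    have t2 := (t.const_mul (C * (2 * Real.exp (1 + 9 * (1 - a))))).comp tendsto_re_stripEnd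
    rw [mul_zero] at t2
    refine t2.congr fun Λ => ?_
    simp only [Function.comp, id, Real.rpow_natCast]
    have : Real.exp (1 + 9 * (1 - a)) * Real.exp (-(1 - a) * (Λ.re + 9)) =
        Real.exp (1 - Λ.re) * Real.exp (a * Λ.re) := by
      rw [← Real.exp_add, ← Real.exp_add]; congr 1; ring
    linear_combination (C * 2 * (Λ.re + 9) ^ j) * this
  refine squeeze_zero_norm' ?_ hdecay
  rw [eventually_stripEnd]
  refine ⟨2, fun Λ hR hi => ?_⟩
  set M := (Λ.re + 9) ^ j * (2 * Real.exp (1 - Λ.re)) with hM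
  have hM0 : 0 ≤ M := by
    have : 0 ≤ Λ.re + 9 := by linarith
    positivity
  have n1 : ‖∫ x in Ioc (0 : ℝ) 1, shiftIntegrand b g j Λ x‖ ≤ D * M := by
    rw [← integral_mul_const]
    refine norm_integral_le_of_norm_le ((h.integrableOn_density.mono_set
      Ioc_subset_Ioi_self).mul_const M) ?_
    refine (ae_restrict_iff' measurableSet_Ioc).2 (Eventually.of_forall fun x hx => ?_)
    rw [shiftIntegrand, norm_mul, h.complexDensity_ofReal hx.1, Complex.norm_real,
      Real.norm_of_nonneg (h.density_pos hx.1).le]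
    refine mul_le_mul_of_nonneg_left ?_ (h.density_pos hx.1).le
    exact norm_shift_factor_le j hR hi (by simpa using hx.1.le) (by simpa using hx.2)
      (by simpa using Real.pi_pos.le)
  have n2 : ‖Complex.I * ∫ y in (0 : ℝ)..Λ.im, shiftIntegrand b g j Λ (1 + y * Complex.I)‖ ≤
      K * 2 ^ κ * Real.exp (-a) * Real.pi * M := by
    rw [norm_mul, Complex.norm_I, one_mul]
    have := intervalIntegral.norm_integral_le_of_norm_le_const (a := (0 : ℝ)) (b := Λ.im)
      (f := fun y : ℝ => shiftIntegrand b g j Λ (1 + y * Complex.I))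
      (C := K * 2 ^ κ * Real.exp (-a) * M) fun y hy => by
        have hy' := abs_sub_left_of_mem_uIcc (uIoc_subset_uIcc hy)
        rw [sub_zero, sub_zero] at hy'
        have hre : ((1 : ℂ) + y * Complex.I).re = 1 := by simp
        have him : ((1 : ℂ) + y * Complex.I).im = y := by simp
        have h1 := hb (1 + y * Complex.I) (by rw [hre]) (by rw [him]; exact hy'.trans hi)
        rw [hre, mul_one, one_add_one_eq_two] at h1
        rw [shiftIntegrand, norm_mul]
        exact mul_le_mul h1 (norm_shift_factor_le j hR hi (by rw [hre]; norm_num) (by rw [hre])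
          (by rw [him]; exact hy'.trans hi)) (norm_nonneg _) (by positivity)
    rw [sub_zero] at this
    refine this.trans ?_
    calc _ ≤ K * 2 ^ κ * Real.exp (-a) * M * Real.pi := by gcongr
      _ = _ := by ring
  have n3 : ‖Complex.exp (a * Λ) * (((1 + Λ.re) ^ (-κ) : ℝ) : ℂ)‖ ≤ Real.exp (a * Λ.re) := by
    have hp : (0 : ℝ) < (1 + Λ.re) ^ (-κ) := Real.rpow_pos_of_pos (by linarith) _
    rw [norm_mul, Complex.norm_exp, Complex.re_ofReal_mul, Complex.norm_real,
      Real.norm_of_nonneg hp.le]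
    refine mul_le_of_le_one_right (Real.exp_pos _).le ?_
    exact Real.rpow_le_one_of_one_le_of_nonpos (by linarith) (by linarith)
  have n4 : ‖(∫ x in Ioc (0 : ℝ) 1, shiftIntegrand b g j Λ x) +
      Complex.I * ∫ y in (0 : ℝ)..Λ.im, shiftIntegrand b g j Λ (1 + y * Complex.I)‖ ≤ C * M :=
    (norm_add_le _ _).trans ((add_le_add n1 n2).trans (by simp only [C]; linarith))
  rw [norm_mul]
  exact mul_le_mul n4 n3 (norm_nonneg _) ((norm_nonneg _).trans n4)

lemma IsKernel.tendsto_integral_shiftIntegrand (h : IsKernel b a e g) (ha : a < 1)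
    (hlim : Tendsto (fun x : ℂ => g x * Complex.exp (a * x) * (((1 + x.re) ^ (-e) : ℝ) : ℂ))
      stripEnd (𝓝 c)) (j : ℕ) :
    Tendsto (fun Λ : ℂ => (∫ x in Ioi (0 : ℝ), shiftIntegrand b g j Λ x) *
        (Complex.exp (a * Λ) * (((1 + Λ.re) ^ (-(e + b - 1)) : ℝ) : ℂ)))
      (stripEnd ⊓ 𝓟 {Λ | |Λ.im| < Real.pi}) (𝓝 ((c * ∫ ξ, (-ξ) ^ j * fermi a ξ : ℝ) : ℂ)) := by
  have t := ((h.tendsto_remainder ha j).add (h.tendsto_integral_shifted ha hlim j)).mono_left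
    (inf_le_left (b := 𝓟 {Λ : ℂ | |Λ.im| < Real.pi}))
  rw [zero_add] at t
  refine t.congr' ?_
  filter_upwards [mem_inf_of_right (mem_principal_self _)] with Λ hΛ
  have hΛ : |Λ.im| < Real.pi := hΛ
  have hi := h.integrableOn_shiftIntegrand j hΛ
  have hsplit : ∫ x in Ioi (0 : ℝ), shiftIntegrand b g j Λ x =
      (∫ x in Ioc (0 : ℝ) 1, shiftIntegrand b g j Λ x) +
        ∫ x in Ioi (1 : ℝ), shiftIntegrand b g j Λ x := by
    rw [← setIntegral_union (Ioc_disjoint_Ioi le_rfl) measurableSet_Ioi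
      (hi.mono_set Ioc_subset_Ioi_self) (hi.mono_set (Ioi_subset_Ioi zero_le_one)),
      Ioc_union_Ioi_eq_Ioi zero_le_one]
  rw [hsplit, h.integral_shiftIntegrand_eq j hΛ]
  ring

lemma IsKernel.integral_shiftIntegrand_zero (h : IsKernel b a e g) (Λ : ℂ) :
    ∫ x in Ioi (0 : ℝ), shiftIntegrand b g 0 Λ x =
      stieltjes (density b g) (-Complex.exp Λ) := by
  refine setIntegral_congr_fun measurableSet_Ioi fun x hx => ?_
  simp only [shiftIntegrand, h.complexDensity_ofReal hx]
  rw [sub_eq_add_neg Λ, Complex.exp_add]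
  push_cast
  ring

lemma IsKernel.integral_shiftIntegrand_one (h : IsKernel b a e g) {Λ : ℂ}
    (hΛ : |Λ.im| < Real.pi) :
    ∫ x in Ioi (0 : ℝ), shiftIntegrand b g 1 Λ x =
      Λ * stieltjes (density b g) (-Complex.exp Λ) +
        stieltjes (logDensity b g) (-Complex.exp Λ) := by
  have hw := neg_exp_mem_unitSlit hΛ
  rw [stieltjes, stieltjes, ← integral_const_mul, ← integral_add
    ((integrableOn_stieltjes h.integrableOn_density hw).const_mul Λ)
    (integrableOn_stieltjes h.integrableOn_logDensity hw)]
  refine setIntegral_congr_fun measurableSet_Ioi fun x hx => ?_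
  simp only [shiftIntegrand, h.complexDensity_ofReal hx, logDensity]
  rw [sub_eq_add_neg Λ, Complex.exp_add]
  push_cast
  ring

/-- With `w = -e^Λ` the function is `-exp` of the quotient of the shifted integrals for `j = 1` and
`j = 0`. Their common normalization and the constant `c` cancel, leaving a quotient of the two Fermi
integrals. -/
theorem IsKernel.tendsto_infinity (h : IsKernel b a e g) (ha : a < 1) :
    Tendsto (fun w => w * Complex.exp
        (stieltjes (logDensity b g) w / stieltjes (density b g) w))
      (Bornology.cobounded ℂ ⊓ 𝓟 unitSlit)
      (𝓝 (-((Real.exp (-(Real.pi * Real.cot (Real.pi * a))) : ℝ) : ℂ))) := by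
  obtain ⟨c, hc, hlim⟩ := h.asymp
  have hB := integral_fermi_pos h.a_pos ha
  have t0 := h.tendsto_integral_shiftIntegrand ha hlim 0
  have t1 := h.tendsto_integral_shiftIntegrand ha hlim 1
  simp only [pow_zero, one_mul, pow_one] at t0 t1
  rw [integral_neg_mul_fermi h.a_pos ha] at t1
  have t2 := t1.div t0 (by exact_mod_cast (mul_pos hc hB).ne')
  have hval : ((c * (-(Real.pi * Real.cot (Real.pi * a)) * ∫ ξ, fermi a ξ) : ℝ) : ℂ) /
      ((c * ∫ ξ, fermi a ξ : ℝ) : ℂ) = ((-(Real.pi * Real.cot (Real.pi * a)) : ℝ) : ℂ) := by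
    rw [← Complex.ofReal_div]
    congr 1
    field_simp
  rw [hval] at t2
  have t3 : Tendsto (fun Λ : ℂ => -Complex.exp (Λ + stieltjes (logDensity b g) (-Complex.exp Λ) /
      stieltjes (density b g) (-Complex.exp Λ))) (stripEnd ⊓ 𝓟 {Λ | |Λ.im| < Real.pi})
      (𝓝 (-((Real.exp (-(Real.pi * Real.cot (Real.pi * a))) : ℝ) : ℂ))) := by
    have t4 := ((Complex.continuous_exp.tendsto _).comp t2).neg
    rw [← Complex.ofReal_exp] at t4
    refine t4.congr' ?_
    have hge : ∀ᶠ Λ : ℂ in stripEnd ⊓ 𝓟 {Λ | |Λ.im| < Real.pi}, 0 ≤ Λ.re :=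
      (tendsto_re_stripEnd.eventually (eventually_ge_atTop (0 : ℝ))).filter_mono inf_le_left
    filter_upwards [mem_inf_of_right (mem_principal_self _), hge] with Λ hΛ hR
    have hΛ : |Λ.im| < Real.pi := hΛ
    have hF := stieltjes_ne_zero h.integrableOn_density (fun x hx => h.density_pos hx)
      (neg_exp_mem_unitSlit hΛ)
    have hp : (((1 + Λ.re) ^ (-(e + b - 1)) : ℝ) : ℂ) ≠ 0 := by
      exact_mod_cast (Real.rpow_pos_of_pos (by linarith) _).ne'
    simp only [Function.comp, Pi.div_apply]
    rw [h.integral_shiftIntegrand_zero, h.integral_shiftIntegrand_one hΛ,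
      mul_div_mul_right _ _ (mul_ne_zero (Complex.exp_ne_zero _) hp), add_div,
      mul_div_cancel_right₀ _ hF]
  -- A point of the slit plane with `|w| > 1` is not a nonnegative real, so the principal logarithm
  -- of `-w` has imaginary part strictly between `-π` and `π`.
  have hlog : Tendsto (fun w : ℂ => Complex.log (-w)) (Bornology.cobounded ℂ ⊓ 𝓟 unitSlit)
      (stripEnd ⊓ 𝓟 {Λ | |Λ.im| < Real.pi}) := by
    have hev : ∀ᶠ w : ℂ in Bornology.cobounded ℂ ⊓ 𝓟 unitSlit, |(Complex.log (-w)).im| <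
        Real.pi := by
      have h1 : ∀ᶠ w : ℂ in Bornology.cobounded ℂ ⊓ 𝓟 unitSlit, 1 < ‖w‖ :=
        (tendsto_norm_cobounded_atTop.eventually (eventually_gt_atTop (1 : ℝ))).filter_mono
          inf_le_left
      filter_upwards [h1, mem_inf_of_right (mem_principal_self _)] with w hw1 hw2
      have hs : -w ∈ Complex.slitPlane := by
        rw [Complex.mem_slitPlane_iff]
        by_contra hcon
        rw [not_or, not_lt, not_not] at hcon
        obtain ⟨hre, him⟩ := hcon
        simp only [Complex.neg_re, Complex.neg_im, neg_eq_zero, Left.neg_nonpos_iff] at hre him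
        have hn : ‖w‖ = w.re := by
          have : w = (w.re : ℂ) := Complex.ext (by simp) (by simp [him])
          rw [this, Complex.norm_real, Complex.ofReal_re, Real.norm_of_nonneg hre]
        rcases hw2 with h2 | h2
        · simp at h2; linarith
        · simp [him] at h2
      have harg := (Complex.mem_slitPlane_iff_arg.1 hs).1
      rw [Complex.log_im, abs_lt]
      exact ⟨Complex.neg_pi_lt_arg _, lt_of_le_of_ne (Complex.arg_le_pi _) harg⟩
    refine tendsto_inf.2 ⟨tendsto_stripEnd_iff.2 ⟨?_, hev.mono fun w hw => hw.le⟩,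
      tendsto_principal.2 hev⟩
    simp only [Complex.log_re, norm_neg]
    exact (Real.tendsto_log_atTop.comp tendsto_norm_cobounded_atTop).mono_left inf_le_left
  refine (t3.comp hlog).congr' ?_
  have h1 : ∀ᶠ w : ℂ in Bornology.cobounded ℂ ⊓ 𝓟 unitSlit, 1 < ‖w‖ :=
    (tendsto_norm_cobounded_atTop.eventually (eventually_gt_atTop (1 : ℝ))).filter_mono inf_le_left
  filter_upwards [h1] with w hw
  have hw0 : -w ≠ 0 := by
    intro h0
    rw [neg_eq_zero.1 h0, norm_zero] at hw
    linarith
  simp only [Function.comp]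
  rw [Complex.exp_log hw0, neg_neg, Complex.exp_add, Complex.exp_log hw0]
  ring

end

/-! ### The transform near `w = 1`: separating the singular integral. -/

/-- The regular part `1 / (1 - exp (-y)) - 1 / y` of the pole at `0`. -/
def poleRemainder : ℂ → ℂ := dslope (fun y => (expQuot y)⁻¹) 0

lemma expQuot_ne_zero {y : ℂ} (hy : ‖y‖ < 1) : expQuot y ≠ 0 :=
  Complex.slitPlane_ne_zero (expQuot_mem_slitPlane (Or.inl (by simpa using hy)))

lemma differentiableOn_poleRemainder : DifferentiableOn ℂ poleRemainder (Metric.ball 0 1) := by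
  rw [poleRemainder, Complex.differentiableOn_dslope (Metric.ball_mem_nhds 0 one_pos)]
  intro y hy
  exact (differentiable_expQuot y).differentiableWithinAt.inv (expQuot_ne_zero (by simpa using hy))

lemma one_div_one_sub_exp {y : ℂ} (h0 : y ≠ 0) (hy : ‖y‖ < 1) :
    1 / (1 - Complex.exp (-y)) = 1 / y + poleRemainder y := by
  have h1 := expQuot_ne_zero hy
  rw [poleRemainder, dslope_of_ne _ h0, slope_def_field, expQuot_zero, ← mul_expQuot y]
  field_simp
  ring

/-- Turns holomorphy of the divided difference in its second argument into holomorphy in the first,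
the one in which `ω` occurs. -/
lemma dslope_symm {γ : ℂ → ℂ} (x y : ℂ) : dslope γ x y = dslope γ y x := by
  rcases eq_or_ne x y with rfl | h
  · rfl
  · rw [dslope_of_ne _ h.symm, dslope_of_ne _ h, slope_comm]

lemma exists_dslope_bound {γ : ℂ → ℂ} (hγ : DifferentiableOn ℂ γ (Metric.ball 0 1)) :
    ∃ M : ℝ, 0 ≤ M ∧ ∀ x ∈ Metric.closedBall (0 : ℂ) (3 / 4),
      ∀ y ∈ Metric.closedBall (0 : ℂ) (3 / 4), ‖dslope γ x y‖ ≤ M := by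
  have hsub : Metric.closedBall (0 : ℂ) (3 / 4) ⊆ Metric.ball 0 1 :=
    Metric.closedBall_subset_ball (by norm_num)
  obtain ⟨M, hM⟩ := (isCompact_closedBall (0 : ℂ) (3 / 4)).exists_bound_of_continuousOn
    ((hγ.deriv Metric.isOpen_ball).continuousOn.mono hsub)
  have hd : ∀ x ∈ Metric.closedBall (0 : ℂ) (3 / 4), DifferentiableAt ℂ γ x := fun x hx =>
    hγ.differentiableAt (Metric.isOpen_ball.mem_nhds (hsub hx))
  refine ⟨max M 0, le_max_right _ _, fun x hx y hy => ?_⟩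
  refine le_trans ?_ (le_max_left _ _)
  rcases eq_or_ne y x with rfl | h
  · rw [dslope_same]; exact hM _ hx
  · have := (convex_closedBall (0 : ℂ) (3 / 4)).norm_image_sub_le_of_norm_deriv_le hd hM hx hy
    rw [dslope_of_ne _ h, slope_def_field, norm_div, div_le_iff₀ (norm_pos_iff.2 (sub_ne_zero.2 h))]
    exact this

lemma integrableOn_rpow_Ioc {b : ℝ} (hb : 0 < b) :
    IntegrableOn (fun x : ℝ => x ^ (b - 1)) (Ioc 0 (1 / 2)) := by
  have := intervalIntegral.intervalIntegrable_rpow' (a := 0) (b := 1 / 2) (r := b - 1)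
    (by linarith)
  rwa [intervalIntegrable_iff_integrableOn_Ioc_of_le (by norm_num)] at this

/-- The singular integral `∫ x ^ (b - 1) / (x - ω)` over `(0, 1 / 2]`. -/
def cauchyPart (b : ℝ) (ω : ℂ) : ℂ :=
  ∫ x in Ioc (0 : ℝ) (1 / 2), ((x ^ (b - 1) : ℝ) : ℂ) * (1 / (x - ω))

lemma ofReal_sub_mem_slitPlane {ω : ℂ} (hω : -ω ∈ Complex.slitPlane) {x : ℝ} (hx : 0 ≤ x) :
    (x : ℂ) - ω ∈ Complex.slitPlane := by
  rcases hω with h | h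
  · left; simp at h ⊢; linarith
  · right; simpa using h

lemma integrableOn_cauchyPart {b : ℝ} (hb : 0 < b) {ω : ℂ} (hω : -ω ∈ Complex.slitPlane) :
    IntegrableOn (fun x : ℝ => ((x ^ (b - 1) : ℝ) : ℂ) * (1 / (x - ω))) (Ioc 0 (1 / 2)) := by
  obtain ⟨K, hK⟩ := (isCompact_Icc (a := (0 : ℝ)) (b := 1 / 2)).exists_bound_of_continuousOn
    (f := fun x : ℝ => 1 / ((x : ℂ) - ω)) (by
      refine ContinuousOn.div (by fun_prop) (by fun_prop) fun x hx => ?_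
      exact Complex.slitPlane_ne_zero (ofReal_sub_mem_slitPlane hω hx.1))
  refine Integrable.mono' ((integrableOn_rpow_Ioc hb).mul_const K) ?_ ?_
  · refine (integrableOn_rpow_Ioc hb).ofReal.1.mul (Measurable.aestronglyMeasurable ?_)
    fun_prop
  · refine (ae_restrict_iff' measurableSet_Ioc).2 (Eventually.of_forall fun x hx => ?_)
    have hx0 := hx.1
    rw [norm_mul, Complex.norm_real, Real.norm_of_nonneg (by positivity)]
    exact mul_le_mul_of_nonneg_left (hK x ⟨hx.1.le, hx.2⟩) (by positivity)

/-- The part of the Stieltjes transform that stays holomorphic at the end of the cut. -/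
def regularPart (b : ℝ) (γ : ℂ → ℂ) (ρ : ℝ → ℝ) (ω : ℂ) : ℂ :=
  (∫ x in Ioi (1 / 2 : ℝ), (ρ x : ℂ) / (1 - Complex.exp ω * Real.exp (-x))) +
    ∫ x in Ioc (0 : ℝ) (1 / 2), ((x ^ (b - 1) : ℝ) : ℂ) *
      (dslope γ ω x + γ x * poleRemainder (x - ω))

section

variable {b : ℝ} {γ : ℂ → ℂ} {ρ : ℝ → ℝ}

/-- The radii `1/4` for `ω` and `1/2` for `x` are chosen so that `x - ω` stays in the unit disc,
where `poleRemainder` is holomorphic. -/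
lemma norm_ofReal_sub_le {ω : ℂ} (hω : ω ∈ Metric.ball (0 : ℂ) (1 / 4)) {x : ℝ}
    (hx : x ∈ Ioc (0 : ℝ) (1 / 2)) : ‖(x : ℂ) - ω‖ ≤ 3 / 4 := by
  have h1 : ‖ω‖ < 1 / 4 := by simpa using hω
  refine (norm_sub_le _ _).trans ?_
  rw [Complex.norm_real, Real.norm_of_nonneg hx.1.le]
  linarith [hx.2]

lemma continuousOn_local_integrand (hγ : DifferentiableOn ℂ γ kernelDomain) {ω : ℂ}
    (hω : ω ∈ Metric.ball (0 : ℂ) (1 / 4)) :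
    ContinuousOn (fun x : ℝ => ((x ^ (b - 1) : ℝ) : ℂ) *
      (dslope γ ω x + γ x * poleRemainder (x - ω))) (Ioc 0 (1 / 2)) := by
  have hγ1 : DifferentiableOn ℂ γ (Metric.ball 0 1) := hγ.mono subset_union_left
  have hx1 : ∀ x ∈ Ioc (0 : ℝ) (1 / 2), (x : ℂ) ∈ Metric.ball (0 : ℂ) 1 := fun x hx => by
    rw [mem_ball_zero_iff, Complex.norm_real, Real.norm_of_nonneg hx.1.le]; linarith [hx.2]
  have hω1 : ω ∈ Metric.ball (0 : ℂ) 1 := Metric.ball_subset_ball (by norm_num) hω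
  refine ContinuousOn.mul ?_ (ContinuousOn.add ?_ (ContinuousOn.mul ?_ ?_))
  · refine Complex.continuous_ofReal.comp_continuousOn (ContinuousOn.rpow_const (by fun_prop) ?_)
    intro x hx; left; exact hx.1.ne'
  · exact ((Complex.differentiableOn_dslope (Metric.isOpen_ball.mem_nhds hω1)).2
      hγ1).continuousOn.comp (by fun_prop) hx1
  · exact hγ1.continuousOn.comp (by fun_prop) hx1
  · refine differentiableOn_poleRemainder.continuousOn.comp (by fun_prop) fun x hx => ?_
    rw [mem_ball_zero_iff]
    exact (norm_ofReal_sub_le hω hx).trans_lt (by norm_num)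

lemma exists_local_integrand_bound (hγ : DifferentiableOn ℂ γ kernelDomain) :
    ∃ M : ℝ, 0 ≤ M ∧ ∀ ω ∈ Metric.ball (0 : ℂ) (1 / 4), ∀ x ∈ Ioc (0 : ℝ) (1 / 2),
      ‖dslope γ ω x + γ x * poleRemainder (x - ω)‖ ≤ M := by
  have hγ1 : DifferentiableOn ℂ γ (Metric.ball 0 1) := hγ.mono subset_union_left
  have hsub : Metric.closedBall (0 : ℂ) (3 / 4) ⊆ Metric.ball 0 1 :=
    Metric.closedBall_subset_ball (by norm_num)
  obtain ⟨M₁, hM₁, h1⟩ := exists_dslope_bound hγ1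
  obtain ⟨M₂, h2⟩ := (isCompact_closedBall (0 : ℂ) (3 / 4)).exists_bound_of_continuousOn
    (hγ1.continuousOn.mono hsub)
  obtain ⟨M₃, h3⟩ := (isCompact_closedBall (0 : ℂ) (3 / 4)).exists_bound_of_continuousOn
    (differentiableOn_poleRemainder.continuousOn.mono hsub)
  have hM₂ : 0 ≤ M₂ := (norm_nonneg _).trans (h2 0 (Metric.mem_closedBall_self (by norm_num)))
  have hM₃ : 0 ≤ M₃ := (norm_nonneg _).trans (h3 0 (Metric.mem_closedBall_self (by norm_num)))
  refine ⟨M₁ + M₂ * M₃, by positivity, fun ω hω x hx => ?_⟩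
  have hx' : (x : ℂ) ∈ Metric.closedBall (0 : ℂ) (3 / 4) := by
    rw [mem_closedBall_zero_iff, Complex.norm_real, Real.norm_of_nonneg hx.1.le]; linarith [hx.2]
  have hω' : ω ∈ Metric.closedBall (0 : ℂ) (3 / 4) :=
    Metric.ball_subset_closedBall (Metric.ball_subset_ball (by norm_num) hω)
  refine (norm_add_le _ _).trans (add_le_add (h1 _ hω' _ hx') ?_)
  rw [norm_mul]
  refine mul_le_mul (h2 _ hx') (h3 _ ?_) (norm_nonneg _) hM₂
  rw [mem_closedBall_zero_iff]
  exact norm_ofReal_sub_le hω hx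

lemma exists_tail_bound : ∃ K : ℝ, 0 ≤ K ∧ ∀ ω ∈ Metric.ball (0 : ℂ) (1 / 4), ∀ x : ℝ,
    1 / 2 < x → 1 - Complex.exp ω * Real.exp (-x) ≠ 0 ∧
      ‖(1 - Complex.exp ω * Real.exp (-x))⁻¹‖ ≤ K := by
  have hpos : 0 < 1 - Real.exp (-(1 / 4)) := by
    have : Real.exp (-(1 / 4)) < 1 := Real.exp_lt_one_iff.2 (by norm_num)
    linarith
  refine ⟨(1 - Real.exp (-(1 / 4)))⁻¹, by positivity, fun ω hω x hx => ?_⟩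
  have h1 : ‖ω‖ < 1 / 4 := by simpa using hω
  have h2 : ‖Complex.exp ω * Real.exp (-x)‖ ≤ Real.exp (-(1 / 4)) := by
    rw [norm_mul, Complex.norm_exp, Complex.norm_real, Real.norm_of_nonneg (Real.exp_pos _).le,
      ← Real.exp_add, Real.exp_le_exp]
    have := Complex.re_le_norm ω
    linarith
  have h3 : 1 - Real.exp (-(1 / 4)) ≤ ‖1 - Complex.exp ω * Real.exp (-x)‖ := by
    have := norm_sub_norm_le (1 : ℂ) (Complex.exp ω * Real.exp (-x))
    rw [norm_one] at this
    linarith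
  refine ⟨norm_pos_iff.1 (hpos.trans_le h3), ?_⟩
  rw [norm_inv]
  exact inv_anti₀ hpos h3

lemma differentiableOn_regularPart (hb : 0 < b) (hγ : DifferentiableOn ℂ γ kernelDomain)
    (hi : IntegrableOn ρ (Ioi 0)) :
    DifferentiableOn ℂ (regularPart b γ ρ) (Metric.ball 0 (1 / 4)) := by
  have hγ1 : DifferentiableOn ℂ γ (Metric.ball 0 1) := hγ.mono subset_union_left
  have hi' : IntegrableOn ρ (Ioi (1 / 2)) := hi.mono_set (Ioi_subset_Ioi (by norm_num))
  refine DifferentiableOn.add ?_ ?_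
  · obtain ⟨K, hK0, hK⟩ := exists_tail_bound
    refine differentiableOn_integral_of_locally_dominated Metric.isOpen_ball ?_ ?_ ?_
    · intro ω _
      refine hi'.ofReal.1.mul (Measurable.aestronglyMeasurable ?_)
      fun_prop
    · refine (ae_restrict_iff' measurableSet_Ioi).2 (Eventually.of_forall fun x hx => ?_)
      exact DifferentiableOn.div (by fun_prop) (by fun_prop) fun ω hω => (hK ω hω x hx).1
    · intro ω₀ _
      refine ⟨1, one_pos, fun x => ‖ρ x‖ * K, hi'.norm.mul_const K, ?_⟩
      refine (ae_restrict_iff' measurableSet_Ioi).2 (Eventually.of_forall fun x hx ω _ hω => ?_)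
      rw [div_eq_mul_inv, norm_mul, Complex.norm_real]
      exact mul_le_mul_of_nonneg_left (hK ω hω x hx).2 (norm_nonneg _)
  · obtain ⟨M, hM0, hM⟩ := exists_local_integrand_bound hγ
    refine differentiableOn_integral_of_locally_dominated Metric.isOpen_ball ?_ ?_ ?_
    · intro ω hω
      exact (continuousOn_local_integrand hγ hω).aestronglyMeasurable measurableSet_Ioc
    · refine (ae_restrict_iff' measurableSet_Ioc).2 (Eventually.of_forall fun x hx => ?_)
      have hx1 : (x : ℂ) ∈ Metric.ball (0 : ℂ) 1 := by
        rw [mem_ball_zero_iff, Complex.norm_real, Real.norm_of_nonneg hx.1.le]; linarith [hx.2]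
      refine (differentiableOn_const _).mul (DifferentiableOn.add ?_
        ((differentiableOn_const _).mul ?_))
      · simp only [dslope_symm _ (x : ℂ)]
        exact ((Complex.differentiableOn_dslope (Metric.isOpen_ball.mem_nhds hx1)).2
          hγ1).mono (Metric.ball_subset_ball (by norm_num))
      · refine differentiableOn_poleRemainder.comp (by fun_prop) fun ω hω => ?_
        rw [mem_ball_zero_iff]
        exact (norm_ofReal_sub_le hω hx).trans_lt (by norm_num)
    · intro ω₀ _
      refine ⟨1, one_pos, fun x => x ^ (b - 1) * M, (integrableOn_rpow_Ioc hb).mul_const M, ?_⟩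
      refine (ae_restrict_iff' measurableSet_Ioc).2 (Eventually.of_forall fun x hx ω _ hω => ?_)
      have hx0 := hx.1
      rw [norm_mul, Complex.norm_real, Real.norm_of_nonneg (by positivity)]
      exact mul_le_mul_of_nonneg_left (hM ω hω x hx) (by positivity)

lemma exp_mem_unitSlit {ω : ℂ} (hω : ω ∈ Metric.ball (0 : ℂ) (1 / 4))
    (hs : -ω ∈ Complex.slitPlane) : Complex.exp ω ∈ unitSlit := by
  have h1 : ‖ω‖ < 1 / 4 := by simpa using hω
  have hn : ‖(-ω : ℂ)‖ < 1 := by rw [norm_neg]; linarith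
  by_contra hcon
  have hcon' : ¬ (1 - Complex.exp ω ∈ Complex.slitPlane) := hcon
  rw [Complex.mem_slitPlane_iff, not_or, not_lt, not_not] at hcon'
  obtain ⟨hre, him⟩ := hcon'
  have him' : (Complex.exp ω).im = 0 := by simpa using him
  have hre' : 1 ≤ (Complex.exp ω).re := by simpa using hre
  have hlog : Complex.log (Complex.exp ω) = ω := by
    have h2 := Complex.abs_im_le_norm ω
    have h3 := Real.pi_gt_three
    have h4 := abs_le.1 (h2.trans h1.le)
    exact Complex.log_exp (by linarith) (by linarith)
  have hreal : Complex.exp ω = ((Complex.exp ω).re : ℂ) := Complex.ext (by simp) (by simp [him'])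
  have hω' : ω = (Real.log (Complex.exp ω).re : ℂ) := by
    rw [Complex.ofReal_log (by linarith), ← hreal, hlog]
  rcases hs with h | h
  · rw [hω'] at h
    simp only [Complex.neg_re, Complex.ofReal_re] at h
    linarith [Real.log_nonneg hre']
  · rw [hω'] at h
    simp at h

/-- With `y = x - ω`, the factor `1 / (1 - e^{-y})` is `1 / y` plus a holomorphic remainder, and `γ
x / (x - ω)` is `γ ω / (x - ω)` plus a divided difference. Only `γ ω` times the integral of `x ^ (b
- 1) / (x - ω)` fails to extend; the tail `x > 1/2` is regular as `|ω| < 1/4`. -/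
lemma stieltjes_exp_eq (hb : 0 < b) (hγ : DifferentiableOn ℂ γ kernelDomain)
    (hi : IntegrableOn ρ (Ioi 0)) (hρ : ∀ x : ℝ, 0 < x → (ρ x : ℂ) = ((x ^ (b - 1) : ℝ) : ℂ) * γ x)
    {ω : ℂ} (hω : ω ∈ Metric.ball (0 : ℂ) (1 / 4)) (hs : -ω ∈ Complex.slitPlane) :
    stieltjes ρ (Complex.exp ω) = regularPart b γ ρ ω + γ ω * cauchyPart b ω := by
  have hint := integrableOn_stieltjes hi (exp_mem_unitSlit hω hs)
  have hsplit : stieltjes ρ (Complex.exp ω) =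
      (∫ x in Ioc (0 : ℝ) (1 / 2), (ρ x : ℂ) / (1 - Complex.exp ω * Real.exp (-x))) +
        ∫ x in Ioi (1 / 2 : ℝ), (ρ x : ℂ) / (1 - Complex.exp ω * Real.exp (-x)) := by
    rw [← setIntegral_union (Ioc_disjoint_Ioi le_rfl) measurableSet_Ioi
      (hint.mono_set Ioc_subset_Ioi_self) (hint.mono_set (Ioi_subset_Ioi (by norm_num))),
      Ioc_union_Ioi_eq_Ioi (by norm_num), stieltjes]
  have hc := integrableOn_cauchyPart hb hs
  obtain ⟨M, hM0, hM⟩ := exists_local_integrand_bound hγ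
  have hr : IntegrableOn (fun x : ℝ => ((x ^ (b - 1) : ℝ) : ℂ) *
      (dslope γ ω x + γ x * poleRemainder (x - ω))) (Ioc 0 (1 / 2)) := by
    refine Integrable.mono' ((integrableOn_rpow_Ioc hb).mul_const M)
      ((continuousOn_local_integrand hγ hω).aestronglyMeasurable measurableSet_Ioc) ?_
    refine (ae_restrict_iff' measurableSet_Ioc).2 (Eventually.of_forall fun x hx => ?_)
    have hx0 := hx.1
    rw [norm_mul, Complex.norm_real, Real.norm_of_nonneg (by positivity)]
    exact mul_le_mul_of_nonneg_left (hM ω hω x hx) (by positivity)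
  have hmain : ∫ x in Ioc (0 : ℝ) (1 / 2), (ρ x : ℂ) / (1 - Complex.exp ω * Real.exp (-x)) =
      (∫ x in Ioc (0 : ℝ) (1 / 2), ((x ^ (b - 1) : ℝ) : ℂ) *
        (dslope γ ω x + γ x * poleRemainder (x - ω))) + γ ω * cauchyPart b ω := by
    rw [cauchyPart, ← integral_const_mul, ← integral_add hr (hc.const_mul _)]
    refine setIntegral_congr_fun measurableSet_Ioc fun x hx => ?_
    have hne : (x : ℂ) - ω ≠ 0 := Complex.slitPlane_ne_zero (ofReal_sub_mem_slitPlane hs hx.1.le)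
    have hp := one_div_one_sub_exp hne ((norm_ofReal_sub_le hω hx).trans_lt (by norm_num))
    have he : Complex.exp ω * (Real.exp (-x) : ℂ) = Complex.exp (-((x : ℂ) - ω)) := by
      push_cast; rw [← Complex.exp_add]; congr 1; ring
    have hds : dslope γ ω x = (γ x - γ ω) / (x - ω) := by
      rw [dslope_of_ne _ (sub_ne_zero.1 hne), slope_def_field]
    rw [he, hρ x hx.1, div_eq_mul_one_div, hp, hds]
    field_simp
    ring
  rw [hsplit, hmain, regularPart]
  ring

end

/-! ### The singular integral for integral and half-integral exponents. -/

/-- Near `0` and off the cut `[0, ∞)`, the singular integral `cauchyPart b` is a holomorphic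
function plus `ω ^ j * E (log (-ω))`. -/
def HasSingularForm (b : ℝ) (j : ℕ) (E : ℂ → ℂ) : Prop :=
  ∃ A : ℂ → ℂ, DifferentiableOn ℂ A (Metric.ball 0 (1 / 4)) ∧
    ∀ ω ∈ Metric.ball (0 : ℂ) (1 / 4), -ω ∈ Complex.slitPlane →
      cauchyPart b ω = A ω + ω ^ j * E (Complex.log (-ω))

/-- From `x / (x - ω) = 1 + ω / (x - ω)`. Raising `b` by one thus multiplies the singular part by
`ω`, which reduces half-integral exponents to `b = 1` and `b = 1/2`. -/
lemma cauchyPart_add_one {b : ℝ} (hb : 0 < b) {ω : ℂ} (hω : -ω ∈ Complex.slitPlane) :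
    cauchyPart (b + 1) ω =
      ω * cauchyPart b ω + ∫ x in Ioc (0 : ℝ) (1 / 2), ((x ^ (b - 1) : ℝ) : ℂ) := by
  have hi : IntegrableOn (fun x : ℝ => ((x ^ (b - 1) : ℝ) : ℂ)) (Ioc 0 (1 / 2)) :=
    (integrableOn_rpow_Ioc hb).ofReal
  rw [cauchyPart, cauchyPart, ← integral_const_mul,
    ← integral_add ((integrableOn_cauchyPart hb hω).const_mul _) hi]
  refine setIntegral_congr_fun measurableSet_Ioc fun x hx => ?_
  have hne : (x : ℂ) - ω ≠ 0 := Complex.slitPlane_ne_zero (ofReal_sub_mem_slitPlane hω hx.1.le)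
  have hx' : x ^ (b + 1 - 1) = x ^ (b - 1) * x := by
    rw [← Real.rpow_add_one hx.1.ne']; congr 1; ring
  rw [hx']
  push_cast
  field_simp
  ring

lemma HasSingularForm.succ {b : ℝ} {j : ℕ} {E : ℂ → ℂ} (hb : 0 < b) (h : HasSingularForm b j E) :
    HasSingularForm (b + 1) (j + 1) E := by
  obtain ⟨A, hA, h⟩ := h
  refine ⟨fun ω => ω * A ω + ∫ x in Ioc (0 : ℝ) (1 / 2), ((x ^ (b - 1) : ℝ) : ℂ),
    (differentiableOn_id.mul hA).add_const _, fun ω hω hs => ?_⟩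
  rw [cauchyPart_add_one hb hs, h ω hω hs]
  ring

lemma HasSingularForm.add_natCast {b : ℝ} {E : ℂ → ℂ} (hb : 0 < b) (h : HasSingularForm b 0 E)
    (j : ℕ) : HasSingularForm (b + j) j E := by
  induction j with
  | zero => simpa using h
  | succ j ih =>
    have := ih.succ (by positivity)
    push_cast
    rwa [← add_assoc]

lemma hasSingularForm_one : HasSingularForm 1 0 fun τ => -τ := by
  refine ⟨fun ω => Complex.log (1 / 2 - ω), fun ω hω => ?_, fun ω hω hs => ?_⟩
  · have h1 : ‖ω‖ < 1 / 4 := by simpa using hω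
    have h2 := Complex.re_le_norm ω
    refine DifferentiableWithinAt.clog (by fun_prop) (Or.inl ?_)
    simp
    linarith
  · have hcont : ContinuousOn (fun x : ℝ => ((x : ℂ) - ω)⁻¹) (uIcc 0 (1 / 2)) := by
      rw [uIcc_of_le (by norm_num)]
      exact ContinuousOn.inv₀ (by fun_prop) fun x hx =>
        Complex.slitPlane_ne_zero (ofReal_sub_mem_slitPlane hs hx.1)
    have h := intervalIntegral.integral_eq_sub_of_hasDerivAt (a := 0) (b := 1 / 2)
      (f := fun x : ℝ => Complex.log (x - ω)) (f' := fun x : ℝ => ((x : ℂ) - ω)⁻¹)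
      (fun x hx => by
        rw [uIcc_of_le (by norm_num)] at hx
        have h1 : HasDerivAt (fun x : ℝ => (x : ℂ) - ω) 1 x :=
          (Complex.ofRealCLM.hasDerivAt (x := x)).sub_const ω
        simpa using h1.clog_real (ofReal_sub_mem_slitPlane hs hx.1))
      hcont.intervalIntegrable
    rw [intervalIntegral.integral_of_le (by norm_num)] at h
    have h2 : cauchyPart 1 ω = ∫ x in Ioc (0 : ℝ) (1 / 2), ((x : ℂ) - ω)⁻¹ := by
      rw [cauchyPart]
      refine setIntegral_congr_fun measurableSet_Ioc fun x hx => ?_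
      simp
    rw [h2, h]
    push_cast
    simp [sub_eq_add_neg]

/-- An antiderivative of `2 / (s ^ 2 + v ^ 2)`. -/
def arctanAux (s : ℂ) (v : ℝ) : ℂ :=
  (Complex.log (s + Complex.I * v) - Complex.log (s - Complex.I * v)) / (Complex.I * s)

lemma hasDerivAt_arctanAux {s : ℂ} (hs : 0 < s.re) (v : ℝ) :
    HasDerivAt (arctanAux s) (2 / (s ^ 2 + v ^ 2)) v := by
  have hv : HasDerivAt (fun v : ℝ => Complex.I * (v : ℂ)) Complex.I v := by
    simpa using (Complex.ofRealCLM.hasDerivAt (x := v)).const_mul Complex.I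
  have h1 : s + Complex.I * v ∈ Complex.slitPlane := Or.inl (by simpa using hs)
  have h2 : s - Complex.I * v ∈ Complex.slitPlane := Or.inl (by simpa using hs)
  have h := (((hv.const_add s).clog_real h1).sub ((hv.const_sub s).clog_real h2)).div_const
    (Complex.I * s)
  have hs0 : s ≠ 0 := fun h0 => by simp [h0] at hs
  have h1' := Complex.slitPlane_ne_zero h1
  have h2' := Complex.slitPlane_ne_zero h2
  have he : s ^ 2 + (v : ℂ) ^ 2 = (s + Complex.I * v) * (s - Complex.I * v) := by
    linear_combination (v : ℂ) ^ 2 * Complex.I_sq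
  convert! h using 1
  rw [he]
  field_simp
  ring

/-- Both logarithms grow like `log v`; what survives is `log i - log (-i) = π i`. -/
lemma tendsto_arctanAux {s : ℂ} (hs : 0 < s.re) :
    Tendsto (arctanAux s) atTop (𝓝 (Real.pi / s)) := by
  have hs0 : s ≠ 0 := fun h0 => by simp [h0] at hs
  have hinv : Tendsto (fun v : ℝ => s * ((v⁻¹ : ℝ) : ℂ)) atTop (𝓝 0) := by
    have := (Complex.continuous_ofReal.tendsto 0).comp tendsto_inv_atTop_zero
    simpa using this.const_mul s
  have key : ∀ ζ ∈ Complex.slitPlane, Tendsto (fun v : ℝ => Complex.log (s + ζ * v) - Real.log v)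
      atTop (𝓝 (Complex.log ζ)) := by
    intro ζ hζ
    have h1 : Tendsto (fun v : ℝ => Complex.log (ζ + s * ((v⁻¹ : ℝ) : ℂ))) atTop
        (𝓝 (Complex.log ζ)) := by
      have h2 : Tendsto (fun v : ℝ => ζ + s * ((v⁻¹ : ℝ) : ℂ)) atTop (𝓝 ζ) := by
        simpa using hinv.const_add ζ
      exact (continuousAt_clog hζ).tendsto.comp h2
    refine h1.congr' ?_
    have hne : ∀ᶠ v : ℝ in atTop, ζ + s * ((v⁻¹ : ℝ) : ℂ) ≠ 0 :=
      (by simpa using hinv.const_add ζ : Tendsto _ _ (𝓝 ζ)).eventually_ne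
        (Complex.slitPlane_ne_zero hζ)
    filter_upwards [eventually_gt_atTop 0, hne] with v hv hne
    have hv' : (v : ℂ) ≠ 0 := by exact_mod_cast hv.ne'
    have : s + ζ * v = (v : ℂ) * (ζ + s * ((v⁻¹ : ℝ) : ℂ)) := by push_cast; field_simp; ring
    rw [this, Complex.log_ofReal_mul hv hne]
    ring
  have hI := key Complex.I (by simp [Complex.mem_slitPlane_iff])
  have hI' := key (-Complex.I) (by simp [Complex.mem_slitPlane_iff])
  have h := ((hI.sub hI').div_const (Complex.I * s))
  have hval : (Complex.log Complex.I - Complex.log (-Complex.I)) / (Complex.I * s)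
      = Real.pi / s := by
    rw [Complex.log_I, Complex.log_neg_I]
    have := Complex.I_ne_zero
    field_simp
    ring
  rw [hval] at h
  refine h.congr fun v => ?_
  rw [arctanAux]
  congr 1
  ring_nf

lemma integrableOn_rpow_neg_half_tail :
    IntegrableOn (fun x : ℝ => x ^ (-(1 / 2) : ℝ) * (2 / x)) (Ioi (1 / 2)) := by
  have h : IntegrableOn (fun x : ℝ => 2 * x ^ (-(3 / 2) : ℝ)) (Ioi (1 / 2)) :=
    (integrableOn_Ioi_rpow_of_lt (by norm_num) (by norm_num)).const_mul 2
  refine h.congr_fun (fun x hx => ?_) measurableSet_Ioi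
  have hx0 : (0 : ℝ) < x := lt_trans (by norm_num) hx
  have : x ^ (-(1 / 2) : ℝ) = x ^ (-(3 / 2) : ℝ) * x := by
    rw [← Real.rpow_add_one hx0.ne']; norm_num
  simp only [this]
  field_simp

lemma norm_tail_le {ω : ℂ} (hω : ω ∈ Metric.ball (0 : ℂ) (1 / 4)) {x : ℝ} (hx : x ∈ Ioi (1 / 2 : ℝ)) :
    (x : ℂ) - ω ≠ 0 ∧
    ‖((x ^ (-(1 / 2) : ℝ) : ℝ) : ℂ) * (1 / (x - ω))‖ ≤ x ^ (-(1 / 2) : ℝ) * (2 / x) := by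
  have h1 : ‖ω‖ < 1 / 4 := by simpa using hω
  have hx' : (1 / 2 : ℝ) < x := hx
  have hx0 : (0 : ℝ) < x := lt_trans (by norm_num) hx'
  have h2 : x / 2 ≤ ‖(x : ℂ) - ω‖ := by
    have := norm_sub_norm_le (x : ℂ) ω
    rw [Complex.norm_real, Real.norm_of_nonneg hx0.le] at this
    linarith
  refine ⟨norm_pos_iff.1 (lt_of_lt_of_le (by positivity) h2), ?_⟩
  rw [norm_mul, Complex.norm_real, Real.norm_of_nonneg (by positivity), norm_div, norm_one]
  refine mul_le_mul_of_nonneg_left ?_ (by positivity)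
  calc 1 / ‖(x : ℂ) - ω‖ ≤ 1 / (x / 2) := one_div_le_one_div_of_le (by positivity) h2
    _ = 2 / x := by field_simp

lemma continuousOn_tail {ω : ℂ} (hω : ω ∈ Metric.ball (0 : ℂ) (1 / 4)) :
    ContinuousOn (fun x : ℝ => ((x ^ (-(1 / 2) : ℝ) : ℝ) : ℂ) * (1 / (x - ω))) (Ioi (1 / 2)) := by
  refine ContinuousOn.mul (Complex.continuous_ofReal.comp_continuousOn
    (continuousOn_id.rpow_const fun x hx => Or.inl ?_)) (ContinuousOn.div (by fun_prop) (by fun_prop)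
    fun x hx => (norm_tail_le hω hx).1)
  exact (lt_trans (by norm_num) (show (1 / 2 : ℝ) < x from hx)).ne'

/-- The integral is extended to `(0, ∞)`, the added tail being holomorphic near `0`. With `s` the
square root of `-ω` of positive real part and `v = √x`, the full integral is `∫ 2 / (s ^ 2 + v ^ 2)
dv = π / s`. -/
lemma hasSingularForm_half :
    HasSingularForm (1 / 2) 0 fun τ => Real.pi * Complex.exp (-(τ / 2)) := by
  refine ⟨fun ω => -∫ x in Ioi (1 / 2 : ℝ), ((x ^ (-(1 / 2) : ℝ) : ℝ) : ℂ) * (1 / (x - ω)),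
    ?_, fun ω hω hs => ?_⟩
  · refine (differentiableOn_integral_of_locally_dominated Metric.isOpen_ball
      (fun ω hω => (continuousOn_tail hω).aestronglyMeasurable measurableSet_Ioi) ?_ ?_).neg
    · filter_upwards [ae_restrict_mem measurableSet_Ioi] with x hx ω hω
      exact ((differentiableAt_const _).mul ((differentiableAt_const _).div (by fun_prop)
        (norm_tail_le hω hx).1)).differentiableWithinAt
    · intro ω₀ _
      refine ⟨1, one_pos, _, integrableOn_rpow_neg_half_tail, ?_⟩
      filter_upwards [ae_restrict_mem measurableSet_Ioi] with x hx ω _ hω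
      exact (norm_tail_le hω hx).2
  · set s := Complex.exp (Complex.log (-ω) / 2) with hsdef
    have hω0 : -ω ≠ 0 := Complex.slitPlane_ne_zero hs
    have hs2 : s ^ 2 = -ω := by
      rw [hsdef, ← Complex.exp_nat_mul]
      push_cast
      rw [mul_div_cancel₀ _ two_ne_zero, Complex.exp_log hω0]
    have hre : 0 < s.re := by
      rw [hsdef, Complex.exp_re]
      refine mul_pos (Real.exp_pos _) (Real.cos_pos_of_mem_Ioo ?_)
      have h1 := Complex.neg_pi_lt_log_im (-ω)
      have h2 : (Complex.log (-ω)).im < Real.pi := by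
        rw [Complex.log_im]
        exact lt_of_le_of_ne (Complex.arg_le_pi _) (Complex.mem_slitPlane_iff_arg.1 hs).1
      have h3 : (Complex.log (-ω) / 2).im = (Complex.log (-ω)).im / 2 := by simp
      rw [h3]
      constructor <;> linarith
    have hb : (1 / 2 : ℝ) - 1 = -(1 / 2) := by norm_num
    have hint1 := integrableOn_cauchyPart (b := 1 / 2) (by norm_num) hs
    rw [hb] at hint1
    have hint2 : IntegrableOn (fun x : ℝ => ((x ^ (-(1 / 2) : ℝ) : ℝ) : ℂ) * (1 / (x - ω)))
        (Ioi (1 / 2)) := by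
      refine Integrable.mono' integrableOn_rpow_neg_half_tail
        ((continuousOn_tail hω).aestronglyMeasurable measurableSet_Ioi) ?_
      filter_upwards [ae_restrict_mem measurableSet_Ioi] with x hx
      exact (norm_tail_le hω hx).2
    have hunion : Ioc (0 : ℝ) (1 / 2) ∪ Ioi (1 / 2) = Ioi 0 :=
      Ioc_union_Ioi_eq_Ioi (by norm_num)
    have hadd := setIntegral_union (Ioc_disjoint_Ioi le_rfl) measurableSet_Ioi hint1 hint2
    have hint := hint1.union hint2
    rw [hunion] at hadd hint
    have hftc := integral_Ioi_of_hasDerivAt_of_tendsto (a := 0)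
      (f := fun x : ℝ => arctanAux s (√x)) (m := Real.pi / s)
      (ContinuousAt.continuousWithinAt ((hasDerivAt_arctanAux hre _).continuousAt.comp
        (f := fun x : ℝ => √x) Real.continuous_sqrt.continuousAt))
      (fun x hx => by
        have hx0 : (0 : ℝ) < x := hx
        have h := (hasDerivAt_arctanAux hre (√x)).scomp x (Real.hasDerivAt_sqrt hx0.ne')
        have hne : (x : ℂ) - ω ≠ 0 :=
          Complex.slitPlane_ne_zero (ofReal_sub_mem_slitPlane hs hx0.le)
        have hval : (1 / (2 * √x)) • (2 / (s ^ 2 + (√x : ℂ) ^ 2)) =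
            ((x ^ (-(1 / 2) : ℝ) : ℝ) : ℂ) * (1 / (x - ω)) := by
          have h1 : (√x : ℂ) ^ 2 = x := by exact_mod_cast Real.sq_sqrt hx0.le
          have h2 : x ^ (-(1 / 2) : ℝ) = (√x)⁻¹ := by
            rw [Real.rpow_neg hx0.le, ← Real.sqrt_eq_rpow]
          have h3 : (√x : ℂ) ≠ 0 := by exact_mod_cast (Real.sqrt_pos.2 hx0).ne'
          have h4 : -ω + (x : ℂ) ≠ 0 := by rwa [neg_add_eq_sub]
          rw [h1, h2, hs2, Complex.real_smul, neg_add_eq_sub]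
          push_cast
          field_simp
        rw [hval] at h
        exact h) hint ((tendsto_arctanAux hre).comp Real.tendsto_sqrt_atTop)
    have h0 : arctanAux s (√0) = 0 := by simp [arctanAux]
    have hexp : Complex.exp (-(Complex.log (-ω) / 2)) = s⁻¹ := by rw [hsdef, Complex.exp_neg]
    rw [h0, sub_zero] at hftc
    beta_reduce
    rw [hexp, pow_zero, one_mul, ← div_eq_mul_inv, ← hftc, hadd, cauchyPart, hb]
    ring

/-- An entire function `E` such that `E (log (-ω))` has a mild but genuine branch point at
`ω = 0`: it is unbounded, `o(1 / ω)` in sectors, and jumps by a nonzero real or imaginary number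
over the negative axis. -/
structure IsBranchFun (E : ℂ → ℂ) : Prop where
  diff : Differentiable ℂ E
  large : ∀ R : ℝ, ∃ δ > 0, ∀ τ : ℂ, Real.exp (τ.re / 2) < δ → R ≤ ‖E τ‖
  small : ∀ K ε : ℝ, 0 ≤ K → 0 < ε → ∃ δ > 0, ∀ τ : ℂ, Real.exp (τ.re / 2) < δ → |τ.im| ≤ K →
    Real.exp τ.re * ‖E τ‖ ≤ ε
  jump : ∀ x σ : ℝ, (σ = 1 ∨ σ = -1) → E (x + 2 * Real.pi * Complex.I * σ) - E x ≠ 0 ∧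
    ((E (x + 2 * Real.pi * Complex.I * σ) - E x).re = 0 ∨
      (E (x + 2 * Real.pi * Complex.I * σ) - E x).im = 0)

lemma isBranchFun_neg : IsBranchFun fun τ => -τ where
  diff := differentiable_id.neg
  large R := by
    refine ⟨Real.exp (-R / 2), Real.exp_pos _, fun τ hτ => ?_⟩
    rw [Real.exp_lt_exp] at hτ
    rw [norm_neg]
    have := Complex.abs_re_le_norm τ
    have := neg_abs_le τ.re
    linarith
  small K ε hK hε := by
    -- With `y = exp (Re τ / 2) < 1` one has `y (-Re τ) ≤ 2`, hence `e^{Re τ} |τ| ≤ y (2 + K)`.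
    refine ⟨min 1 (ε / (2 + K)), by positivity, fun τ hτ him => ?_⟩
    obtain ⟨h1, h2⟩ := lt_min_iff.1 hτ
    set y := Real.exp (τ.re / 2) with hy
    have hy0 : 0 < y := Real.exp_pos _
    have hre : τ.re < 0 := by
      have := Real.exp_lt_one_iff.1 h1
      linarith
    have hsq : Real.exp τ.re = y * y := by rw [hy, ← Real.exp_add]; congr 1; ring
    have hx : y * (-τ.re) ≤ 2 := by
      have h3 : -τ.re / 2 ≤ Real.exp (-τ.re / 2) := by
        have := Real.add_one_le_exp (-τ.re / 2); linarith
      have h4 : y * Real.exp (-τ.re / 2) = 1 := by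
        rw [hy, ← Real.exp_add, show τ.re / 2 + -τ.re / 2 = 0 by ring, Real.exp_zero]
      nlinarith
    have hn : ‖-τ‖ ≤ -τ.re + K := by
      rw [norm_neg]
      refine (Complex.norm_le_abs_re_add_abs_im τ).trans ?_
      rw [abs_of_neg hre]
      linarith
    rw [lt_div_iff₀ (by positivity)] at h2
    rw [hsq]
    calc y * y * ‖-τ‖ ≤ y * y * (-τ.re + K) := mul_le_mul_of_nonneg_left hn (by positivity)
      _ = y * (y * (-τ.re) + y * K) := by ring
      _ ≤ y * (2 + 1 * K) := by
        refine mul_le_mul_of_nonneg_left (add_le_add hx ?_) hy0.le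
        exact mul_le_mul_of_nonneg_right h1.le hK
      _ ≤ ε := by linarith
  jump x σ hσ := by
    have h : -((x : ℂ) + 2 * Real.pi * Complex.I * σ) - -(x : ℂ) =
        ((-(2 * Real.pi * σ) : ℝ) : ℂ) * Complex.I := by push_cast; ring
    have hσ0 : σ ≠ 0 := by rcases hσ with rfl | rfl <;> norm_num
    rw [h]
    refine ⟨mul_ne_zero ?_ Complex.I_ne_zero, Or.inl (by simp)⟩
    exact_mod_cast neg_ne_zero.2 (mul_ne_zero (by positivity) hσ0)

lemma norm_pi_mul_exp_neg_half (τ : ℂ) :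
    ‖Real.pi * Complex.exp (-(τ / 2))‖ = Real.pi * Real.exp (-(τ.re / 2)) := by
  rw [norm_mul, Complex.norm_real, Real.norm_of_nonneg Real.pi_pos.le, Complex.norm_exp]
  simp

lemma isBranchFun_exp : IsBranchFun fun τ => Real.pi * Complex.exp (-(τ / 2)) where
  diff := by fun_prop
  large R := by
    refine ⟨1 / (|R| + 1), by positivity, fun τ hτ => ?_⟩
    rw [norm_pi_mul_exp_neg_half, Real.exp_neg]
    have h0 := Real.exp_pos (τ.re / 2)
    have h1 : |R| + 1 ≤ (Real.exp (τ.re / 2))⁻¹ := by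
      rw [le_inv_comm₀ (by positivity) h0, ← one_div]; exact hτ.le
    have h2 := Real.pi_gt_three
    have h3 := le_abs_self R
    have h4 := abs_nonneg R
    nlinarith
  small K ε hK hε := by
    refine ⟨ε / Real.pi, by positivity, fun τ hτ _ => ?_⟩
    rw [norm_pi_mul_exp_neg_half]
    rw [lt_div_iff₀ Real.pi_pos] at hτ
    have : Real.exp τ.re * (Real.pi * Real.exp (-(τ.re / 2))) = Real.exp (τ.re / 2) * Real.pi := by
      rw [mul_left_comm, ← Real.exp_add, mul_comm]; congr 2; ring
    rw [this]
    exact hτ.le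
  jump x σ hσ := by
    -- A shift of `τ` by `2 π i σ` changes the sign of `exp (-τ / 2)`, so the jump is real and equal
    -- to `-2 π e^{-x / 2}`.
    have h1 : Complex.exp (-(((x : ℂ) + 2 * Real.pi * Complex.I * σ) / 2)) =
        -Complex.exp (-((x : ℂ) / 2)) := by
      have h2 : -(((x : ℂ) + 2 * Real.pi * Complex.I * σ) / 2) =
          -((x : ℂ) / 2) + -(σ * (Real.pi * Complex.I)) := by ring
      rw [h2, Complex.exp_add]
      rcases hσ with rfl | rfl
      · simp [Complex.exp_neg, Complex.exp_pi_mul_I]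
      · simp [Complex.exp_pi_mul_I]
    have h : Real.pi * Complex.exp (-(((x : ℂ) + 2 * Real.pi * Complex.I * σ) / 2)) -
        Real.pi * Complex.exp (-((x : ℂ) / 2)) =
        ((-(2 * Real.pi * Real.exp (-(x / 2))) : ℝ) : ℂ) := by
      rw [h1]; push_cast; ring
    rw [h]
    refine ⟨?_, Or.inr (Complex.ofReal_im _)⟩
    have := Real.exp_pos (-(x / 2))
    exact_mod_cast neg_ne_zero.2 (by positivity)

lemma exists_hasSingularForm {n : ℕ} (hn : 0 < n) :
    ∃ j E, IsBranchFun E ∧ HasSingularForm (n / 2 : ℝ) j E := by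
  obtain ⟨i, hi | hi⟩ := n.even_or_odd'
  · refine ⟨i - 1, _, isBranchFun_neg, ?_⟩
    have h := hasSingularForm_one.add_natCast one_pos (i - 1)
    have h1 : 1 ≤ i := by omega
    convert! h using 1
    rw [hi]
    push_cast [h1]
    ring
  · refine ⟨i, _, isBranchFun_exp, ?_⟩
    have h := hasSingularForm_half.add_natCast (by norm_num) i
    convert! h using 1
    rw [hi]
    push_cast
    ring

/-! ### The local form of the pair of transforms. -/

/-- Local description near `w = 1` of a pair of functions `F`, `L` on the slit plane, in the
coordinate `ω = log w`, with a common singular part. -/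
structure IsLocalPair (F L A B g : ℂ → ℂ) (j : ℕ) (E : ℂ → ℂ) : Prop where
  branch : IsBranchFun E
  diffA : DifferentiableOn ℂ A (Metric.ball 0 (1 / 4))
  diffB : DifferentiableOn ℂ B (Metric.ball 0 (1 / 4))
  diffg : DifferentiableOn ℂ g (Metric.ball 0 (1 / 4))
  real_pos : ∀ x : ℝ, -1 < x → (g x).im = 0 ∧ 0 < (g x).re
  eqF : ∀ ω ∈ Metric.ball (0 : ℂ) (1 / 4), -ω ∈ Complex.slitPlane →
    F (Complex.exp ω) = A ω + ω ^ j * g ω * E (Complex.log (-ω))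
  eqL : ∀ ω ∈ Metric.ball (0 : ℂ) (1 / 4), -ω ∈ Complex.slitPlane →
    L (Complex.exp ω) = B ω - ω * (ω ^ j * g ω * E (Complex.log (-ω)))
  one_le : ∀ x : ℝ, 0 ≤ x → x < 1 → (F x).im = 0 ∧ 1 ≤ (F x).re
  nonpos : ∀ x : ℝ, 0 ≤ x → x < 1 → (L x).im = 0 ∧ (L x).re ≤ 0

/-- The second density is `-x` times the first. Its holomorphic factor is `-x g x`, taken at `ω` in
the singular part; so the two singular parts differ exactly by the factor `-ω`. -/
lemma IsKernel.exists_isLocalPair {b a e : ℝ} {g : ℂ → ℂ} (h : IsKernel b a e g)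
    (h1 : laplace b g 0 = 1) {n : ℕ} (hn : 0 < n) (hb : b = n / 2) :
    ∃ A B j E, IsLocalPair (stieltjes (density b g)) (stieltjes (logDensity b g)) A B g j E := by
  obtain ⟨j, E, hE, K, hK, hform⟩ := exists_hasSingularForm hn
  rw [← hb] at hform
  have hdg : DifferentiableOn ℂ g (Metric.ball 0 (1 / 4)) :=
    h.diff.mono ((Metric.ball_subset_ball (by norm_num)).trans subset_union_left)
  have hdl : DifferentiableOn ℂ (fun x => -x * g x) kernelDomain :=
    differentiableOn_id.neg.mul h.diff
  have hρ : ∀ x : ℝ, 0 < x → (density b g x : ℂ) = ((x ^ (b - 1) : ℝ) : ℂ) * g x := by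
    intro x hx
    rw [density, h.eq_re (show -1 < x by linarith)]
    simp
  refine ⟨fun ω => regularPart b g (density b g) ω + g ω * K ω,
    fun ω => regularPart b (fun x => -x * g x) (logDensity b g) ω + -ω * g ω * K ω, j, E, ?_⟩
  refine ⟨hE, ?_, ?_, hdg, h.real_pos, fun ω hω hs => ?_, fun ω hω hs => ?_,
    fun x h0 hx => ?_, fun x h0 hx => ?_⟩
  · exact (differentiableOn_regularPart h.b_pos h.diff h.integrableOn_density).add (hdg.mul hK)
  · exact (differentiableOn_regularPart h.b_pos hdl h.integrableOn_logDensity).add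
      ((differentiableOn_id.neg.mul hdg).mul hK)
  · rw [stieltjes_exp_eq h.b_pos h.diff h.integrableOn_density hρ hω hs, hform ω hω hs]
    ring
  · rw [stieltjes_exp_eq (γ := fun x => -x * g x) h.b_pos hdl h.integrableOn_logDensity
      (fun x hx => ?_) hω hs, hform ω hω hs]
    · ring
    · rw [logDensity, Complex.ofReal_mul, hρ x hx]
      push_cast
      ring
  · rw [stieltjes_ofReal]
    exact ⟨Complex.ofReal_im _, h.one_le_stieltjes_density h1 h0 hx⟩
  · rw [stieltjes_ofReal]
    exact ⟨Complex.ofReal_im _, h.stieltjes_logDensity_nonpos hx⟩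

lemma norm_eq_exp_re {ω τ : ℂ} (h : Complex.exp τ = -ω) : ‖ω‖ = Real.exp τ.re := by
  rw [← norm_neg, ← h, Complex.norm_exp]

lemma eventually_exp_half_lt {δ : ℝ} (hδ : 0 < δ) :
    ∀ᶠ ω : ℂ in 𝓝 0, ∀ τ, Complex.exp τ = -ω → Real.exp (τ.re / 2) < δ := by
  have : ∀ᶠ ω : ℂ in 𝓝 0, ‖ω‖ < δ ^ 2 := by
    have := Metric.ball_mem_nhds (0 : ℂ) (show 0 < δ ^ 2 by positivity)
    filter_upwards [this] with ω hω
    simpa using hω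
  filter_upwards [this] with ω hω τ hτ
  rw [norm_eq_exp_re hτ] at hω
  refine lt_of_pow_lt_pow_left₀ 2 hδ.le ?_
  rw [← Real.exp_nat_mul]
  convert! hω using 2
  push_cast
  ring

namespace IsLocalPair

variable {F L A B g E : ℂ → ℂ} {j : ℕ}

lemma continuousAt_of_ball {f : ℂ → ℂ} (hf : DifferentiableOn ℂ f (Metric.ball 0 (1 / 4))) :
    ContinuousAt f 0 :=
  (hf.differentiableAt (Metric.ball_mem_nhds _ (by norm_num))).continuousAt

lemma eventually_small (h : IsLocalPair F L A B g j E) (hj : j ≠ 0) {K : ℝ} (hK : 0 ≤ K) :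
    ∀ᶠ ω : ℂ in 𝓝 0, ∀ τ, Complex.exp τ = -ω → |τ.im| ≤ K → ‖ω ^ j * g ω * E τ‖ ≤ 1 / 4 := by
  obtain ⟨i, rfl⟩ := Nat.exists_eq_succ_of_ne_zero hj
  obtain ⟨δ, hδ, hsmall⟩ := h.branch.small K (1 / (4 * (‖g 0‖ + 1))) hK (by positivity)
  have hg : ∀ᶠ ω in 𝓝 (0 : ℂ), ‖g ω‖ < ‖g 0‖ + 1 :=
    (continuousAt_of_ball h.diffg).norm.eventually_lt_const (by linarith)
  filter_upwards [eventually_exp_half_lt hδ, hg, Metric.ball_mem_nhds (0 : ℂ) one_pos]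
    with ω h1 h2 h3 τ hτ him
  have h4 := hsmall τ (h1 τ hτ) him
  rw [← norm_eq_exp_re hτ] at h4
  have h5 : ‖ω‖ ^ i ≤ 1 := pow_le_one₀ (norm_nonneg _) (mem_ball_zero_iff.1 h3).le
  rw [norm_mul, norm_mul, norm_pow, pow_succ]
  calc ‖ω‖ ^ i * ‖ω‖ * ‖g ω‖ * ‖E τ‖ = ‖ω‖ ^ i * (‖g ω‖ * (‖ω‖ * ‖E τ‖)) := by ring
    _ ≤ 1 * ((‖g 0‖ + 1) * (1 / (4 * (‖g 0‖ + 1)))) := by gcongr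
    _ = 1 / 4 := by field_simp

/-- As `w` increases to `1` the value of `F` is at least `1` in modulus and, for `j ≠ 0`, the
singular part is at most `1/4`; hence `A` cannot be small at `0`. -/
lemma half_le_norm (h : IsLocalPair F L A B g j E) (hj : j ≠ 0) : 1 / 2 ≤ ‖A 0‖ := by
  have hev : ∀ᶠ x : ℝ in 𝓝[<] 0, 1 / 2 ≤ ‖A x‖ := by
    have hc : Tendsto (fun x : ℝ => (x : ℂ)) (𝓝[<] 0) (𝓝 0) :=
      (Complex.continuous_ofReal.tendsto' 0 0 rfl).mono_left nhdsWithin_le_nhds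
    filter_upwards [hc.eventually (h.eventually_small hj le_rfl),
      hc.eventually (Metric.ball_mem_nhds (0 : ℂ) (show (0 : ℝ) < 1 / 4 by norm_num)),
      self_mem_nhdsWithin] with x h1 h2 hx
    have hx : x < 0 := hx
    have hs : -(x : ℂ) ∈ Complex.slitPlane := Or.inl (by simpa using hx)
    have h3 := h1 (Complex.log (-x)) (Complex.exp_log (Complex.slitPlane_ne_zero hs)) (by
      rw [← Complex.ofReal_neg, ← Complex.ofReal_log (by linarith)]; simp)
    have h4 := h.eqF x h2 hs
    have h5 := h.one_le (Real.exp x) (Real.exp_pos x).le (Real.exp_lt_one_iff.2 hx)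
    have h6 := (h5.2.trans (Complex.re_le_norm _))
    rw [Complex.ofReal_exp, h4] at h6
    have h7 := h6.trans (norm_add_le _ _)
    linarith
  have hc : Tendsto (fun x : ℝ => ‖A x‖) (𝓝[<] 0) (𝓝 ‖A 0‖) :=
    ((continuousAt_of_ball h.diffA).norm.tendsto.comp
      (Complex.continuous_ofReal.tendsto' 0 0 rfl)).mono_left nhdsWithin_le_nhds
  exact ge_of_tendsto hc hev

/-- For `j = 0` the singular part is unbounded, because `g 0 ≠ 0`, and dominates `A`; for `j ≠ 0` it
is small and `A 0` dominates. As `τ` ranges over all logarithms of `-ω` of bounded imaginary part,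
the denominator stays nonzero on every branch met during a turn. -/
lemma eventually_ne_zero (h : IsLocalPair F L A B g j E) {K : ℝ} (hK : 0 ≤ K) :
    ∀ᶠ ω : ℂ in 𝓝 0, ∀ τ, Complex.exp τ = -ω → |τ.im| ≤ K → A ω + ω ^ j * g ω * E τ ≠ 0 := by
  rcases eq_or_ne j 0 with rfl | hj
  · have hg0 : 0 < ‖g 0‖ := by
      have := h.real_pos 0 (by norm_num)
      rw [norm_pos_iff]
      intro h0
      simp [h0] at this
    obtain ⟨δ, hδ, hlarge⟩ := h.branch.large ((‖A 0‖ + 2) / (‖g 0‖ / 2))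
    have hA : ∀ᶠ ω in 𝓝 (0 : ℂ), ‖A ω‖ < ‖A 0‖ + 1 :=
      (continuousAt_of_ball h.diffA).norm.eventually_lt_const (by linarith)
    have hg : ∀ᶠ ω in 𝓝 (0 : ℂ), ‖g 0‖ / 2 < ‖g ω‖ :=
      (continuousAt_of_ball h.diffg).norm.eventually_const_lt (by linarith)
    filter_upwards [hA, hg, eventually_exp_half_lt hδ] with ω h1 h2 h3 τ hτ _ h0
    have h4 := hlarge τ (h3 τ hτ)
    rw [div_le_iff₀ (by positivity)] at h4
    have h5 : ‖A ω‖ = ‖g ω‖ * ‖E τ‖ := by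
      rw [eq_neg_of_add_eq_zero_left h0, norm_neg]; simp
    have h6 : ‖E τ‖ * (‖g 0‖ / 2) ≤ ‖g ω‖ * ‖E τ‖ := by
      rw [mul_comm]; exact mul_le_mul_of_nonneg_right h2.le (norm_nonneg _)
    linarith
  · have hA : ∀ᶠ ω in 𝓝 (0 : ℂ), 1 / 4 < ‖A ω‖ :=
      (continuousAt_of_ball h.diffA).norm.eventually_const_lt
        (lt_of_lt_of_le (by norm_num) (h.half_le_norm hj))
    filter_upwards [hA, h.eventually_small hj hK] with ω h1 h2 τ hτ him h0
    have h3 := h2 τ hτ him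
    rw [eq_neg_of_add_eq_zero_left h0, norm_neg] at h1
    linarith

end IsLocalPair

/-! ### Monodromy around `w = 1`. -/

/-- The holomorphic function `log w / (w - 1)` near `w = 1`. -/
def logFactor : ℂ → ℂ := dslope Complex.log 1

lemma logFactor_one : logFactor 1 = 1 := by
  rw [logFactor, dslope_same, (Complex.hasDerivAt_log (by simp)).deriv, inv_one]

lemma mul_logFactor (w : ℂ) : (1 - w) * logFactor w = -Complex.log w := by
  have := sub_smul_dslope Complex.log 1 w
  rw [Complex.log_one, sub_zero, smul_eq_mul] at this
  rw [logFactor, ← this]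
  ring

lemma differentiableOn_logFactor : DifferentiableOn ℂ logFactor Complex.slitPlane := by
  rw [logFactor, Complex.differentiableOn_dslope
    (Complex.isOpen_slitPlane.mem_nhds Complex.one_mem_slitPlane)]
  exact differentiableOn_id.clog fun w hw => hw

lemma analyticAt_logFactor {w : ℂ} (hw : w ∈ Complex.slitPlane) : AnalyticAt ℂ logFactor w :=
  differentiableOn_logFactor.analyticAt (Complex.isOpen_slitPlane.mem_nhds hw)

lemma neg_log_mem_slitPlane {w : ℂ} (hw : w ∈ Complex.slitPlane) (h1 : 1 - w ∈ Complex.slitPlane) :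
    -Complex.log w ∈ Complex.slitPlane := by
  rcases eq_or_ne w.im 0 with him | him
  · left
    have h2 : 0 < w.re := (Complex.mem_slitPlane_iff.1 hw).resolve_right (by simpa using him)
    have h3 : w.re < 1 := by
      have := (Complex.mem_slitPlane_iff.1 h1).resolve_right (by simpa using him)
      simpa using this
    have hw' : w = (w.re : ℂ) := Complex.ext rfl (by simpa using him)
    rw [hw', ← Complex.ofReal_log h2.le]
    simpa using Real.log_neg h2 h3
  · right
    have : w.arg ≠ 0 := fun h => him (Complex.arg_eq_zero_iff.1 h).2
    simpa [Complex.log_im] using this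

/-- The identity `-log w = (1 - w) * logFactor w` holds between the exponentials, so the two sides
differ by `2 π i n`. The arguments of `-log w` and `1 - w` lie in the same half plane and differ by
less than `π`, while that of `logFactor w` is below `π / 2`; hence `n = 0`. This passes from `log
(-ω)` to `log (1 - w)`. -/
lemma log_neg_log {w : ℂ} (hw : w ∈ Complex.slitPlane) (h1 : 1 - w ∈ Complex.slitPlane)
    (hre : 0 < (logFactor w).re) :
    Complex.log (-Complex.log w) = Complex.log (1 - w) + Complex.log (logFactor w) := by
  have hs := neg_log_mem_slitPlane hw h1
  have hf : logFactor w ≠ 0 := fun h => by simp [h] at hre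
  have hexp : Complex.exp (Complex.log (-Complex.log w)) =
      Complex.exp (Complex.log (1 - w) + Complex.log (logFactor w)) := by
    rw [Complex.exp_add, Complex.exp_log (Complex.slitPlane_ne_zero hs),
      Complex.exp_log (Complex.slitPlane_ne_zero h1), Complex.exp_log hf, mul_logFactor]
  obtain ⟨n, hn⟩ := Complex.exp_eq_exp_iff_exists_int.1 hexp
  have him := congrArg Complex.im hn
  have hn2 : ((n : ℂ) * (2 * Real.pi * Complex.I)).im = n * (2 * Real.pi) := by
    rw [← Complex.ofReal_intCast]; simp
  rw [Complex.add_im, Complex.add_im, hn2, Complex.log_im, Complex.log_im, Complex.log_im] at him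
  have harg := abs_lt.1 (Complex.abs_arg_lt_pi_div_two_iff.2 (Or.inl hre))
  have hlim : (Complex.log w).im = w.arg := Complex.log_im w
  have hdiff : |Complex.arg (-Complex.log w) - Complex.arg (1 - w)| < Real.pi := by
    have a1 := Complex.neg_pi_lt_arg (-Complex.log w)
    have a2 := Complex.neg_pi_lt_arg (1 - w)
    have a3 := lt_of_le_of_ne (Complex.arg_le_pi _) (Complex.mem_slitPlane_iff_arg.1 hs).1
    have a4 := lt_of_le_of_ne (Complex.arg_le_pi _) (Complex.mem_slitPlane_iff_arg.1 h1).1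
    rw [abs_lt]
    rcases lt_or_ge 0 w.im with h | h
    · have b1 : 0 < w.arg := by
        refine lt_of_le_of_ne (Complex.arg_nonneg_iff.2 h.le) fun h0 => ?_
        exact h.ne' (Complex.arg_eq_zero_iff.1 h0.symm).2
      have b2 : Complex.arg (-Complex.log w) < 0 := Complex.arg_neg_iff.2 (by simpa [hlim] using b1)
      have b3 : Complex.arg (1 - w) < 0 := Complex.arg_neg_iff.2 (by simpa using h)
      constructor <;> linarith
    · have b1 : w.arg ≤ 0 := by
        rcases h.lt_or_eq with h | h
        · exact (Complex.arg_neg_iff.2 h).le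
        · refine (Complex.arg_eq_zero_iff.2 ⟨?_, h⟩).le
          exact ((Complex.mem_slitPlane_iff.1 hw).resolve_right (by simpa using h)).le
      have b2 : 0 ≤ Complex.arg (-Complex.log w) :=
        Complex.arg_nonneg_iff.2 (by simpa [hlim] using b1)
      have b3 : 0 ≤ Complex.arg (1 - w) := Complex.arg_nonneg_iff.2 (by simpa using h)
      constructor <;> linarith
  rw [abs_lt] at hdiff
  have hpi := Real.pi_pos
  have hn0 : n = 0 := by
    have h2 : (n : ℝ) < 1 := by
      by_contra hcon
      have : (1 : ℝ) ≤ n := not_lt.1 hcon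
      nlinarith
    have h3 : (-1 : ℝ) < n := by
      by_contra hcon
      have : (n : ℝ) ≤ -1 := not_lt.1 hcon
      nlinarith
    have h2' : n < 1 := by exact_mod_cast h2
    have h3' : -1 < n := by exact_mod_cast h3
    omega
  simpa [hn0] using hn

/-- A nonzero real or imaginary jump `κ` of the denominator changes the exponential. -/
lemma exp_div_add_ne {f l ω : ℝ} (hf : 0 < f) (hl : l ≤ 0) (hω : ω < 0) {κ : ℂ} (hκ : κ ≠ 0)
    (hre : κ.re = 0 ∨ κ.im = 0) (h1 : f + κ ≠ 0) :
    Complex.exp ((l - ω * κ) / (f + κ)) ≠ Complex.exp (l / f) := by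
  intro h
  obtain ⟨n, hn⟩ := Complex.exp_eq_exp_iff_exists_int.1 h
  have hf' : (f : ℂ) ≠ 0 := by exact_mod_cast hf.ne'
  have hc : ω * f + l < 0 := by nlinarith
  -- Clearing denominators gives `-κ (ω f + l) = 2 π i n f (f + κ)`, where `ω f + l < 0` is real. If
  -- `κ` is imaginary, the real parts force `n = 0`; if `κ` is real, the left side is real and the
  -- right side imaginary. Either way `κ = 0`.
  have heq : -κ * ((ω * f + l : ℝ) : ℂ) = ((n * (2 * Real.pi) * f : ℝ) : ℂ) * Complex.I * (f + κ) := by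
    rw [div_eq_iff h1] at hn
    have h2 : (l / f : ℂ) * f = l := div_mul_cancel₀ _ hf'
    push_cast
    linear_combination f * hn + (f + κ) * h2
  have hr := congrArg Complex.re heq
  have hi := congrArg Complex.im heq
  simp at hr hi
  have hπ := Real.pi_pos
  rcases hre with h0 | h0
  · have hκi : κ.im ≠ 0 := fun h => hκ (Complex.ext h0 h)
    rw [h0] at hr hi
    have hn0 : (n : ℝ) = 0 := by
      by_contra hn0
      have h3 : (n : ℝ) * (2 * Real.pi) * f * κ.im ≠ 0 := by positivity
      apply h3
      linarith
    rw [hn0] at hi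
    have : κ.im * (ω * f + l) = 0 := by linarith
    exact mul_ne_zero hκi hc.ne this
  · have hκr : κ.re ≠ 0 := fun h => hκ (Complex.ext h h0)
    rw [h0] at hr
    have : κ.re * (ω * f + l) = 0 := by linarith
    exact mul_ne_zero hκr hc.ne this

lemma eventuallyEq_log_of_exp {f X : ℂ → ℂ} {w₀ : ℂ} (hf : ContinuousAt f w₀)
    (him : |(f w₀).im| < Real.pi) (hexp : ∀ᶠ w in 𝓝 w₀, Complex.exp (f w) = X w) :
    (fun w => Complex.log (X w)) =ᶠ[𝓝 w₀] f := by
  have h1 : ∀ᶠ w in 𝓝 w₀, |(f w).im| < Real.pi :=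
    (Complex.continuous_im.continuousAt.comp hf).abs.eventually_lt_const him
  filter_upwards [h1, hexp] with w h2 h3
  rw [abs_lt] at h2
  rw [← h3, Complex.log_exp h2.1 h2.2.le]

namespace IsLocalPair

variable {F L A B g E : ℂ → ℂ} {j : ℕ}

/-- The branch of `w * exp (L w / F w)` near `w = 1` on which `log (1 - w)` takes the value `u`. -/
def branchVal (A B g E : ℂ → ℂ) (j : ℕ) (u w : ℂ) : ℂ :=
  w * Complex.exp
    ((B (Complex.log w) - Complex.log w * (Complex.log w ^ j * g (Complex.log w) *
        E (u + Complex.log (logFactor w)))) /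
      (A (Complex.log w) + Complex.log w ^ j * g (Complex.log w) *
        E (u + Complex.log (logFactor w))))

lemma exists_radius (h : IsLocalPair F L A B g j E) : ∃ r > 0, r ≤ 1 ∧ ∀ w : ℂ, ‖w - 1‖ < r →
    w ∈ Complex.slitPlane ∧ Complex.log w ∈ Metric.ball (0 : ℂ) (1 / 4) ∧ 0 < (logFactor w).re ∧
    ∀ τ, Complex.exp τ = -Complex.log w → |τ.im| ≤ 4 * Real.pi →
      A (Complex.log w) + Complex.log w ^ j * g (Complex.log w) * E τ ≠ 0 := by
  have hlog : Tendsto Complex.log (𝓝 1) (𝓝 0) := by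
    simpa using (continuousAt_clog Complex.one_mem_slitPlane).tendsto
  have h1 := Complex.isOpen_slitPlane.mem_nhds Complex.one_mem_slitPlane
  have h2 := hlog.eventually (Metric.ball_mem_nhds (0 : ℂ) (show (0 : ℝ) < 1 / 4 by norm_num))
  have h3 : ∀ᶠ w in 𝓝 (1 : ℂ), 0 < (logFactor w).re := by
    have hc := (analyticAt_logFactor Complex.one_mem_slitPlane).continuousAt
    refine (Complex.continuous_re.continuousAt.comp hc).eventually_const_lt ?_
    simp [logFactor_one]
  -- The bound `4 π` is made of at most `π` for the argument of `1 - w`, `2 π` for the turn, and `π`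
  -- for the argument of `logFactor w`.
  have h4 := hlog.eventually (h.eventually_ne_zero (K := 4 * Real.pi) (by positivity))
  obtain ⟨r, hr, hball⟩ := Metric.eventually_nhds_iff.1 ((eventually_iff.2 h1).and
    (h2.and (h3.and h4)))
  refine ⟨min r 1, by positivity, min_le_right _ _, fun w hw => ?_⟩
  exact hball (by rw [dist_eq_norm]; exact hw.trans_le (min_le_left _ _))

lemma analyticAt_branchVal (h : IsLocalPair F L A B g j E) {u : ℂ → ℂ} {w : ℂ}
    (hu : AnalyticAt ℂ u w) (hw : w ∈ Complex.slitPlane)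
    (hl : Complex.log w ∈ Metric.ball (0 : ℂ) (1 / 4)) (hf : 0 < (logFactor w).re)
    (hne : A (Complex.log w) + Complex.log w ^ j * g (Complex.log w) *
        E (u w + Complex.log (logFactor w)) ≠ 0) :
    AnalyticAt ℂ (fun w => branchVal A B g E j (u w) w) w := by
  have hlog : AnalyticAt ℂ Complex.log w := analyticAt_clog hw
  have hball := Metric.isOpen_ball.mem_nhds hl
  have hA : AnalyticAt ℂ (fun w => A (Complex.log w)) w := (h.diffA.analyticAt hball).fun_comp hlog
  have hB : AnalyticAt ℂ (fun w => B (Complex.log w)) w := (h.diffB.analyticAt hball).fun_comp hlog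
  have hg : AnalyticAt ℂ (fun w => g (Complex.log w)) w := (h.diffg.analyticAt hball).fun_comp hlog
  have hfac : AnalyticAt ℂ (fun w => Complex.log (logFactor w)) w :=
    (analyticAt_logFactor hw).clog (Or.inl hf)
  have hE : AnalyticAt ℂ (fun w => E (u w + Complex.log (logFactor w))) w :=
    (h.branch.diff.analyticAt _).fun_comp (hu.add hfac)
  have hsing := ((hlog.pow j).mul hg).mul hE
  exact analyticAt_id.mul (((hB.sub (hlog.mul hsing)).div (hA.add hsing) hne).cexp')

lemma eq_branchVal (h : IsLocalPair F L A B g j E) {w : ℂ} (hw : w ∈ Complex.slitPlane)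
    (hl : Complex.log w ∈ Metric.ball (0 : ℂ) (1 / 4)) (hf : 0 < (logFactor w).re)
    (h1 : 1 - w ∈ Complex.slitPlane) :
    w * Complex.exp (L w / F w) = branchVal A B g E j (Complex.log (1 - w)) w := by
  have hs := neg_log_mem_slitPlane hw h1
  have hF := h.eqF _ hl hs
  have hL := h.eqL _ hl hs
  rw [Complex.exp_log (Complex.slitPlane_ne_zero hw), log_neg_log hw h1 hf] at hF hL
  rw [branchVal, hF, hL]

lemma exp_lift {u w : ℂ} (hu : Complex.exp u = 1 - w) (hf : 0 < (logFactor w).re) :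
    Complex.exp (u + Complex.log (logFactor w)) = -Complex.log w := by
  rw [Complex.exp_add, hu, Complex.exp_log (fun h0 => by simp [h0] at hf), mul_logFactor]

lemma abs_im_lift_le {u w : ℂ} (hu : |u.im| ≤ 3 * Real.pi) :
    |(u + Complex.log (logFactor w)).im| ≤ 4 * Real.pi := by
  rw [Complex.add_im, Complex.log_im]
  have := Complex.abs_arg_le_pi (logFactor w)
  exact (abs_add_le _ _).trans (by linarith)

lemma isPreconnected_slitBall (r : ℝ) (hr : 0 < r) :
    IsPreconnected {w : ℂ | ‖w - 1‖ < r ∧ 1 - w ∈ Complex.slitPlane} := by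
  have hmem : ((r / 2 : ℝ) : ℂ) ∈ Metric.ball (0 : ℂ) r := by
    rw [mem_ball_zero_iff, Complex.norm_real, Real.norm_of_nonneg (by positivity)]
    linarith
  have hstar : StarConvex ℝ ((r / 2 : ℝ) : ℂ) (Metric.ball (0 : ℂ) r ∩ Complex.slitPlane) :=
    ((convex_ball (0 : ℂ) r).starConvex hmem).inter
      (Complex.starConvex_ofReal_slitPlane (by positivity))
  have himg := (hstar.isPathConnected
    ⟨hmem, Complex.ofReal_mem_slitPlane.2 (by positivity)⟩).isConnected.isPreconnected.image
    (fun u : ℂ => 1 - u) (by fun_prop)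
  convert! himg using 1
  ext w
  constructor
  · rintro ⟨h1, h2⟩
    exact ⟨1 - w, ⟨by rwa [mem_ball_zero_iff, norm_sub_rev], h2⟩, by ring⟩
  · rintro ⟨u, ⟨h1, h2⟩, rfl⟩
    exact ⟨by simpa using h1, by simpa using h2⟩

/-- Continuation once around `w = 1` changes every germ of `w * exp (L w / F w)`. -/
lemma not_eventuallyEq (h : IsLocalPair F L A B g j E) {r : ℝ} (hr : 0 < r) (hr1 : r ≤ 1)
    (hball : ∀ w : ℂ, ‖w - 1‖ < r →
      w ∈ Complex.slitPlane ∧ Complex.log w ∈ Metric.ball (0 : ℂ) (1 / 4) ∧ 0 < (logFactor w).re ∧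
      ∀ τ, Complex.exp τ = -Complex.log w → |τ.im| ≤ 4 * Real.pi →
        A (Complex.log w) + Complex.log w ^ j * g (Complex.log w) * E τ ≠ 0)
    {p : ℂ} (hp : ‖p - 1‖ < r) (hps : 1 - p ∈ Complex.slitPlane) {σ : ℝ} (hσ : σ = 1 ∨ σ = -1) :
    ¬ ((fun w => branchVal A B g E j (Complex.log (1 - w) + 2 * Real.pi * Complex.I * σ) w)
      =ᶠ[𝓝 p] fun w => w * Complex.exp (L w / F w)) := by
  intro heq
  set S : Set ℂ := {w : ℂ | ‖w - 1‖ < r ∧ 1 - w ∈ Complex.slitPlane} with hS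
  have hSo : IsOpen S := by
    have h1 : IsOpen {w : ℂ | ‖w - 1‖ < r} := isOpen_lt (by fun_prop) continuous_const
    exact h1.inter (Complex.isOpen_slitPlane.preimage (by fun_prop))
  have him : ∀ s : ℝ, |s| ≤ 1 → ∀ w : ℂ,
      |(Complex.log (1 - w) + 2 * Real.pi * Complex.I * s).im| ≤ 3 * Real.pi := by
    intro s hs w
    have h1 : (2 * Real.pi * Complex.I * s : ℂ).im = 2 * Real.pi * s := by simp
    rw [Complex.add_im, h1, Complex.log_im]
    have h2 := Complex.abs_arg_le_pi (1 - w)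
    have h3 : |2 * Real.pi * s| ≤ 2 * Real.pi := by
      rw [abs_mul, abs_of_pos (by positivity)]
      exact mul_le_of_le_one_right (by positivity) hs
    exact (abs_add_le _ _).trans (by linarith)
  have hexp : ∀ s : ℝ, (s = 0 ∨ s = 1 ∨ s = -1) → ∀ w ∈ S,
      Complex.exp (Complex.log (1 - w) + 2 * Real.pi * Complex.I * s) = 1 - w := by
    intro s hs w hw
    have h1 : Complex.exp (2 * Real.pi * Complex.I * s) = 1 := by
      rcases hs with rfl | rfl | rfl
      · simp
      · simp
      · simp [Complex.exp_neg, Complex.exp_two_pi_mul_I]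
    rw [Complex.exp_add, h1, mul_one, Complex.exp_log (Complex.slitPlane_ne_zero hw.2)]
  have hne : ∀ s : ℝ, (s = 0 ∨ s = 1 ∨ s = -1) → ∀ w ∈ S,
      A (Complex.log w) + Complex.log w ^ j * g (Complex.log w) *
        E (Complex.log (1 - w) + 2 * Real.pi * Complex.I * s + Complex.log (logFactor w)) ≠ 0 := by
    intro s hs w hw
    obtain ⟨_, _, h3, h4⟩ := hball w hw.1
    refine h4 _ (exp_lift (hexp s hs w hw) h3) (abs_im_lift_le (him s ?_ w))
    rcases hs with rfl | rfl | rfl <;> simp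
  have hana : ∀ s : ℝ, (s = 0 ∨ s = 1 ∨ s = -1) → AnalyticOnNhd ℂ
      (fun w => branchVal A B g E j (Complex.log (1 - w) + 2 * Real.pi * Complex.I * s) w) S := by
    intro s hs w hw
    obtain ⟨h1, h2, h3, _⟩ := hball w hw.1
    have hu : AnalyticAt ℂ
        (fun w => Complex.log (1 - w) + 2 * Real.pi * Complex.I * s) w :=
      ((analyticAt_const.sub analyticAt_id).clog hw.2).add analyticAt_const
    exact h.analyticAt_branchVal hu h1 h2 h3 (hne s hs w hw)
  have heq' : (fun w => branchVal A B g E j (Complex.log (1 - w) + 2 * Real.pi * Complex.I * σ) w)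
      =ᶠ[𝓝 p] fun w => branchVal A B g E j
        (Complex.log (1 - w) + 2 * Real.pi * Complex.I * (0 : ℝ)) w := by
    filter_upwards [heq, hSo.mem_nhds (show p ∈ S from ⟨hp, hps⟩)] with w h1 hw
    obtain ⟨h2, h3, h4, _⟩ := hball w hw.1
    rw [h1, h.eq_branchVal h2 h3 h4 hw.2]
    simp
  -- By the identity theorem an equality of germs at `p` spreads over the slit disc, in particular
  -- to the real point `1 - r / 2`, where the signs of `F` and `L` and the type of the jump are
  -- known.
  have hall := (hana σ (Or.inr hσ)).eqOn_of_preconnected_of_eventuallyEq (hana 0 (Or.inl rfl))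
    (isPreconnected_slitBall r hr) ⟨hp, hps⟩ heq'
  have hx0 : 0 < 1 - r / 2 := by linarith
  have hx1 : 1 - r / 2 < 1 := by linarith
  have hw : ((1 - r / 2 : ℝ) : ℂ) ∈ S := by
    have h1 : ((1 - r / 2 : ℝ) : ℂ) - 1 = ((-(r / 2) : ℝ) : ℂ) := by push_cast; ring
    have h2 : 1 - ((1 - r / 2 : ℝ) : ℂ) = ((r / 2 : ℝ) : ℂ) := by push_cast; ring
    refine ⟨?_, ?_⟩
    · rw [h1, Complex.norm_real, Real.norm_eq_abs, abs_neg, abs_of_pos (by positivity)]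
      linarith
    · rw [h2]; exact Complex.ofReal_mem_slitPlane.2 (by positivity)
  generalize 1 - r / 2 = x at hx0 hx1 hw
  obtain ⟨h2, h3, h4, _⟩ := hball _ hw.1
  have hfin := hall hw
  have hneσ := hne σ (Or.inr hσ) _ hw
  have hs := neg_log_mem_slitPlane h2 hw.2
  have hlog := log_neg_log h2 hw.2 h4
  have hF := h.eqF _ h3 hs
  have hL := h.eqL _ h3 hs
  have hlogx : Complex.log (x : ℂ) = (Real.log x : ℂ) := (Complex.ofReal_log hx0.le).symm
  have hlx := Real.log_neg hx0 hx1
  have hτ : Complex.log (-Complex.log (x : ℂ)) = (Real.log (-Real.log x) : ℂ) := by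
    rw [hlogx, ← Complex.ofReal_neg, ← Complex.ofReal_log (by linarith)]
  have hshift : ∀ s : ℝ, Complex.log (1 - (x : ℂ)) + 2 * Real.pi * Complex.I * s +
      Complex.log (logFactor x) = (Real.log (-Real.log x) : ℂ) + 2 * Real.pi * Complex.I * s := by
    intro s
    rw [← hτ, hlog]
    ring
  have hxne : (x : ℂ) ≠ 0 := by exact_mod_cast hx0.ne'
  simp only [branchVal, hshift] at hfin
  rw [hshift] at hneσ
  replace hfin := mul_left_cancel₀ hxne hfin
  rw [Complex.exp_log hxne, hτ] at hF hL
  have hlnorm : -1 < Real.log x := by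
    have : |Real.log x| < 1 / 4 := by
      rw [hlogx, mem_ball_zero_iff, Complex.norm_real] at h3
      exact h3
    have := (abs_lt.1 this).1
    linarith
  obtain ⟨hgi, hgr⟩ := h.real_pos _ hlnorm
  obtain ⟨hFi, hFr⟩ := h.one_le x hx0.le hx1
  obtain ⟨hLi, hLr⟩ := h.nonpos x hx0.le hx1
  obtain ⟨hJ0, hJ⟩ := h.branch.jump (Real.log (-Real.log x)) σ hσ
  set τ : ℝ := Real.log (-Real.log x)
  have hgre : g (Real.log x) = ((g (Real.log x)).re : ℂ) := Complex.ext rfl (by simpa using hgi)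
  have hc0 : Real.log x ^ j * (g (Real.log x)).re ≠ 0 :=
    mul_ne_zero (pow_ne_zero _ hlx.ne) hgr.ne'
  have hcoef : Complex.log (x : ℂ) ^ j * g (Complex.log x) =
      ((Real.log x ^ j * (g (Real.log x)).re : ℝ) : ℂ) := by
    rw [hlogx, hgre]; push_cast; simp
  rw [hcoef] at hfin hF hL hneσ
  generalize Real.log x ^ j * (g (Real.log x)).re = c at hc0 hfin hF hL hneσ
  -- The continued branch differs from the original one by `c D` in the denominator and `-log x · c
  -- D` in the numerator, with `c` real and nonzero.
  set D : ℂ := E (τ + 2 * Real.pi * Complex.I * σ) - E τ with hD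
  have hEσ : E (τ + 2 * Real.pi * Complex.I * σ) = E τ + D := by rw [hD]; ring
  have hE0 : E (τ + 2 * Real.pi * Complex.I * (0 : ℝ)) = E τ := by simp
  have hFx : F x = ((F x).re : ℂ) := Complex.ext rfl (by simpa using hFi)
  have hLx : L x = ((L x).re : ℂ) := Complex.ext rfl (by simpa using hLi)
  rw [hEσ] at hneσ
  rw [hEσ, hE0, ← hF, ← hL, hFx, hLx] at hfin
  have e1 : A (Complex.log x) + c * (E τ + D) = (F x).re + c * D := by rw [← hFx, hF]; ring
  have e2 : B (Complex.log x) - Complex.log x * (c * (E τ + D)) =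
      (L x).re - Real.log x * (c * D) := by rw [← hLx, hL, hlogx]; ring
  rw [e1] at hneσ
  rw [e1, e2] at hfin
  refine exp_div_add_ne (by linarith) hLr hlx
    (mul_ne_zero (by exact_mod_cast hc0) hJ0) ?_ hneσ hfin
  rcases hJ with hJ | hJ
  · left; simp [hJ]
  · right; simp [hJ]

end IsLocalPair

/-! ### Continuation along the circle. -/

lemma accPt_unitSlit : AccPt (1 : ℂ) (𝓟 unitSlit) := by
  rw [accPt_iff_nhds]
  intro U hU
  obtain ⟨ε, hε, hball⟩ := Metric.mem_nhds_iff.1 hU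
  refine ⟨((1 - ε / 2 : ℝ) : ℂ), ⟨hball ?_, ofReal_mem_unitSlit (by linarith)⟩, fun h => ?_⟩
  · rw [Metric.mem_ball, dist_eq_norm]
    have : ((1 - ε / 2 : ℝ) : ℂ) - 1 = ((-(ε / 2) : ℝ) : ℂ) := by push_cast; ring
    rw [this, Complex.norm_real, Real.norm_eq_abs, abs_neg, abs_of_pos (by positivity)]
    linarith
  · have : (1 - ε / 2 : ℝ) = 1 := by exact_mod_cast h
    linarith

/-- The branch of `log (1 - w)` near the point `turn 1 p σ t`, continued from `log (1 - p)`. -/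
def turnLog (p : ℂ) (σ t : ℝ) (w : ℂ) : ℂ :=
  Complex.log ((1 - w) / (1 - p) * Complex.exp (-(2 * Real.pi * Complex.I * σ * t))) +
    Complex.log (1 - p) + 2 * Real.pi * Complex.I * σ * t

section

variable {p : ℂ} {σ t : ℝ}

lemma turn_ratio (hp : 1 - p ≠ 0) : (1 - turn 1 p σ t) / (1 - p) *
    Complex.exp (-(2 * Real.pi * Complex.I * σ * t)) = 1 := by
  have h1 : 1 - turn 1 p σ t = (1 - p) * Complex.exp (2 * Real.pi * Complex.I * σ * t) := by
    rw [turn]; ring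
  rw [h1, mul_div_cancel_left₀ _ hp, ← Complex.exp_add, add_neg_cancel, Complex.exp_zero]

lemma one_sub_turn (p : ℂ) (σ t : ℝ) :
    1 - turn 1 p σ t = (1 - p) * Complex.exp (2 * Real.pi * Complex.I * σ * t) := by
  rw [turn]; ring

lemma norm_turn_sub_one (p : ℂ) (σ t : ℝ) : ‖turn 1 p σ t - 1‖ = ‖p - 1‖ := by
  have : 2 * Real.pi * Complex.I * σ * t = ((2 * Real.pi * σ * t : ℝ) : ℂ) * Complex.I := by
    push_cast; ring
  rw [turn, add_sub_cancel_left, norm_mul, this, Complex.norm_exp_ofReal_mul_I, mul_one]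

lemma analyticAt_turnLog (hp : 1 - p ≠ 0) : AnalyticAt ℂ (turnLog p σ t) (turn 1 p σ t) := by
  have h1 : AnalyticAt ℂ (fun w : ℂ => (1 - w) / (1 - p) *
      Complex.exp (-(2 * Real.pi * Complex.I * σ * t))) (turn 1 p σ t) :=
    (((analyticAt_const.sub analyticAt_id).div analyticAt_const hp).mul analyticAt_const)
  refine ((h1.clog ?_).add analyticAt_const).add analyticAt_const
  rw [turn_ratio hp]
  exact Complex.one_mem_slitPlane

lemma turnLog_turn (hp : 1 - p ≠ 0) :
    turnLog p σ t (turn 1 p σ t) = Complex.log (1 - p) + 2 * Real.pi * Complex.I * σ * t := by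
  rw [turnLog, turn_ratio hp, Complex.log_one, zero_add]

lemma exp_turnLog (hp : 1 - p ≠ 0) {w : ℂ} (hw : 1 - w ≠ 0) :
    Complex.exp (turnLog p σ t w) = 1 - w := by
  rw [turnLog, Complex.exp_add, Complex.exp_add, Complex.exp_log hp,
    Complex.exp_log (mul_ne_zero (div_ne_zero hw hp) (Complex.exp_ne_zero _)), Complex.exp_neg]
  have := Complex.exp_ne_zero (2 * Real.pi * Complex.I * σ * t)
  field_simp

lemma eventually_one_sub_ne {w₀ : ℂ} (h : 1 - w₀ ≠ 0) : ∀ᶠ w in 𝓝 w₀, 1 - w ≠ 0 :=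
  (show ContinuousAt (fun w : ℂ => 1 - w) w₀ by fun_prop).eventually_ne h

/-- Both are logarithms of `1 - w`. For `|s - t| < 1/2` the point has turned by less than `π`
relative to the rotated principal branch, so no multiple of `2 π i` intervenes. -/
lemma turnLog_eventuallyEq (hp : 1 - p ≠ 0) (hσ : |σ| ≤ 1) {s : ℝ} (hst : |s - t| < 1 / 2) :
    turnLog p σ s =ᶠ[𝓝 (turn 1 p σ s)] turnLog p σ t := by
  have hs0 : 1 - turn 1 p σ s ≠ 0 := by
    rw [one_sub_turn]; exact mul_ne_zero hp (Complex.exp_ne_zero _)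
  have h := eventuallyEq_log_of_exp
    (f := fun w => turnLog p σ s w - Complex.log (1 - p) - 2 * Real.pi * Complex.I * σ * t)
    (X := fun w => (1 - w) / (1 - p) * Complex.exp (-(2 * Real.pi * Complex.I * σ * t)))
    (w₀ := turn 1 p σ s)
    (((analyticAt_turnLog hp).continuousAt.sub continuousAt_const).sub continuousAt_const) ?_ ?_
  · filter_upwards [h] with w hw
    rw [turnLog.eq_def p σ t, hw]
    ring
  · have : turnLog p σ s (turn 1 p σ s) - Complex.log (1 - p) - 2 * Real.pi * Complex.I * σ * t =
        ((2 * Real.pi * σ * (s - t) : ℝ) : ℂ) * Complex.I := by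
      rw [turnLog_turn hp]; push_cast; ring
    have him : (((2 * Real.pi * σ * (s - t) : ℝ) : ℂ) * Complex.I).im =
        2 * Real.pi * (σ * (s - t)) := by
      rw [Complex.im_ofReal_mul, Complex.I_im, mul_one, mul_assoc]
    rw [this, him, abs_mul, abs_of_pos (by positivity), abs_mul]
    have h1 : |σ| * |s - t| ≤ 1 * |s - t| := mul_le_mul_of_nonneg_right hσ (abs_nonneg _)
    nlinarith [Real.pi_pos]
  · filter_upwards [eventually_one_sub_ne hs0] with w hw
    rw [Complex.exp_sub, Complex.exp_sub, exp_turnLog hp hw, Complex.exp_log hp, Complex.exp_neg]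
    rfl

lemma turnLog_zero_eventuallyEq (hp : 1 - p ∈ Complex.slitPlane) :
    turnLog p σ 0 =ᶠ[𝓝 p] fun w => Complex.log (1 - w) := by
  have hp0 := Complex.slitPlane_ne_zero hp
  have h0 : turn 1 p σ 0 = p := by simp [turn]
  have hc := (analyticAt_turnLog (σ := σ) (t := 0) hp0).continuousAt
  have hv := turnLog_turn (σ := σ) (t := 0) hp0
  rw [h0] at hc hv
  refine (eventuallyEq_log_of_exp hc ?_ ?_).symm
  · rw [hv]
    simp only [Complex.ofReal_zero, mul_zero, add_zero, Complex.log_im]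
    exact abs_lt.2 ⟨Complex.neg_pi_lt_arg _,
      lt_of_le_of_ne (Complex.arg_le_pi _) (Complex.mem_slitPlane_iff_arg.1 hp).1⟩
  · filter_upwards [eventually_one_sub_ne hp0] with w hw
    exact exp_turnLog hp0 hw

lemma exp_neg_two_pi_mul (hσ : σ = 1 ∨ σ = -1) :
    Complex.exp (-(2 * Real.pi * Complex.I * σ * (1 : ℝ))) = 1 := by
  rcases hσ with rfl | rfl <;> simp [Complex.exp_neg]

lemma turnLog_one (hσ : σ = 1 ∨ σ = -1) (w : ℂ) :
    turnLog p σ 1 w = turnLog p σ 0 w + 2 * Real.pi * Complex.I * σ := by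
  rw [turnLog, turnLog, exp_neg_two_pi_mul hσ]
  simp

end

/-- The function elements along the circle are `branchVal` at the continued logarithm `turnLog`.
They start from the given function, and after a full turn the logarithm has gained `2 π i σ`. -/
lemma IsLocalPair.isBranchPoint {F L A B g E : ℂ → ℂ} {j : ℕ} (h : IsLocalPair F L A B g j E) :
    IsBranchPoint (fun w => w * Complex.exp (L w / F w)) unitSlit 1 := by
  obtain ⟨r, hr, hr1, hball⟩ := h.exists_radius
  refine ⟨accPt_unitSlit, r, hr, fun p hp _ hpr σ hσ => ?_⟩
  have hps : 1 - p ∈ Complex.slitPlane := hp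
  have hp0 := Complex.slitPlane_ne_zero hps
  have hσ1 : |σ| ≤ 1 := by rcases hσ with rfl | rfl <;> simp
  have ht0 : turn 1 p σ 0 = p := by simp [turn]
  have ht1 : turn 1 p σ 1 = p := by
    rw [turn]
    rcases hσ with rfl | rfl <;> simp [Complex.exp_neg]
  refine ⟨fun w => branchVal A B g E j (Complex.log (1 - w) + 2 * Real.pi * Complex.I * σ) w,
    ⟨fun t w => branchVal A B g E j (turnLog p σ t w) w, fun t ht => ?_, fun t ht => ?_, ?_, ?_⟩,
    h.not_eventuallyEq hr hr1 hball hpr hps hσ⟩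
  · obtain ⟨h1, h2, h3, h4⟩ := hball (turn 1 p σ t) (by rwa [norm_turn_sub_one])
    refine h.analyticAt_branchVal (analyticAt_turnLog hp0) h1 h2 h3 (h4 _ (exp_lift ?_ h3)
      (abs_im_lift_le ?_))
    · refine exp_turnLog hp0 ?_
      rw [one_sub_turn]; exact mul_ne_zero hp0 (Complex.exp_ne_zero _)
    · have h5 : (2 * Real.pi * Complex.I * σ * t : ℂ).im = 2 * Real.pi * (σ * t) := by
        simp [mul_assoc]
      rw [turnLog_turn hp0, Complex.add_im, h5, Complex.log_im]
      have h6 := Complex.abs_arg_le_pi (1 - p)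
      have h7 : |2 * Real.pi * (σ * t)| ≤ 2 * Real.pi := by
        rw [abs_mul, abs_of_pos (by positivity), abs_mul, abs_of_nonneg ht.1]
        exact mul_le_of_le_one_right (by positivity) (mul_le_one₀ hσ1 ht.1 ht.2)
      exact (abs_add_le _ _).trans (by linarith)
  · have hev : ∀ᶠ s in 𝓝 t, |s - t| < 1 / 2 := by
      filter_upwards [Metric.ball_mem_nhds t (show (0 : ℝ) < 1 / 2 by norm_num)] with s hs
      simpa [Real.dist_eq] using hs
    filter_upwards [nhdsWithin_le_nhds hev] with s hs
    filter_upwards [turnLog_eventuallyEq hp0 hσ1 hs] with w hw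
    rw [hw]
  · rw [ht0]
    filter_upwards [turnLog_zero_eventuallyEq (σ := σ) hps, isOpen_unitSlit.mem_nhds hp,
      Metric.isOpen_ball.mem_nhds (show p ∈ Metric.ball (1 : ℂ) r by
        rwa [Metric.mem_ball, dist_eq_norm])] with w hw hs hb
    rw [Metric.mem_ball, dist_eq_norm] at hb
    obtain ⟨h1, h2, h3, _⟩ := hball w hb
    rw [hw, h.eq_branchVal h1 h2 h3 hs]
  · rw [ht1]
    filter_upwards [turnLog_zero_eventuallyEq (σ := σ) hps] with w hw
    rw [turnLog_one hσ, hw]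

/-- Branch points are transported by scaling the variable. -/
lemma IsBranchPoint.comp_mul {f : ℂ → ℂ} {U V : Set ℂ} {c : ℂ} (hc : c ≠ 0)
    (hUV : ∀ z, z ∈ V ↔ c * z ∈ U) (h : IsBranchPoint f U 1) :
    IsBranchPoint (fun z => f (c * z)) V (1 / c) := by
  obtain ⟨hacc, r, hr, h⟩ := h
  have hmul : ContinuousAt (fun z : ℂ => c * z) (1 / c) := by fun_prop
  have hcc : c * (1 / c) = 1 := mul_one_div_cancel hc
  refine ⟨?_, r / ‖c‖, by positivity, fun p hp hne hpr σ hσ => ?_⟩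
  · rw [accPt_iff_nhds] at hacc ⊢
    intro W hW
    have hcont : ContinuousAt (fun z : ℂ => z / c) 1 := by fun_prop
    obtain ⟨y, ⟨hy1, hy2⟩, hy⟩ := hacc _ (hcont.preimage_mem_nhds hW)
    refine ⟨y / c, ⟨hy1, (hUV _).2 (by rwa [mul_div_cancel₀ _ hc])⟩, fun h0 => hy ?_⟩
    exact (div_left_inj' hc).1 h0
  · have hturn : ∀ t, c * turn (1 / c) p σ t = turn 1 (c * p) σ t := by
      intro t
      rw [turn, turn]
      field_simp
    have hpc : ‖c * p - 1‖ < r := by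
      rw [lt_div_iff₀ (norm_pos_iff.2 hc)] at hpr
      have : c * p - 1 = (p - 1 / c) * c := by field_simp
      rwa [this, norm_mul]
    obtain ⟨g, ⟨φ, h1, h2, h3, h4⟩, h5⟩ := h (c * p) ((hUV p).1 hp) (fun h0 => hne (by
      rw [← h0, mul_div_cancel_left₀ _ hc])) hpc σ hσ
    have hcomp : ∀ (f₁ f₂ : ℂ → ℂ) (z : ℂ), f₁ =ᶠ[𝓝 (c * z)] f₂ →
        (fun z => f₁ (c * z)) =ᶠ[𝓝 z] fun z => f₂ (c * z) := fun f₁ f₂ z hf =>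
      (show ContinuousAt (fun z : ℂ => c * z) z by fun_prop).eventually hf
    refine ⟨fun z => g (c * z), ⟨fun t z => φ t (c * z), fun t ht => ?_, fun t ht => ?_, ?_, ?_⟩,
      fun heq => h5 ?_⟩
    · refine AnalyticAt.fun_comp (f := fun z => c * z) ?_ (analyticAt_const.mul analyticAt_id)
      rw [hturn]; exact h1 t ht
    · filter_upwards [h2 t ht] with s hs
      refine hcomp _ _ _ ?_
      rwa [hturn]
    · refine hcomp _ _ _ ?_
      rwa [hturn]
    · refine hcomp _ _ _ ?_
      rwa [hturn]
    · have hcont : ContinuousAt (fun w : ℂ => w / c) (c * p) := by fun_prop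
      have hcp : c * p / c = p := mul_div_cancel_left₀ _ hc
      have hev := hcont.eventually (show ∀ᶠ z in 𝓝 (c * p / c), _ by rw [hcp]; exact heq)
      filter_upwards [hev] with w hw
      simpa [mul_div_cancel₀ _ hc] using hw

/-! ### The limit of the harmonic sums is `log C_N`. -/

/-- `log N + ∑_{p ∣ N} log p / (p - 1)`, so that `log C_N = φ(N) * logWeight N`. -/
def logWeight (N : ℕ) : ℝ := Real.log N + ∑ p ∈ N.primeFactors, Real.log p / (p - 1)

lemma logWeight_mul {M N : ℕ} (hM : M ≠ 0) (hN : N ≠ 0) (h : M.Coprime N) :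
    logWeight (M * N) = logWeight M + logWeight N := by
  rw [logWeight, logWeight, logWeight, Nat.cast_mul,
    Real.log_mul (by exact_mod_cast hM) (by exact_mod_cast hN), Nat.primeFactors_mul hM hN,
    Finset.sum_union h.disjoint_primeFactors]
  ring

lemma log_cNum {N : ℕ} (hN : N ≠ 0) : Real.log (cNum N) = N.totient * logWeight N := by
  rw [cNum, Nat.cast_mul, Nat.cast_pow, Nat.cast_prod, Real.log_mul, Real.log_pow,
    Real.log_prod, logWeight, mul_add, Finset.mul_sum]
  · congr 1
    refine Finset.sum_congr rfl fun p hp => ?_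
    have hpp := Nat.prime_of_mem_primeFactors hp
    have hdvd : p - 1 ∣ N.totient := by
      rw [← Nat.totient_prime hpp]
      exact Nat.totient_dvd_of_dvd (Nat.dvd_of_mem_primeFactors hp)
    have h1 : ((p - 1 : ℕ) : ℝ) = p - 1 := by rw [Nat.cast_sub hpp.one_le, Nat.cast_one]
    have h2 : (p : ℝ) - 1 ≠ 0 := by
      have : (1 : ℝ) < p := by exact_mod_cast hpp.one_lt
      linarith
    rw [Nat.cast_pow, Real.log_pow, Nat.cast_div hdvd (by rw [h1]; exact h2), h1]
    field_simp
  · intro p hp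
    have := (Nat.prime_of_mem_primeFactors hp).ne_zero
    positivity
  · positivity
  · refine Finset.prod_ne_zero_iff.2 fun p hp => ?_
    have := (Nat.prime_of_mem_primeFactors hp).ne_zero
    positivity

lemma sum_divisors_mul_of_coprime {M N : ℕ} (h : M.Coprime N) (f : ℕ → ℝ) :
    ∑ d ∈ (M * N).divisors, f d = ∑ a ∈ M.divisors, ∑ b ∈ N.divisors, f (a * b) := by
  rw [Nat.divisors_mul, Finset.mul_def, Finset.sum_image h.mul_injOn_divisors,
    Finset.sum_product]

/-- This is `∑_{d ∣ N} log C_d = N log N`, which determines `log C_N` recursively. Prime powers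
follow by a telescoping induction; for coprime factors `logWeight` is additive and the totient
multiplicative. -/
lemma sum_divisors_totient_mul_logWeight (N : ℕ) :
    ∑ d ∈ N.divisors, (d.totient : ℝ) * logWeight d = N * Real.log N := by
  have htot : ∀ M : ℕ, ∑ d ∈ M.divisors, (d.totient : ℝ) = M := fun M => by
    exact_mod_cast Nat.sum_totient M
  induction N using Nat.recOnPosPrimePosCoprime with
  | zero => simp
  | one => simp [logWeight]
  | prime_pow p n hp hn =>
    rw [Nat.sum_divisors_prime_pow hp]
    clear hn
    have hp1 : (p : ℝ) - 1 ≠ 0 := by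
      have : (1 : ℝ) < p := by exact_mod_cast hp.one_lt
      linarith
    induction n with
    | zero => simp [logWeight]
    | succ n ih =>
      rw [Finset.sum_range_succ, ih, logWeight, Nat.primeFactors_prime_pow n.succ_ne_zero hp,
        Finset.sum_singleton, Nat.totient_prime_pow_succ hp]
      push_cast [hp.one_le]
      rw [Real.log_pow, Real.log_pow]
      push_cast
      field_simp
      ring
  | coprime M N hM hN h ihM ihN =>
    rw [sum_divisors_mul_of_coprime h]
    have hterm : ∀ a ∈ M.divisors, ∑ b ∈ N.divisors, ((a * b).totient : ℝ) * logWeight (a * b) =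
        a.totient * logWeight a * N + a.totient * (N * Real.log N) := by
      intro a ha
      rw [← ihN, ← htot N, Finset.mul_sum, Finset.mul_sum, ← Finset.sum_add_distrib]
      refine Finset.sum_congr rfl fun b hb => ?_
      have hab : a.Coprime b := (h.coprime_dvd_left (Nat.dvd_of_mem_divisors ha)).coprime_dvd_right
        (Nat.dvd_of_mem_divisors hb)
      rw [Nat.totient_mul hab, logWeight_mul (Nat.pos_of_mem_divisors ha).ne'
        (Nat.pos_of_mem_divisors hb).ne' hab]
      push_cast
      ring
    rw [Finset.sum_congr rfl hterm, Finset.sum_add_distrib, ← Finset.sum_mul, ← Finset.sum_mul,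
      ihM, htot, Nat.cast_mul, Real.log_mul (by positivity) (by positivity)]
    ring

/-- Each fraction `k / N` has a unique form `r / d` in lowest terms. -/
lemma sum_divisors_residues {N : ℕ} (hN : 0 < N) (f : ℝ → ℝ) :
    ∑ d ∈ N.divisors, ∑ r ∈ residues d, f (r / d) = ∑ k ∈ Finset.Icc 1 N, f (k / N) := by
  rw [Finset.sum_sigma']
  refine Finset.sum_bij' (fun x _ => x.2 * (N / x.1))
    (fun k _ => ⟨N / k.gcd N, k / k.gcd N⟩) ?_ ?_ ?_ ?_ ?_
  · rintro ⟨d, r⟩ h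
    simp only [Finset.mem_sigma, residues, Finset.mem_filter, Finset.mem_Icc] at h
    obtain ⟨hd, ⟨h1, h2⟩, h3⟩ := h
    obtain ⟨e, rfl⟩ := Nat.dvd_of_mem_divisors hd
    have hd0 := Nat.pos_of_mem_divisors hd
    have he : 0 < e := Nat.pos_of_mul_pos_left hN
    simp only [Nat.mul_div_cancel_left _ hd0, Finset.mem_Icc]
    exact ⟨Nat.mul_pos h1 he, Nat.mul_le_mul_right _ h2⟩
  · intro k hk
    rw [Finset.mem_Icc] at hk
    have hg : 0 < k.gcd N := Nat.gcd_pos_of_pos_right _ hN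
    simp only [Finset.mem_sigma, residues, Finset.mem_filter, Finset.mem_Icc, Nat.mem_divisors]
    refine ⟨⟨Nat.div_dvd_of_dvd (Nat.gcd_dvd_right _ _), hN.ne'⟩, ⟨?_, ?_⟩, ?_⟩
    · exact Nat.div_pos (Nat.gcd_le_left _ hk.1) hg
    · exact Nat.div_le_div_right hk.2
    · exact Nat.coprime_div_gcd_div_gcd hg
  · rintro ⟨d, r⟩ h
    simp only [Finset.mem_sigma, residues, Finset.mem_filter, Finset.mem_Icc] at h
    obtain ⟨hd, ⟨h1, h2⟩, h3⟩ := h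
    obtain ⟨e, rfl⟩ := Nat.dvd_of_mem_divisors hd
    have hd0 := Nat.pos_of_mem_divisors hd
    have he : 0 < e := Nat.pos_of_mul_pos_left hN
    have hgcd : (r * e).gcd (d * e) = e := by rw [Nat.gcd_mul_right, h3, one_mul]
    simp only [Nat.mul_div_cancel_left _ hd0, hgcd, Nat.mul_div_cancel _ he]
  · intro k hk
    have hg : 0 < k.gcd N := Nat.gcd_pos_of_pos_right _ hN
    obtain ⟨e, he⟩ := Nat.gcd_dvd_right k N
    have h1 : N / k.gcd N = e := Nat.div_eq_of_eq_mul_right hg he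
    have he0 : 0 < e := by
      rcases Nat.eq_zero_or_pos e with h0 | h0
      · rw [h0] at he; omega
      · exact h0
    have h2 : N / e = k.gcd N := Nat.div_eq_of_eq_mul_left he0 he
    simp only [h1, h2]
    exact Nat.div_mul_cancel (Nat.gcd_dvd_left _ _)
  · rintro ⟨d, r⟩ h
    simp only [Finset.mem_sigma] at h
    obtain ⟨e, he⟩ := Nat.dvd_of_mem_divisors h.1
    have hd0 := Nat.pos_of_mem_divisors h.1
    have he0 : 0 < e := by
      rcases Nat.eq_zero_or_pos e with h0 | h0
      · rw [h0] at he; omega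
      · exact h0
    have h1 : N / d = e := Nat.div_eq_of_eq_mul_right hd0 he
    simp only [h1]
    congr 1
    rw [he]
    push_cast
    field_simp

lemma harmonic_mul (N m : ℕ) : ∑ n ∈ Finset.range m, ∑ k ∈ Finset.Icc 1 N, (1 : ℝ) / (k + n * N) =
    ((harmonic (N * m) : ℚ) : ℝ) := by
  induction m with
  | zero => simp
  | succ m ih =>
    rw [Finset.sum_range_succ, ih, Nat.mul_succ]
    simp only [harmonic]
    rw [Finset.sum_range_add]
    push_cast
    congr 1
    have h := Finset.sum_Ico_add' (fun k : ℕ => (1 : ℝ) / (k + m * N)) 0 N 1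
    rw [Nat.Ico_zero_eq_range, zero_add] at h
    rw [show Finset.Icc 1 N = Finset.Ico 1 (N + 1) from rfl, ← h]
    refine Finset.sum_congr rfl fun i _ => ?_
    push_cast
    rw [one_div]
    congr 1
    ring

/-- Summation over all divisors replaces coprime residues by all `k ≤ N`; then `1 / (k / N + n) = N
/ (k + n N)` runs once through the harmonic series up to `N m`. -/
lemma sum_divisors_harmonicDiff {N : ℕ} (hN : 0 < N) (m : ℕ) :
    ∑ d ∈ N.divisors, harmonicDiff (residues d) (fun r => (r : ℝ) / d) m =
      N * (((harmonic (N * m) : ℚ) : ℝ) - ((harmonic m : ℚ) : ℝ)) := by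
  have hN' : (N : ℝ) ≠ 0 := by positivity
  have h1 : ∀ n ∈ Finset.range m, ∑ d ∈ N.divisors, ∑ r ∈ residues d,
      (1 / ((r : ℝ) / d + n) - 1 / (1 + n)) =
      N * ∑ k ∈ Finset.Icc 1 N, (1 : ℝ) / (k + n * N) - N * (1 / (1 + n)) := by
    intro n _
    rw [sum_divisors_residues hN (fun x => 1 / (x + n) - 1 / (1 + n)), Finset.sum_sub_distrib,
      Finset.sum_const, Nat.card_Icc, Nat.add_sub_cancel, nsmul_eq_mul, Finset.mul_sum]
    congr 1
    refine Finset.sum_congr rfl fun k _ => ?_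
    rw [div_add' _ _ _ hN', one_div_div]
    ring
  simp only [harmonicDiff]
  rw [Finset.sum_comm, Finset.sum_congr rfl h1, Finset.sum_sub_distrib, ← Finset.mul_sum,
    ← Finset.mul_sum, harmonic_mul, ← mul_sub]
  congr 2
  simp only [harmonic]
  push_cast
  refine Finset.sum_congr rfl fun n _ => ?_
  rw [one_div, add_comm]

lemma tendsto_sum_divisors_harmonicDiff {N : ℕ} (hN : 0 < N) :
    Tendsto (fun m => ∑ d ∈ N.divisors, harmonicDiff (residues d) (fun r => (r : ℝ) / d) m)
      atTop (𝓝 (N * Real.log N)) := by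
  have h0 := Real.tendsto_harmonic_sub_log
  have h1 : Tendsto (fun m : ℕ => ((harmonic (N * m) : ℚ) : ℝ) - Real.log ((N * m : ℕ) : ℝ)) atTop
      (𝓝 Real.eulerMascheroniConstant) :=
    h0.comp (tendsto_id.const_mul_atTop' hN)
  have h2 := ((h1.sub h0).add_const (Real.log N)).const_mul (N : ℝ)
  rw [sub_self, zero_add] at h2
  refine h2.congr' ?_
  filter_upwards [eventually_gt_atTop 0] with m hm
  rw [sum_divisors_harmonicDiff hN, Nat.cast_mul,
    Real.log_mul (by positivity) (by positivity)]
  ring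

/-- The harmonic sums attached to `N` converge to `log C_N`. -/
lemma tendsto_harmonicDiff_residues {N : ℕ} (hN : 0 < N) :
    Tendsto (harmonicDiff (residues N) fun r => (r : ℝ) / N) atTop (𝓝 (Real.log (cNum N))) := by
  -- The sum over all divisors tends to `N log N`, since `H_{Nm} - H_m → log N`. Removing the known
  -- limits for proper divisors isolates the term of `N`.
  induction N using Nat.strong_induction_on with
  | _ N ih =>
    have h1 := tendsto_sum_divisors_harmonicDiff hN
    have h2 : Tendsto (fun m => ∑ d ∈ N.properDivisors,
        harmonicDiff (residues d) (fun r => (r : ℝ) / d) m) atTop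
        (𝓝 (∑ d ∈ N.properDivisors, Real.log (cNum d))) :=
      tendsto_finsetSum _ fun d hd => ih d (Nat.mem_properDivisors.1 hd).2
        (Nat.pos_of_mem_properDivisors hd)
    have h3 : ∑ d ∈ N.divisors, Real.log (cNum d) = N * Real.log N := by
      rw [← sum_divisors_totient_mul_logWeight]
      exact Finset.sum_congr rfl fun d hd => log_cNum (Nat.pos_of_mem_divisors hd).ne'
    have hsplit : ∀ f : ℕ → ℝ, ∑ d ∈ N.divisors, f d - ∑ d ∈ N.properDivisors, f d = f N := by
      intro f
      rw [← Nat.insert_self_properDivisors hN.ne', Finset.sum_insert Nat.self_notMem_properDivisors,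
        add_sub_cancel_right]
    have h4 := h1.sub h2
    rw [← h3, hsplit] at h4
    exact h4.congr fun m => hsplit _

lemma card_residues {N : ℕ} (hN : 2 ≤ N) : (residues N).card = N.totient := by
  rw [Nat.totient_eq_card_coprime]
  congr 1
  ext r
  simp only [residues, Finset.mem_filter, Finset.mem_Icc, Finset.mem_range, Nat.coprime_comm (m := N)]
  constructor
  · rintro ⟨⟨h1, h2⟩, h3⟩
    refine ⟨lt_of_le_of_ne h2 fun h => ?_, h3⟩
    rw [h, Nat.coprime_self] at h3
    omega
  · rintro ⟨h1, h2⟩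
    refine ⟨⟨Nat.pos_of_ne_zero fun h => ?_, h1.le⟩, h2⟩
    rw [h, Nat.coprime_zero_right] at h2
    omega

lemma lt_of_mem_residues {N r : ℕ} (hN : 2 ≤ N) (hr : r ∈ residues N) : 0 < r ∧ r < N := by
  simp only [residues, Finset.mem_filter, Finset.mem_Icc] at hr
  refine ⟨hr.1.1, lt_of_le_of_ne hr.1.2 fun h => ?_⟩
  rw [h, Nat.coprime_self] at hr
  omega

/-- The symmetry `r ↦ N - r` preserves the residues. It makes the exponent `b` half an integer, so
that only two types of singularity occur. -/
lemma sum_one_sub_residues {N : ℕ} (hN : 2 ≤ N) :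
    ∑ r ∈ residues N, (1 - (r : ℝ) / N) = N.totient / 2 := by
  have hN' : (N : ℝ) ≠ 0 := by positivity
  have hrefl : ∑ r ∈ residues N, (1 - (r : ℝ) / N) = ∑ r ∈ residues N, (r : ℝ) / N := by
    have hmem : ∀ r ∈ residues N, N - r ∈ residues N := by
      intro r hr
      have h1 := lt_of_mem_residues hN hr
      simp only [residues, Finset.mem_filter, Finset.mem_Icc] at hr ⊢
      exact ⟨⟨by omega, by omega⟩, (Nat.coprime_self_sub_left hr.1.2).2 hr.2⟩
    refine Finset.sum_bij' (fun r _ => N - r) (fun r _ => N - r) hmem hmem ?_ ?_ ?_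
    · intro r hr
      have h1 := lt_of_mem_residues hN hr
      omega
    · intro r hr
      have h1 := lt_of_mem_residues hN hr
      omega
    · intro r hr
      have h1 := lt_of_mem_residues hN hr
      rw [Nat.cast_sub h1.2.le]
      field_simp
  have hsum : ∑ r ∈ residues N, (1 - (r : ℝ) / N) + ∑ r ∈ residues N, (r : ℝ) / N =
      N.totient := by
    rw [← Finset.sum_add_distrib, ← card_residues hN]
    simp
  linarith

/-! ### The parameters `r / N_j` and the coefficients of the two series. -/

section

variable {k : ℕ} (N : Fin k → ℕ)

/-- The pairs `(j, r)` with `r` a residue coprime to `N j`. -/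
def params : Finset (Σ _ : Fin k, ℕ) := Finset.univ.sigma fun j => residues (N j)

/-- The hypergeometric parameter `r / N j` attached to a pair `(j, r)`. -/
def param (i : Σ _ : Fin k, ℕ) : ℝ := i.2 / N i.1

variable {N}

lemma mem_params {i : Σ _ : Fin k, ℕ} : i ∈ params N ↔ i.2 ∈ residues (N i.1) := by
  simp [params]

lemma param_mem (hN : ∀ j, 2 ≤ N j) {i : Σ _ : Fin k, ℕ} (hi : i ∈ params N) :
    0 < param N i ∧ param N i < 1 := by
  obtain ⟨h1, h2⟩ := lt_of_mem_residues (hN i.1) (mem_params.1 hi)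
  have h3 : (0 : ℝ) < N i.1 := by exact_mod_cast h1.trans h2
  refine ⟨div_pos (by exact_mod_cast h1) h3, ?_⟩
  rw [param, div_lt_one h3]
  exact_mod_cast h2

lemma one_mem_residues {M : ℕ} (hM : 2 ≤ M) : 1 ∈ residues M := by
  simp only [residues, Finset.mem_filter, Finset.mem_Icc]
  exact ⟨⟨le_rfl, by omega⟩, Nat.coprime_one_left _⟩

lemma sum_one_sub_param (hN : ∀ j, 2 ≤ N j) :
    ∑ i ∈ params N, (1 - param N i) = ((∑ j, (N j).totient : ℕ) : ℝ) / 2 := by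
  rw [params, Finset.sum_sigma]
  push_cast
  rw [Finset.sum_div]
  exact Finset.sum_congr rfl fun j _ => sum_one_sub_residues (hN j)

lemma harmonicDiff_params (m : ℕ) : harmonicDiff (params N) (param N) m =
    ∑ j, harmonicDiff (residues (N j)) (fun r => (r : ℝ) / N j) m := by
  simp only [harmonicDiff]
  rw [Finset.sum_comm (s := Finset.univ)]
  refine Finset.sum_congr rfl fun n _ => ?_
  rw [params, Finset.sum_sigma]
  rfl

lemma cNum_pos {M : ℕ} (hM : 0 < M) : 0 < cNum M :=
  Nat.mul_pos (pow_pos hM _) (Finset.prod_pos fun _ hp =>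
    pow_pos (Nat.prime_of_mem_primeFactors hp).pos _)

lemma cVec_pos (hN : ∀ j, 2 ≤ N j) : 0 < cVec N :=
  Finset.prod_pos fun j _ => cNum_pos (by linarith [hN j])

lemma tendsto_harmonicDiff_params (hN : ∀ j, 2 ≤ N j) :
    Tendsto (harmonicDiff (params N) (param N)) atTop (𝓝 (Real.log (cVec N))) := by
  have h1 : Real.log (cVec N) = ∑ j, Real.log (cNum (N j)) := by
    rw [cVec, Nat.cast_prod, Real.log_prod]
    exact fun j _ => by exact_mod_cast (cNum_pos (by linarith [hN j])).ne'
  rw [h1]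
  refine (tendsto_finsetSum Finset.univ fun j _ =>
    tendsto_harmonicDiff_residues (N := N j) (by linarith [hN j])).congr fun m => ?_
  rw [harmonicDiff_params]

lemma hCoeff_eq {M : ℕ} (hM : 2 ≤ M) (m : ℕ) :
    hCoeff M m = (harmonicDiff (residues M) (fun r => (r : ℝ) / M) m : ℂ) := by
  rw [hCoeff, harmonicDiff, ← card_residues hM]
  simp only [harm]
  push_cast
  rw [Finset.sum_comm, Finset.mul_sum, ← Finset.sum_sub_distrib]
  refine Finset.sum_congr rfl fun n _ => ?_
  rw [Finset.sum_sub_distrib, Finset.sum_const, nsmul_eq_mul]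

lemma hVec_eq (hN : ∀ j, 2 ≤ N j) (m : ℕ) :
    hVec N m = (harmonicDiff (params N) (param N) m : ℂ) := by
  rw [hVec, harmonicDiff_params]
  push_cast
  exact Finset.sum_congr rfl fun j _ => hCoeff_eq (hN j) m

lemma bVec_eq (m : ℕ) : bVec N m = (cVec N : ℂ) ^ m *
    ((∏ i ∈ params N, ((ascPochhammer ℝ m).eval (param N i) / m.factorial) : ℝ) : ℂ) := by
  rw [bVec, cVec, params, Finset.prod_sigma]
  push_cast
  rw [← Finset.prod_pow, ← Finset.prod_mul_distrib]
  refine Finset.prod_congr rfl fun j _ => ?_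
  rw [bCoeff]
  congr 1
  refine Finset.prod_congr rfl fun r _ => ?_
  congr 1
  have h := Polynomial.eval₂_at_apply Complex.ofRealHom (param N ⟨j, r⟩) (p := ascPochhammer ℝ m)
  rw [← Polynomial.eval_map, ascPochhammer_map] at h
  simpa [param] using h

/-- The numerator `1` is always a residue, so the least parameter comes from the largest modulus. -/
lemma eq_one_div_maxN (hk : 0 < k) (hN : ∀ j, 2 ≤ N j) {a : ℝ}
    (hle : ∀ i ∈ params N, a ≤ param N i) (hex : ∃ i ∈ params N, a = param N i) :
    a = 1 / maxN N := by
  have : Nonempty (Fin k) := ⟨⟨0, hk⟩⟩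
  obtain ⟨j, -, hj⟩ := Finset.exists_mem_eq_sup Finset.univ Finset.univ_nonempty N
  have hM : maxN N = N j := hj
  refine le_antisymm ?_ ?_
  · have := hle ⟨j, 1⟩ (mem_params.2 (one_mem_residues (hN j)))
    simpa [param, hM] using this
  · obtain ⟨i, hi, rfl⟩ := hex
    obtain ⟨h1, h2⟩ := lt_of_mem_residues (hN i.1) (mem_params.1 hi)
    have h3 : N i.1 ≤ maxN N := Finset.le_sup (f := N) (Finset.mem_univ i.1)
    have h4 : (0 : ℝ) < N i.1 := by exact_mod_cast h1.trans h2
    exact div_le_div₀ (by positivity) (by exact_mod_cast h1) h4 (by exact_mod_cast h3)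

end

/-! ### Back to the variable `z`. -/

lemma mem_slit_iff {c : ℝ} (hc : 0 < c) (z : ℂ) : z ∈ slit (1 / c) ↔ c * z ∈ unitSlit := by
  rw [slit, mem_compl_iff, not_iff_comm, unitSlit, mem_ofPred_eq, Complex.mem_slitPlane_iff,
    not_or, not_lt, not_not]
  simp only [Complex.sub_re, Complex.one_re, Complex.re_ofReal_mul, Complex.sub_im, Complex.one_im,
    Complex.im_ofReal_mul, zero_sub, neg_eq_zero, mul_eq_zero, hc.ne', false_or]
  constructor
  · rintro ⟨h1, h2⟩
    refine ⟨z.re, ?_, Complex.ext rfl (by simpa using h2.symm)⟩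
    rw [mem_Ici, div_le_iff₀ hc]
    linarith
  · rintro ⟨x, hx, rfl⟩
    rw [mem_Ici, div_le_iff₀ hc] at hx
    simp
    linarith

lemma tendsto_mul_slit {c : ℝ} (hc : 0 < c) :
    Tendsto (fun z : ℂ => c * z) (Bornology.cobounded ℂ ⊓ 𝓟 (slit (1 / c)))
      (Bornology.cobounded ℂ ⊓ 𝓟 unitSlit) := by
  refine tendsto_inf.2 ⟨tendsto_inf_left ?_, tendsto_inf_right (tendsto_principal_principal.2
    fun z hz => (mem_slit_iff hc z).1 hz)⟩
  rw [← tendsto_norm_atTop_iff_cobounded]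
  simp only [norm_mul]
  exact tendsto_norm_cobounded_atTop.const_mul_atTop (by simpa using hc.ne')

section

variable {k : ℕ} {N : Fin k → ℕ} {b a e : ℝ} {g : ℂ → ℂ}

lemma hasSum_bVec (h : IsKernel b a e g) (hr : HasLaplaceRecurrence (params N) (param N) b a g)
    {z : ℂ} (hz : ‖cVec N * z‖ < 1) :
    HasSum (fun m : ℕ => bVec N m * z ^ m) (stieltjes (density b g) (cVec N * z)) := by
  refine (hasSum_stieltjes h.integrableOn_density hz).congr_fun fun m => ?_
  have h1 : ∫ x in Ioi (0 : ℝ), density b g x * Real.exp (-(m * x)) = laplace b g m := rfl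
  rw [h1, laplace_natCast h hr, bVec_eq, mul_pow]
  ring

/-- Since `ℒ'(0) = -log C`, the harmonic coefficient times `ℒ(m)` equals `ℒ'(m) + log C · ℒ(m)`; the
first term sums to the transform of the logarithmic density. -/
lemma hasSum_hVec (h : IsKernel b a e g) (hr : HasLaplaceRecurrence (params N) (param N) b a g)
    (ha : ∀ i ∈ params N, a ≤ param N i) (hN : ∀ j, 2 ≤ N j) {z : ℂ} (hz : ‖cVec N * z‖ < 1) :
    HasSum (fun m : ℕ => hVec N m * bVec N m * z ^ m)
      (stieltjes (logDensity b g) (cVec N * z) +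
        Real.log (cVec N) * stieltjes (density b g) (cVec N * z)) := by
  have hlog : laplaceDeriv b g 0 = -Real.log (cVec N) := by
    have := tendsto_nhds_unique (tendsto_harmonicDiff h hr ha) (tendsto_harmonicDiff_params hN)
    linarith
  refine ((hasSum_stieltjes h.integrableOn_logDensity hz).add
    ((hasSum_bVec h hr hz).mul_left _)).congr_fun fun m => ?_
  have h1 := laplaceDeriv_natCast h hr ha m
  have h2 : laplaceDeriv b g m =
      (harmonicDiff (params N) (param N) m - Real.log (cVec N)) * laplace b g m := by
    rw [div_eq_iff (h.laplace_pos (by linarith [h.a_pos, (Nat.cast_nonneg m : (0 : ℝ) ≤ m)])).ne',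
      hlog] at h1
    rw [h1]; ring
  rw [integral_logDensity_mul_exp, h2, laplace_natCast h hr, hVec_eq hN, bVec_eq, mul_pow]
  push_cast
  ring

/-- The continuation of the canonical coordinate to the slit plane. -/
def continuedCoordinate (c : ℝ) (b : ℝ) (g : ℂ → ℂ) (z : ℂ) : ℂ :=
  c * z * Complex.exp (stieltjes (logDensity b g) (c * z) / stieltjes (density b g) (c * z))

lemma IsKernel.analyticOnNhd_continuedCoordinate (h : IsKernel b a e g) {c : ℝ} (hc : 0 < c) :
    AnalyticOnNhd ℂ (continuedCoordinate c b g) (slit (1 / c)) := by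
  have hw : AnalyticOnNhd ℂ
      (fun w => w * Complex.exp (stieltjes (logDensity b g) w / stieltjes (density b g) w))
      unitSlit :=
    (differentiableOn_id.mul (((differentiableOn_stieltjes h.integrableOn_logDensity).div
      (differentiableOn_stieltjes h.integrableOn_density) fun w hw =>
        stieltjes_ne_zero h.integrableOn_density (fun x hx => h.density_pos hx) hw).cexp)).analyticOnNhd
      isOpen_unitSlit
  intro z hz
  exact (hw _ ((mem_slit_iff hc z).1 hz)).fun_comp (f := fun z : ℂ => c * z)
    (analyticAt_const.mul analyticAt_id)

end

end CanonicalCoordinate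

end

theorem theorem3 (k : ℕ) (hk : 0 < k) (N : Fin k → ℕ) (hN : ∀ j, 2 ≤ N j) :
    -- `q_𝐍` is well defined on the disk `|z| < 1 / C_𝐍`
    (∀ z : ℂ, ‖z‖ < 1 / (CanonicalCoordinate.cVec N : ℝ) →
      Summable (fun m : ℕ => CanonicalCoordinate.bVec N m * z ^ m) ∧
      Summable (fun m : ℕ =>
        CanonicalCoordinate.hVec N m * CanonicalCoordinate.bVec N m * z ^ m) ∧
      CanonicalCoordinate.fSer N z ≠ 0) ∧
    ∃ Q : ℂ → ℂ,
      -- (i) `Q` is the analytic continuation of `q_𝐍` to the slit plane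
      (AnalyticOnNhd ℂ Q (CanonicalCoordinate.slit (1 / (CanonicalCoordinate.cVec N : ℝ))) ∧
        ∀ z : ℂ, ‖z‖ < 1 / (CanonicalCoordinate.cVec N : ℝ) →
          Q z = CanonicalCoordinate.qFun N z) ∧
      -- (ii) `1 / C_𝐍` is a branch point
      CanonicalCoordinate.IsBranchPoint Q
        (CanonicalCoordinate.slit (1 / (CanonicalCoordinate.cVec N : ℝ)))
        (1 / (CanonicalCoordinate.cVec N : ℂ)) ∧
      -- (iii) the limit at infinity off the cut
      Filter.Tendsto Q
        (Bornology.cobounded ℂ ⊓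
          Filter.principal (CanonicalCoordinate.slit (1 / (CanonicalCoordinate.cVec N : ℝ))))
        (nhds (-((Real.exp
          (-(Real.pi * Real.cot (Real.pi / (CanonicalCoordinate.maxN N : ℝ)))) : ℝ) : ℂ))) := by
  open CanonicalCoordinate in
  have hC : (0 : ℝ) < cVec N := by exact_mod_cast cVec_pos hN
  have hC' : ((cVec N : ℕ) : ℂ) = ((cVec N : ℝ) : ℂ) := by push_cast; rfl
  have hne : (params N).Nonempty := ⟨⟨⟨0, hk⟩, 1⟩, mem_params.2 (one_mem_residues (hN _))⟩
  obtain ⟨a, e, g, h, hle, hex, hr⟩ := exists_kernel hne fun i hi => param_mem hN hi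
  have ha : a = 1 / maxN N := eq_one_div_maxN hk hN hle hex
  have ha1 : a < 1 := by
    obtain ⟨i, hi, hai⟩ := hex
    rw [hai]
    exact (param_mem hN hi).2
  have hn : 0 < ∑ j, (N j).totient :=
    Finset.sum_pos (fun j _ => Nat.totient_pos.2 (by linarith [hN j])) ⟨⟨0, hk⟩, Finset.mem_univ _⟩
  -- The value of the exponent as half the positive integer `∑ φ(N_j)` matters only here.
  obtain ⟨A, B, j, E, hpair⟩ := h.exists_isLocalPair hr.zero hn (sum_one_sub_param hN)
  generalize ∑ i ∈ params N, (1 - param N i) = b at h hr hpair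
  have hdisk : ∀ z : ℂ, ‖z‖ < 1 / (cVec N : ℝ) → ‖(cVec N : ℂ) * z‖ < 1 := by
    intro z hz
    rw [lt_div_iff₀ hC] at hz
    rw [norm_mul, Complex.norm_natCast, mul_comm]
    exact hz
  have hslit : ∀ z : ℂ, ‖z‖ < 1 / (cVec N : ℝ) → (cVec N : ℂ) * z ∈ unitSlit := by
    intro z hz
    left
    have h1 := (Complex.re_le_norm _).trans_lt (hdisk z hz)
    simp only [Complex.sub_re, Complex.one_re]
    linarith
  have hF : ∀ z : ℂ, ‖z‖ < 1 / (cVec N : ℝ) → stieltjes (density b g) (cVec N * z) ≠ 0 :=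
    fun z hz => stieltjes_ne_zero h.integrableOn_density (fun x hx => h.density_pos hx) (hslit z hz)
  refine ⟨fun z hz => ⟨(hasSum_bVec h hr (hdisk z hz)).summable,
    (hasSum_hVec h hr hle hN (hdisk z hz)).summable, ?_⟩, continuedCoordinate (cVec N) b g,
    ⟨h.analyticOnNhd_continuedCoordinate hC, fun z hz => ?_⟩, ?_, ?_⟩
  · rw [fSer, (hasSum_bVec h hr (hdisk z hz)).tsum_eq]
    exact hF z hz
  -- The summand `log C` of `G / F` exponentiates to the factor `C` that turns `z` into `w = C z`.
  · rw [qFun, gSer, fSer, (hasSum_bVec h hr (hdisk z hz)).tsum_eq,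
      (hasSum_hVec h hr hle hN (hdisk z hz)).tsum_eq, add_div, mul_div_cancel_right₀ _ (hF z hz),
      Complex.exp_add, ← Complex.ofReal_exp, Real.exp_log hC, continuedCoordinate, ← hC']
    ring
  · rw [hC']
    exact hpair.isBranchPoint.comp_mul (by exact_mod_cast hC.ne') (mem_slit_iff hC)
  · have h1 := (h.tendsto_infinity ha1).comp (tendsto_mul_slit hC)
    rw [ha, mul_one_div] at h1
    exact h1
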